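/- Fix $n\ge 1$ and write $\mathcal F f(\xi)=(2\pi)^{-n/2}\int_{\mathbb R^n} f(x)e^{-ix\cdot\xi}\,dx$. For $s>1$ let $\mathcal S_s(\mathbb R^n)=\bigcup_{h>0}\mathcal S_{s,h}(\mathbb R^n)$ be the Gelfand–Shilov space (smooth $f:\mathbb R^n\to\mathbb C$ with $\sup_x|x^\alpha\partial^\beta f(x)|\le Ch^{|\alpha|+|\beta|}(\alpha!\beta!)^s$ for all $\alpha,\beta$, with some $C,h>0$), and $\mathcal S_s'=\bigcap_{h>0}\mathcal S_{s,h}'$ the space of linear functionals on $\mathcal S_s$ that are bounded on each $\mathcal S_{s,h}$. Let $\rho:\mathbb R^n\to[0,1]$ be a smooth function supported in $[-1,1]^n$ with $\rho(\xi)=1$ for $|\xi|\le\frac12$ and $\sum_{k\in\mathbb Z^n}\rho(\xi-k)>0$ for all $\xi$; put $\sigma_k(\xi)=\rho(\xi-k)/\sum_{m\in\mathbb Z^n}\rho(\xi-m)$ and $\Box_k f=\mathcal F^{-1}(\sigma_k\mathcal F f)$. If $\rho\in\mathcal S_s(\mathbb R^n)$, then for $1\le p,q\le\infty$ the Gevrey-modulation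 space is $$\mathcal{GM}^{p,q}_s=\Big\{f\in\mathcal S_s':\ \|f\|_{\mathcal{GM}^{p,q}_s}=\Big(\sum_{k\in\mathbb Z^n}e^{q|k|^{1/s}}\|\Box_kf\|_{L^p}^q\Big)^{1/q}<\infty\Big\}$$ (supremum over $k$ if $q=\infty$). For $R>0$ and $\epsilon\in\{0,1\}^n$ let $$P_R(\epsilon)=\{\xi\in\mathbb R^n:\operatorname{sgn}\xi_j=(-1)^{\epsilon_j},\ j=1,\dots,n\}\setminus[-R,R]^n,\qquad \mathcal{GM}^{p,q}_s(\epsilon,R)=\{f\in\mathcal{GM}^{p,q}_s:\operatorname{supp}\mathcal Ff\subset P_R(\epsilon)\}.$$ **Proposition.** Let $1\le p\le\infty$ and let $\rho$ be as above. There is a constant $C_0>0$, depending only on $p$, $n$ and $\rho$, such that the following holds for every $s>1$ with $\rho\in\mathcal S_s(\mathbb R^n)$, all $1\le q,q'\le\infty$ with $\frac1q+\frac1{q'}=1$, and every $\delta$ with $0<\delta\le 2-2^{1/s}$. Put $$D(R)=C_0\Big(s\,\omega_n(\delta q')^{-sn}\int_{\delta q'R^{1/s}}^\infty y^{sn-1}e^{-y}\,dy\Big)^{1/q'},$$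 where $\omega_n$ is the surface area of the unit sphere of $\mathbb R^n$ and where for $q'=\infty$ the expression is read as its limit $C_0e^{-\delta R^{1/s}}$. Then $D(R)\to0$ as $R\to\infty$. Moreover, for every $\epsilon\in\{0,1\}^n$ and $R>0$, the set $\mathcal{GM}^{p,q}_s(\epsilon,R)$ is a subalgebra of $\mathcal{GM}^{p,q}_s$: it is a linear subspace, and any $f,g\in\mathcal{GM}^{p,q}_s(\epsilon,R)$ are essentially bounded functions whose pointwise product $fg$ again belongs to $\mathcal{GM}^{p,q}_s(\epsilon,R)$, with $$\|fg\|_{\mathcal{GM}^{p,q}_s}\le D(R)\,\|f\|_{\mathcal{GM}^{p,q}_s}\|g\|_{\mathcal{GM}^{p,q}_s}.$$ -/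

import Mathlib

open Set Filter Topology MeasureTheory
open scoped ENNReal

noncomputable section

namespace GevreyModulation

/-! ### The Gelfand–Shilov space and its dual -/

/-- `f` belongs to the space `S_{s,h}(ℝⁿ)` with `S_{s,h}`-norm at most `C`:
`|x|ᵏ |Dˡ f(x)| ≤ C h^(k+l) (k! l!)ˢ` for all orders `k, l` and all `x`.
As for Mathlib's Schwartz space, powers of the norm and full derivatives are used instead of
monomials and partial derivatives; since `α! ≤ |α|! ≤ n^|α| α!`, this only changes the
parameter `h` by a factor that depends on `n` and `s`. -/
def GSBound {n : ℕ} (s h C : ℝ) (f : EuclideanSpace ℝ (Fin n) → ℂ) : Prop :=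
  ∀ (k l : ℕ) (x : EuclideanSpace ℝ (Fin n)),
    ‖x‖ ^ k * ‖iteratedFDeriv ℝ l f x‖ ≤ C * h ^ (k + l) * ((k.factorial : ℝ) * (l.factorial : ℝ)) ^ s

/-- The Gelfand–Shilov space `S_s(ℝⁿ) = ⋃_{h > 0} S_{s,h}(ℝⁿ)`. -/
def GelfandShilov (n : ℕ) (s : ℝ) : Submodule ℂ (EuclideanSpace ℝ (Fin n) → ℂ) where
  carrier := {f | ContDiff ℝ (⊤ : ℕ∞) f ∧ ∃ h C : ℝ, 0 < h ∧ GSBound s h C f}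
  zero_mem' := by
    refine ⟨contDiff_const, 1, 0, one_pos, fun k l x => ?_⟩
    simp
  add_mem' := by
    rintro f g ⟨hf, h₁, C₁, hh₁, hb₁⟩ ⟨hg, h₂, C₂, hh₂, hb₂⟩
    have key : ∀ (C h : ℝ) (f : EuclideanSpace ℝ (Fin n) → ℂ), 0 < h → h ≤ max h₁ h₂ →
        GSBound s h C f → GSBound s (max h₁ h₂) |C| f := by
      intro C h f h0 hle hb k l x
      refine (hb k l x).trans ?_
      have h1 : (0 : ℝ) ≤ ((k.factorial : ℝ) * (l.factorial : ℝ)) ^ s := by positivity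
      have h2 : h ^ (k + l) ≤ (max h₁ h₂) ^ (k + l) := pow_le_pow_left₀ h0.le hle _
      have h3 : (0 : ℝ) ≤ h ^ (k + l) := by positivity
      exact mul_le_mul_of_nonneg_right
        (mul_le_mul (le_abs_self C) h2 h3 (abs_nonneg C)) h1
    have e₁ := key C₁ h₁ f hh₁ (le_max_left _ _) hb₁
    have e₂ := key C₂ h₂ g hh₂ (le_max_right _ _) hb₂
    refine ⟨hf.add hg, max h₁ h₂, |C₁| + |C₂|, lt_max_of_lt_left hh₁, fun k l x => ?_⟩
    have hl : ((l : ℕ∞) : WithTop ℕ∞) ≤ ((⊤ : ℕ∞) : WithTop ℕ∞) := by exact_mod_cast le_top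
    rw [iteratedFDeriv_add_apply (hf.of_le hl).contDiffAt (hg.of_le hl).contDiffAt]
    calc ‖x‖ ^ k * ‖iteratedFDeriv ℝ l f x + iteratedFDeriv ℝ l g x‖
        ≤ ‖x‖ ^ k * ‖iteratedFDeriv ℝ l f x‖ + ‖x‖ ^ k * ‖iteratedFDeriv ℝ l g x‖ := by
          rw [← mul_add]
          exact mul_le_mul_of_nonneg_left (norm_add_le _ _) (by positivity)
      _ ≤ _ := by
          have := add_le_add (e₁ k l x) (e₂ k l x)
          linarith
  smul_mem' := by
    rintro c f ⟨hf, h, C, hh, hb⟩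
    refine ⟨contDiff_const.smul hf, h, ‖c‖ * C, hh, fun k l x => ?_⟩
    have hl : ((l : ℕ∞) : WithTop ℕ∞) ≤ ((⊤ : ℕ∞) : WithTop ℕ∞) := by exact_mod_cast le_top
    rw [iteratedFDeriv_const_smul_apply (hf.of_le hl).contDiffAt, norm_smul]
    have := mul_le_mul_of_nonneg_left (hb k l x) (norm_nonneg c)
    linarith

/-- The space `S_s'(ℝⁿ) = ⋂_{h > 0} S_{s,h}'(ℝⁿ)` of Gelfand–Shilov distributions: the linear
functionals on `S_s` that are bounded on each of the normed spaces `S_{s,h}`. -/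
def GelfandShilovDual (n : ℕ) (s : ℝ) : Submodule ℂ (GelfandShilov n s →ₗ[ℂ] ℂ) where
  carrier := {T | ∀ h : ℝ, 0 < h → ∃ K : ℝ, ∀ (φ : GelfandShilov n s) (C : ℝ),
    GSBound s h C (φ : EuclideanSpace ℝ (Fin n) → ℂ) → ‖T φ‖ ≤ K * C}
  zero_mem' := fun h _ => ⟨0, fun φ C _ => by simp⟩
  add_mem' := by
    intro T U hT hU h hh
    obtain ⟨K, hK⟩ := hT h hh
    obtain ⟨L, hL⟩ := hU h hh
    refine ⟨K + L, fun φ C hC => ?_⟩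
    have := (norm_add_le (T φ) (U φ)).trans (add_le_add (hK φ C hC) (hL φ C hC))
    rw [LinearMap.add_apply]
    linarith
  smul_mem' := by
    intro c T hT h hh
    obtain ⟨K, hK⟩ := hT h hh
    refine ⟨‖c‖ * K, fun φ C hC => ?_⟩
    rw [LinearMap.smul_apply, norm_smul, mul_assoc]
    exact mul_le_mul_of_nonneg_left (hK φ C hC) (norm_nonneg c)

open Classical in
/-- The (bilinear) pairing `⟨T, g⟩` of `T ∈ S_s'` with `g ∈ S_s`. The value `0` outside `S_s` is
never relevant: below, `g` is always the Fourier transform of an element of `S_s`, and `S_s` is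
invariant under the Fourier transform. -/
def pair {n : ℕ} {s : ℝ} (T : GelfandShilovDual n s) (g : EuclideanSpace ℝ (Fin n) → ℂ) : ℂ :=
  if h : g ∈ GelfandShilov n s then (T : GelfandShilov n s →ₗ[ℂ] ℂ) ⟨g, h⟩ else 0

/-- The Fourier transform `F f(ξ) = (2π)^(-n/2) ∫ f(x) e^(-i x·ξ) dx`. -/
def fourierT {n : ℕ} (f : EuclideanSpace ℝ (Fin n) → ℂ) (ξ : EuclideanSpace ℝ (Fin n)) : ℂ :=
  (((2 * Real.pi) ^ (-(n : ℝ) / 2) : ℝ) : ℂ) *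
    ∫ x, f x * Complex.exp (-(Complex.I * ((inner ℝ x ξ : ℝ) : ℂ)))

/-- The support of the Fourier transform `F T` of `T ∈ S_s'`, where `⟨F T, φ⟩ = ⟨T, F φ⟩`: the
points without a neighbourhood on which `F T` vanishes. -/
def fourierSupport {n : ℕ} {s : ℝ} (T : GelfandShilovDual n s) :
    Set (EuclideanSpace ℝ (Fin n)) :=
  {ξ | ∀ U : Set (EuclideanSpace ℝ (Fin n)), IsOpen U → ξ ∈ U →
    ∃ φ ∈ GelfandShilov n s, HasCompactSupport φ ∧ tsupport φ ⊆ U ∧ pair T (fourierT φ) ≠ 0}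

/-! ### The frequency-uniform decomposition -/

/-- The lattice point `k ∈ ℤⁿ` as a point of `ℝⁿ`. -/
def latticePt {n : ℕ} (k : Fin n → ℤ) : EuclideanSpace ℝ (Fin n) :=
  WithLp.toLp 2 (fun i => (k i : ℝ))

/-- The generating function `ρ : ℝⁿ → [0,1]` of a frequency-uniform decomposition. -/
structure IsDecompositionWindow {n : ℕ} (ρ : EuclideanSpace ℝ (Fin n) → ℝ) : Prop where
  contDiff : ContDiff ℝ (⊤ : ℕ∞) ρ
  mem_Icc : ∀ ξ, ρ ξ ∈ Icc (0 : ℝ) 1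
  tsupport_subset : tsupport ρ ⊆ {ξ | ∀ i, |ξ i| ≤ 1}
  eq_one : ∀ ξ, ‖ξ‖ ≤ 1 / 2 → ρ ξ = 1
  /-- The (locally finite) sum by which one divides has no zero. -/
  sum_pos : ∀ ξ, 0 < ∑' k : Fin n → ℤ, ρ (ξ - latticePt k)

/-- `σ_k(ξ) = ρ(ξ - k) / ∑_m ρ(ξ - m)`. -/
def sigma {n : ℕ} (ρ : EuclideanSpace ℝ (Fin n) → ℝ) (k : Fin n → ℤ)
    (ξ : EuclideanSpace ℝ (Fin n)) : ℝ :=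
  ρ (ξ - latticePt k) / ∑' m : Fin n → ℤ, ρ (ξ - latticePt m)

/-- The uniform decomposition operator `□_k T = F⁻¹(σ_k F T)`. As `σ_k` is compactly supported
this is the function `□_k T(x) = (2π)^(-n/2) ⟨F T, σ_k e^(i x·)⟩`. -/
def box {n : ℕ} {s : ℝ} (ρ : EuclideanSpace ℝ (Fin n) → ℝ) (k : Fin n → ℤ)
    (T : GelfandShilovDual n s) (x : EuclideanSpace ℝ (Fin n)) : ℂ :=
  (((2 * Real.pi) ^ (-(n : ℝ) / 2) : ℝ) : ℂ) *
    pair T (fourierT fun η =>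
      (sigma ρ k η : ℂ) * Complex.exp (Complex.I * ((inner ℝ x η : ℝ) : ℂ)))

/-! ### Gevrey-modulation spaces -/

/-- The weighted `Lᵖ`-norm `e^(|k|^(1/s)) ‖□_k T‖_{Lᵖ}` of a frequency block. -/
def blockNorm {n : ℕ} {s : ℝ} (ρ : EuclideanSpace ℝ (Fin n) → ℝ) (p : ℝ≥0∞)
    (T : GelfandShilovDual n s) (k : Fin n → ℤ) : ℝ≥0∞ :=
  ENNReal.ofReal (Real.exp (‖(latticePt k : EuclideanSpace ℝ (Fin n))‖ ^ (1 / s))) *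
    eLpNorm (box ρ k T) p volume

/-- The norm `(∑_k e^(q |k|^(1/s)) ‖□_k T‖_{Lᵖ}^q)^(1/q)`, with a supremum for `q = ∞`;
its value is `∞` if `T` does not belong to the Gevrey-modulation space. -/
def gmNorm {n : ℕ} {s : ℝ} (ρ : EuclideanSpace ℝ (Fin n) → ℝ) (p q : ℝ≥0∞)
    (T : GelfandShilovDual n s) : ℝ≥0∞ :=
  if q = ∞ then ⨆ k, blockNorm ρ p T k
  else (∑' k, blockNorm ρ p T k ^ q.toReal) ^ (1 / q.toReal)

/-- The Gevrey-modulation space `GM^{p,q}_s(ℝⁿ)`. -/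
def GMSpace {n : ℕ} (ρ : EuclideanSpace ℝ (Fin n) → ℝ) (s : ℝ) (p q : ℝ≥0∞) :
    Set (GelfandShilovDual n s) :=
  {T | gmNorm ρ p q T < ∞}

/-- The cube `P_R`. -/
def cubeP {n : ℕ} (R : ℝ) : Set (EuclideanSpace ℝ (Fin n)) := {ξ | ∀ j, |ξ j| ≤ R}

/-- The orthant piece `P_R(ε)`. -/
def orthantP {n : ℕ} (ε : Fin n → Fin 2) (R : ℝ) : Set (EuclideanSpace ℝ (Fin n)) :=
  {ξ | ∀ j, Real.sign (ξ j) = (-1) ^ (ε j : ℕ)} \ cubeP R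

/-- The space `GM^{p,q}_s(ε, R)`. -/
def GMPiece {n : ℕ} (ρ : EuclideanSpace ℝ (Fin n) → ℝ) (s : ℝ) (p q : ℝ≥0∞)
    (ε : Fin n → Fin 2) (R : ℝ) : Set (GelfandShilovDual n s) :=
  {T | T ∈ GMSpace ρ s p q ∧ fourierSupport T ⊆ orthantP ε R}

/-- `T ∈ S_s'` is (integration against) the essentially bounded function `u`. -/
def IsRepresentedBy {n : ℕ} {s : ℝ} (T : GelfandShilovDual n s)
    (u : EuclideanSpace ℝ (Fin n) → ℂ) : Prop :=
  MemLp u ∞ volume ∧ ∀ φ : GelfandShilov n s,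
    (T : GelfandShilov n s →ₗ[ℂ] ℂ) φ = ∫ x, u x * (φ : EuclideanSpace ℝ (Fin n) → ℂ) x

/-- `W` is the pointwise product of `T` and `U`: the latter two are bounded functions, and `W` is
the product of these functions. -/
def IsProduct {n : ℕ} {s : ℝ} (T U W : GelfandShilovDual n s) : Prop :=
  ∃ u v : EuclideanSpace ℝ (Fin n) → ℂ,
    IsRepresentedBy T u ∧ IsRepresentedBy U v ∧ IsRepresentedBy W (fun x => u x * v x)

/-! ### The algebra constant -/

/-- The surface area of the unit sphere of `ℝⁿ`. -/
def omegaN (n : ℕ) : ℝ :=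
  ((volume : Measure (EuclideanSpace ℝ (Fin n))).toSphere).real Set.univ

/-- The constant `D(R)`. For `q' = ∞` the expression is to be read as the limit
`C₀ e^(-δ R^(1/s))` of the one for finite exponents. -/
def algebraConst (n : ℕ) (C₀ s δ : ℝ) (q' : ℝ≥0∞) (R : ℝ) : ℝ :=
  if q' = ∞ then C₀ * Real.exp (-(δ * R ^ (1 / s)))
  else C₀ * (s * omegaN n * (δ * q'.toReal) ^ (-(s * n)) *
    ∫ y in Ioi (δ * q'.toReal * R ^ (1 / s)), y ^ (s * n - 1) * Real.exp (-y)) ^ (1 / q'.toReal)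

end GevreyModulation

end

open GevreyModulation

namespace GevreyModulation

/-! The estimate rests on a strict form of the subadditivity of `t ↦ t^θ`, `θ = 1/s < 1`: by
concavity `(x+y)^θ + (2 - 2^θ) min(x,y)^θ ≤ x^θ + y^θ` (`rpow_add_le_of_le`). Hence, for `k` within
bounded distance of `l + m`, the weight `e^(|k|^θ)` is at most a constant times `e^(|l|^θ)
e^(|m|^θ)` times a gain `e^(-δ|l|^θ) + e^(-δ|m|^θ)`.

The block `□_k (fg)` only sees the products `□_l f · □_m g` with `l + m - k` in a fixed box
(`integral_box_mul_box_eq_zero`). Bernstein's inequality bounds one factor in `L^∞`, and Young's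
inequality removes the outer projection. What remains is a discrete bilinear estimate: `ℓ¹ * ℓ^q ⊆
ℓ^q`, with Hölder's inequality spending the gain (`seqNorm_bilinear_le`). The constant is the
`ℓ^(q')`-norm of `e^(-δ|m|^θ)` over those `m` whose cube meets `P_R(ε)`, as all other blocks of `f`
and `g` vanish. Pushing these cubes outwards within the orthant compares that norm with an integral
over `|y| > R`, which is `D(R)` in polar coordinates (`seqNorm_pieceWeight_le`).

The same Hölder argument makes `∑ ‖□_l f‖_∞` finite, so `f` is the bounded continuous function `∑
□_l f` (`isRepresentedBy_blockSum`) and products can be expanded block by block. The Fourier support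
of a product lies in the sum of the Fourier supports, and coordinates of equal sign cannot cancel,
so the sum stays in `P_R(ε)` (`IsProduct.fourierSupport_subset`).

These manipulations take place in `S_s'`. They need the Gevrey calculus of `S_s` (products,
inverses, Fourier transform) with constants uniform on each `S_{s,h}`, and the rule that functionals
commute with convolution integrals (`pair_conv`), from which the exchange formula
`pair_fourierT_mul` follows. -/

/-- The Euclidean space `ℝⁿ`. -/
abbrev Space (n : ℕ) := EuclideanSpace ℝ (Fin n)

/-! ### Gevrey bounds and factorial inequalities -/

/-- Gevrey bounds `|Dˡ f| ≤ C hˡ (l!)ˢ`. -/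
def GevBound {n : ℕ} {F : Type*} [NormedAddCommGroup F] [NormedSpace ℝ F] (s h C : ℝ)
    (f : Space n → F) : Prop :=
  ∀ (l : ℕ) (x : Space n), ‖iteratedFDeriv ℝ l f x‖ ≤ C * h ^ l * (l.factorial : ℝ) ^ s

/-- Because `l! = (l choose j) j! (l-j)!` and `s ≥ 1`, a binomial coefficient is at most its `s`-th
power. Leibniz sums therefore lose only their number of terms. -/
lemma choose_mul_factorial_rpow_le {s : ℝ} (hs : 1 ≤ s) {j l : ℕ} (hj : j ≤ l) :
    (l.choose j : ℝ) * ((j.factorial : ℝ) ^ s * ((l - j).factorial : ℝ) ^ s)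
      ≤ (l.factorial : ℝ) ^ s := by
  have h1 : (l.factorial : ℝ) = (l.choose j : ℝ) * ((j.factorial : ℝ) * ((l - j).factorial : ℝ)) := by
    have := Nat.choose_mul_factorial_mul_factorial hj
    rw [← this]; push_cast; ring
  have hb : (1 : ℝ) ≤ (l.choose j : ℝ) := by exact_mod_cast Nat.choose_pos hj
  rw [h1, Real.mul_rpow (by positivity) (by positivity),
    Real.mul_rpow (by positivity) (by positivity)]
  gcongr
  calc (l.choose j : ℝ) = (l.choose j : ℝ) ^ (1 : ℝ) := (Real.rpow_one _).symm
    _ ≤ _ := Real.rpow_le_rpow_of_exponent_le hb hs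

lemma factorial_rpow_mono {s : ℝ} (hs : 0 ≤ s) {j l : ℕ} (hj : j ≤ l) :
    (j.factorial : ℝ) ^ s ≤ (l.factorial : ℝ) ^ s :=
  Real.rpow_le_rpow (by positivity) (by exact_mod_cast Nat.factorial_le hj) hs

/-- Raising an order by `N` costs a geometric factor, which can be absorbed into the parameter `h`.
-/
lemma factorial_add_rpow_le {s : ℝ} (hs : 0 ≤ s) (k N : ℕ) :
    ((k + N).factorial : ℝ) ^ s
      ≤ ((2 : ℝ) ^ s) ^ (k + N) * ((k.factorial : ℝ) ^ s * (N.factorial : ℝ) ^ s) := by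
  have h1 : ((k + N).factorial : ℝ) ≤ 2 ^ (k + N) * ((k.factorial : ℝ) * (N.factorial : ℝ)) := by
    have := Nat.add_choose_mul_factorial_mul_factorial k N
    have h2 : (k + N).choose N ≤ 2 ^ (k + N) := Nat.choose_le_two_pow _ _
    have h3 : (k + N).factorial ≤ 2 ^ (k + N) * (k.factorial * N.factorial) := by
      rw [← this, mul_assoc]; gcongr
    exact_mod_cast h3
  calc ((k + N).factorial : ℝ) ^ s
      ≤ (2 ^ (k + N) * ((k.factorial : ℝ) * (N.factorial : ℝ))) ^ s :=
        Real.rpow_le_rpow (by positivity) h1 hs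
    _ = _ := by
      rw [Real.mul_rpow (by positivity) (by positivity),
        Real.mul_rpow (by positivity) (by positivity), ← Real.rpow_natCast, ← Real.rpow_mul (by norm_num),
        mul_comm _ s, Real.rpow_mul (by norm_num), Real.rpow_natCast]

/-! ### Products, decay and integrability in `S_s` -/

section Bounds

variable {n : ℕ} {s h C : ℝ} {f g : Space n → ℂ}

lemma GSBound.nonneg (hf : GSBound s h C f) : 0 ≤ C := by
  have := hf 0 0 0
  simp only [pow_zero, Nat.factorial_zero, Nat.cast_one, mul_one, Real.one_rpow, add_zero,
    one_mul] at this
  exact (norm_nonneg _).trans this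

lemma GSBound.mono {h' C' : ℝ} (hf : GSBound s h C f) (h0 : 0 ≤ h) (hh : h ≤ h') (hC : C ≤ C') :
    GSBound s h' C' f := by
  intro k l x
  have := hf.nonneg
  have := this.trans hC
  refine (hf k l x).trans ?_
  gcongr

lemma GSBound.gevBound (hf : GSBound s h C f) : GevBound s h C f := by
  intro l x
  simpa using hf 0 l x

lemma GevBound.nonneg {F : Type*} [NormedAddCommGroup F] [NormedSpace ℝ F] {f : Space n → F}
    (hf : GevBound s h C f) : 0 ≤ C := by
  have := hf 0 0
  simp only [pow_zero, Nat.factorial_zero, Nat.cast_one, mul_one, Real.one_rpow] at this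
  exact (norm_nonneg _).trans this

lemma GevBound.mono {F : Type*} [NormedAddCommGroup F] [NormedSpace ℝ F] {f : Space n → F}
    {h' C' : ℝ} (hf : GevBound s h C f) (h0 : 0 ≤ h) (hh : h ≤ h') (hC : C ≤ C') :
    GevBound s h' C' f := by
  intro l x
  have := hf.nonneg
  have := this.trans hC
  refine (hf l x).trans ?_
  gcongr

/-- A function of `S_s` times a smooth function with Gevrey bounds. -/
lemma GSBound.mul_gevBound {h₁ C₁ h₂ C₂ : ℝ} (hs : 1 ≤ s) (h₁0 : 0 ≤ h₁) (h₂0 : 0 ≤ h₂)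
    (hfs : ContDiff ℝ (⊤ : ℕ∞) f) (hgs : ContDiff ℝ (⊤ : ℕ∞) g)
    (hf : GevBound s h₁ C₁ f) (hg : GSBound s h₂ C₂ g) :
    GSBound s (2 * max h₁ h₂) (C₁ * C₂) (fun x => f x * g x) := by
  intro k l x
  set H := max h₁ h₂ with hH
  have hH0 : 0 ≤ H := le_max_of_le_left h₁0
  have hC₁ := hf.nonneg
  have hC₂ := hg.nonneg
  have key := norm_iteratedFDeriv_mul_le (𝕜 := ℝ) (N := (⊤ : ℕ∞)) hfs hgs x (n := l)
    (by exact_mod_cast le_top)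
  calc ‖x‖ ^ k * ‖iteratedFDeriv ℝ l (fun x => f x * g x) x‖
      ≤ ‖x‖ ^ k * ∑ i ∈ Finset.range (l + 1), (l.choose i : ℝ) * ‖iteratedFDeriv ℝ i f x‖ *
          ‖iteratedFDeriv ℝ (l - i) g x‖ := by gcongr
    _ = ∑ i ∈ Finset.range (l + 1), (l.choose i : ℝ) * ‖iteratedFDeriv ℝ i f x‖ *
          (‖x‖ ^ k * ‖iteratedFDeriv ℝ (l - i) g x‖) := by
        rw [Finset.mul_sum]; exact Finset.sum_congr rfl fun i _ => by ring
    _ ≤ ∑ i ∈ Finset.range (l + 1), C₁ * C₂ * H ^ (k + l) *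
          ((k.factorial : ℝ) * (l.factorial : ℝ)) ^ s := by
        refine Finset.sum_le_sum fun i hi => ?_
        have hil : i ≤ l := Nat.lt_succ_iff.mp (Finset.mem_range.mp hi)
        have e := choose_mul_factorial_rpow_le hs hil
        calc (l.choose i : ℝ) * ‖iteratedFDeriv ℝ i f x‖ *
              (‖x‖ ^ k * ‖iteratedFDeriv ℝ (l - i) g x‖)
            ≤ (l.choose i : ℝ) * (C₁ * H ^ i * (i.factorial : ℝ) ^ s) *
              (C₂ * H ^ (k + (l - i)) * ((k.factorial : ℝ) * ((l - i).factorial : ℝ)) ^ s) := by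
              have a1 : ‖iteratedFDeriv ℝ i f x‖ ≤ C₁ * H ^ i * (i.factorial : ℝ) ^ s := by
                refine (hf i x).trans ?_
                gcongr
                exact le_max_left _ _
              have a2 : ‖x‖ ^ k * ‖iteratedFDeriv ℝ (l - i) g x‖ ≤
                  C₂ * H ^ (k + (l - i)) * ((k.factorial : ℝ) * ((l - i).factorial : ℝ)) ^ s := by
                refine (hg k (l - i) x).trans ?_
                gcongr
                exact le_max_right _ _
              exact mul_le_mul (mul_le_mul_of_nonneg_left a1 (by positivity)) a2 (by positivity)
                (by positivity)
          _ = C₁ * C₂ * H ^ (k + l) * (k.factorial : ℝ) ^ s * ((l.choose i : ℝ) *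
                ((i.factorial : ℝ) ^ s * ((l - i).factorial : ℝ) ^ s)) := by
              rw [Real.mul_rpow (by positivity) (by positivity),
                show k + l = i + (k + (l - i)) by omega, pow_add]
              ring
          _ ≤ C₁ * C₂ * H ^ (k + l) * (k.factorial : ℝ) ^ s * (l.factorial : ℝ) ^ s := by gcongr
          _ = _ := by rw [Real.mul_rpow (by positivity) (by positivity)]; ring
    _ = (l + 1 : ℕ) * (C₁ * C₂ * H ^ (k + l) * ((k.factorial : ℝ) * (l.factorial : ℝ)) ^ s) := by
        simp
    -- The `l + 1` terms of the Leibniz sum are paid for by doubling the parameter.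
    _ ≤ 2 ^ (k + l) * (C₁ * C₂ * H ^ (k + l) * ((k.factorial : ℝ) * (l.factorial : ℝ)) ^ s) := by
        gcongr
        have h1 : l + 1 ≤ 2 ^ l := Nat.lt_two_pow_self
        have h2 : 2 ^ l ≤ 2 ^ (k + l) := Nat.pow_le_pow_right (by norm_num) (by omega)
        exact_mod_cast h1.trans h2
    _ = _ := by rw [mul_pow]; ring

/-- A bound that is uniform in the order of the derivative, with extra decay. -/
lemma GSBound.decay (hs : 0 ≤ s) (h0 : 0 ≤ h) (N : ℕ) :
    ∃ K : ℝ, 0 ≤ K ∧ ∀ (f : Space n → ℂ) (C : ℝ), GSBound s h C f → ∀ k l x,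
      (1 + ‖x‖) ^ N * (‖x‖ ^ k * ‖iteratedFDeriv ℝ l f x‖)
        ≤ K * C * (h * 2 ^ s) ^ (k + l) * ((k.factorial : ℝ) * (l.factorial : ℝ)) ^ s := by
  refine ⟨2 ^ N * (1 + h ^ N * (2 ^ s) ^ N * (N.factorial : ℝ) ^ s), by positivity,
    fun f C hf k l x => ?_⟩
  have hC := hf.nonneg
  have h2s : (1 : ℝ) ≤ 2 ^ s := Real.one_le_rpow (by norm_num) hs
  have e1 : (1 + ‖x‖) ^ N ≤ 2 ^ N * (1 + ‖x‖ ^ N) := by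
    have : 1 + ‖x‖ ≤ 2 * max 1 ‖x‖ := by
      linarith [le_max_left 1 ‖x‖, le_max_right 1 ‖x‖]
    calc (1 + ‖x‖) ^ N ≤ (2 * max 1 ‖x‖) ^ N := by gcongr
      _ = 2 ^ N * (max 1 ‖x‖) ^ N := mul_pow _ _ _
      _ ≤ _ := by
        gcongr
        rcases max_choice 1 ‖x‖ with h | h <;> rw [h]
        · rw [one_pow]; linarith [pow_nonneg (norm_nonneg x) N]
        · linarith
  have e2 := hf k l x
  -- The bound at order `k + N` supplies the additional weight `‖x‖^N`.
  have e3 := hf (k + N) l x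
  have e4 := factorial_add_rpow_le hs k N
  rw [Real.mul_rpow (by positivity) (by positivity)] at e2 e3 ⊢
  set D := ‖iteratedFDeriv ℝ l f x‖
  have e5 : ‖x‖ ^ k * D ≤ C * (h * 2 ^ s) ^ (k + l) *
      ((k.factorial : ℝ) ^ s * (l.factorial : ℝ) ^ s) := by
    refine e2.trans ?_
    gcongr
    exact le_mul_of_one_le_right h0 h2s
  have e6 : ‖x‖ ^ (k + N) * D ≤ h ^ N * (2 ^ s) ^ N * (N.factorial : ℝ) ^ s *
      (C * (h * 2 ^ s) ^ (k + l) * ((k.factorial : ℝ) ^ s * (l.factorial : ℝ) ^ s)) := by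
    calc ‖x‖ ^ (k + N) * D ≤ C * h ^ (k + N + l) * ((((2 : ℝ) ^ s) ^ (k + N) *
          ((k.factorial : ℝ) ^ s * (N.factorial : ℝ) ^ s)) * (l.factorial : ℝ) ^ s) := by
          refine e3.trans ?_
          gcongr
      _ = (h ^ N * (2 ^ s) ^ N * (N.factorial : ℝ) ^ s) * (C * (h ^ (k + l) * ((2 : ℝ) ^ s) ^ k) *
          ((k.factorial : ℝ) ^ s * (l.factorial : ℝ) ^ s)) := by
          rw [pow_add, pow_add, pow_add, pow_add]; ring
      _ ≤ _ := by
          rw [mul_pow h]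
          gcongr
          omega
  calc (1 + ‖x‖) ^ N * (‖x‖ ^ k * D) ≤ (2 ^ N * (1 + ‖x‖ ^ N)) * (‖x‖ ^ k * D) := by gcongr
    _ = 2 ^ N * (‖x‖ ^ k * D + ‖x‖ ^ (k + N) * D) := by rw [pow_add]; ring
    _ ≤ 2 ^ N * (C * (h * 2 ^ s) ^ (k + l) * ((k.factorial : ℝ) ^ s * (l.factorial : ℝ) ^ s) +
          h ^ N * (2 ^ s) ^ N * (N.factorial : ℝ) ^ s *
      (C * (h * 2 ^ s) ^ (k + l) * ((k.factorial : ℝ) ^ s * (l.factorial : ℝ) ^ s))) := by gcongr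
    _ = _ := by ring

lemma GelfandShilov.continuous (hf : f ∈ GelfandShilov n s) : Continuous f := hf.1.continuous

lemma integrable_one_add_norm_pow (n : ℕ) :
    Integrable (fun x : Space n => ((1 + ‖x‖) ^ (n + 1))⁻¹) := by
  have := integrable_one_add_norm (E := Space n) (μ := volume) (r := (n + 1 : ℕ)) (by simp)
  refine this.congr (Eventually.of_forall fun x => ?_)
  simp only
  rw [Real.rpow_neg (by positivity), Real.rpow_natCast]

lemma GSBound.integrable (hs : 0 ≤ s) (h0 : 0 ≤ h) (hfs : ContDiff ℝ (⊤ : ℕ∞) f)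
    (hf : GSBound s h C f) (k l : ℕ) :
    Integrable (fun x => ‖x‖ ^ k * ‖iteratedFDeriv ℝ l f x‖) := by
  obtain ⟨K, hK, hd⟩ := GSBound.decay (n := n) hs h0 (n + 1)
  refine ((integrable_one_add_norm_pow n).const_mul
    (K * C * (h * 2 ^ s) ^ (k + l) * ((k.factorial : ℝ) * (l.factorial : ℝ)) ^ s)).mono' ?_ ?_
  · have : Continuous (iteratedFDeriv ℝ l f) :=
      hfs.continuous_iteratedFDeriv (by exact_mod_cast le_top)
    exact (by fun_prop : Continuous fun x => ‖x‖ ^ k * ‖iteratedFDeriv ℝ l f x‖).aestronglyMeasurable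
  · refine Eventually.of_forall fun x => ?_
    rw [Real.norm_of_nonneg (by positivity), ← div_eq_mul_inv, le_div_iff₀ (by positivity), mul_comm]
    exact hd f C hf k l x

lemma GelfandShilov.integrable (hs : 0 ≤ s) (hf : f ∈ GelfandShilov n s) : Integrable f := by
  obtain ⟨hfs, h, C, h0, hb⟩ := hf
  have := hb.integrable hs h0.le hfs 0 0
  refine this.mono' hfs.continuous.aestronglyMeasurable (Eventually.of_forall fun x => ?_)
  simp

lemma GelfandShilov.mul_gev {h₁ C₁ : ℝ} (hs : 1 ≤ s) (h₁0 : 0 ≤ h₁)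
    (hfs : ContDiff ℝ (⊤ : ℕ∞) f) (hf : GevBound s h₁ C₁ f) (hg : g ∈ GelfandShilov n s) :
    (fun x => f x * g x) ∈ GelfandShilov n s := by
  obtain ⟨hgs, h, C, h0, hb⟩ := hg
  refine ⟨hfs.mul hgs, 2 * max h₁ h, C₁ * C, ?_, GSBound.mul_gevBound hs h₁0 h0.le hfs hgs hf hb⟩
  have := lt_max_of_lt_right (b := h₁) h0
  positivity

lemma GelfandShilov.mul (hs : 1 ≤ s) (hf : f ∈ GelfandShilov n s) (hg : g ∈ GelfandShilov n s) :
    (fun x => f x * g x) ∈ GelfandShilov n s := by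
  obtain ⟨hfs, h, C, h0, hb⟩ := hf
  exact GelfandShilov.mul_gev hs h0.le hfs hb.gevBound hg

/-- A compactly supported function with Gevrey bounds belongs to `S_s`. -/
lemma GevBound.gsBound_of_support (hf : GevBound s h C f) (hs : 0 ≤ s) (h0 : 0 ≤ h) {r : ℝ} (hr : 1 ≤ r)
    (hsupp : ∀ x, f x ≠ 0 → ‖x‖ ≤ r) : GSBound s (max h r) C f := by
  intro k l x
  have hC := hf.nonneg
  by_cases hx : iteratedFDeriv ℝ l f x = 0
  · rw [hx, norm_zero, mul_zero]
    have : 0 ≤ max h r := le_max_of_le_left h0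
    positivity
  · have hxr : ‖x‖ ≤ r := by
      have h1 : x ∈ tsupport f := support_iteratedFDeriv_subset (𝕜 := ℝ) l hx
      have h2 : tsupport f ⊆ Metric.closedBall 0 r :=
        closure_minimal (fun y hy => by simpa using hsupp y hy) Metric.isClosed_closedBall
      simpa using h2 h1
    have hk : (1 : ℝ) ≤ (k.factorial : ℝ) ^ s :=
      Real.one_le_rpow (by exact_mod_cast Nat.succ_le_of_lt k.factorial_pos) hs
    rw [Real.mul_rpow (by positivity) (by positivity), pow_add]
    calc ‖x‖ ^ k * ‖iteratedFDeriv ℝ l f x‖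
        ≤ (max h r) ^ k * (C * (max h r) ^ l * (l.factorial : ℝ) ^ s) := by
          gcongr
          · exact hxr.trans (le_max_right _ _)
          · refine (hf l x).trans ?_
            gcongr
            exact le_max_left _ _
      _ = C * ((max h r) ^ k * (max h r) ^ l) * (1 * (l.factorial : ℝ) ^ s) := by ring
      _ ≤ _ := by
          have : 0 ≤ max h r := le_max_of_le_left h0
          gcongr

end Bounds

/-! ### Invariance of `S_s` under the Fourier transform -/

section FourierBounds

set_option maxSynthPendingDepth 3

open VectorFourier ContinuousMultilinearMap Real in
/-- A sharp form of `VectorFourier.norm_iteratedFDeriv_fourierPowSMulRight`. -/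
lemma norm_iteratedFDeriv_fourierPowSMulRight_le_sum {V W E : Type*} [NormedAddCommGroup V]
    [NormedSpace ℝ V] [NormedAddCommGroup W] [NormedSpace ℝ W] [NormedAddCommGroup E]
    [NormedSpace ℂ E] (L : V →L[ℝ] W →L[ℝ] ℝ)
    {f : V → E} {K : WithTop ℕ∞} (hf : ContDiff ℝ K f) {n : ℕ} {k : ℕ} (hk : k ≤ K) (v : V) :
    ‖iteratedFDeriv ℝ k (fun v ↦ fourierPowSMulRight L f v n) v‖ ≤
      (2 * π) ^ n * ∑ i ∈ Finset.range (k + 1),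
      k.choose i * (n.descFactorial i * ‖L‖ ^ n * ‖v‖ ^ (n - i)) *
        ‖iteratedFDeriv ℝ (k - i) f v‖ := by
  simp_rw [fourierPowSMulRight_eq_comp]
  let T : (W →L[ℝ] ℝ) [×n]→L[ℝ] (W [×n]→L[ℝ] ℝ) :=
    compContinuousLinearMapLRight (ContinuousMultilinearMap.mkPiAlgebra ℝ (Fin n) ℝ)
  have I₁ m : ‖iteratedFDeriv ℝ m T (fun _ ↦ L v)‖ ≤
      n.descFactorial m * 1 * (‖L‖ * ‖v‖) ^ (n - m) := by
    have : ‖T‖ ≤ 1 := by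
      apply (norm_compContinuousLinearMapLRight_le _ _).trans
      simp only [norm_mkPiAlgebra, le_refl]
    apply (ContinuousMultilinearMap.norm_iteratedFDeriv_le _ _ _).trans
    simp only [Fintype.card_fin]
    gcongr
    refine (pi_norm_le_iff_of_nonneg (by positivity)).mpr (fun _ ↦ ?_)
    exact ContinuousLinearMap.le_opNorm _ _
  have I₂ m : ‖iteratedFDeriv ℝ m (T ∘ (ContinuousLinearMap.pi (fun (_ : Fin n) ↦ L))) v‖ ≤
      (n.descFactorial m * 1 * (‖L‖ * ‖v‖) ^ (n - m)) * ‖L‖ ^ m := by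
    rw [ContinuousLinearMap.iteratedFDeriv_comp_right _ (ContinuousMultilinearMap.contDiff _)
      _ (mod_cast le_top)]
    apply (norm_compContinuousLinearMap_le _ _).trans
    simp only [Finset.prod_const, Finset.card_fin]
    gcongr
    · exact I₁ m
    · exact ContinuousLinearMap.norm_pi_le_of_le (fun _ ↦ le_rfl) (norm_nonneg _)
  have I₃ m : ‖iteratedFDeriv ℝ m (T ∘ (ContinuousLinearMap.pi (fun (_ : Fin n) ↦ L))) v‖ ≤
      n.descFactorial m * ‖L‖ ^ n * ‖v‖ ^ (n - m) := by
    apply (I₂ m).trans (le_of_eq _)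
    rcases le_or_gt m n with hm | hm
    · rw [show ‖L‖ ^ n = ‖L‖ ^ (m + (n - m)) by rw [Nat.add_sub_cancel' hm], pow_add]
      ring
    · simp only [Nat.descFactorial_eq_zero_iff_lt.mpr hm, CharP.cast_eq_zero, mul_one, zero_mul]
  have A : ContDiff ℝ K (fun y ↦ T (fun _ ↦ L y)) :=
    (ContinuousMultilinearMap.contDiff _).comp (contDiff_pi.2 fun _ ↦ L.contDiff)
  rw [iteratedFDeriv_const_smul_apply' (hf := ((smulRightL ℝ (fun _ ↦ W)
    E).isBoundedBilinearMap.contDiff.comp₂ (A.of_le hk) (hf.of_le hk)).contDiffAt),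
    norm_smul (β := V [×k]→L[ℝ] (W [×n]→L[ℝ] E))]
  simp only [norm_pow, norm_neg, Complex.norm_mul, Complex.norm_ofNat, Complex.norm_real,
    Real.norm_eq_abs, abs_of_nonneg pi_nonneg, Complex.norm_I, mul_one]
  gcongr
  apply (ContinuousLinearMap.norm_iteratedFDeriv_le_of_bilinear_of_le_one _ A hf _
    hk ContinuousMultilinearMap.norm_smulRightL_le).trans
  gcongr with i _hi
  exact I₃ i

variable {n : ℕ} {s h C : ℝ} {f g : Space n → ℂ}

/-- The bilinear form `x·ξ / (2π)`. -/
noncomputable def scaledInner (n : ℕ) : Space n →L[ℝ] Space n →L[ℝ] ℝ := (2 * Real.pi)⁻¹ • innerSL ℝ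

lemma scaledInner_apply (x ξ : Space n) : scaledInner n x ξ = (2 * Real.pi)⁻¹ * inner ℝ x ξ := rfl

/-- The normalizing constant `(2π)^(-n/2)`. -/
noncomputable def normConst (n : ℕ) : ℝ := (2 * Real.pi) ^ (-(n : ℝ) / 2)

lemma normConst_pos (n : ℕ) : 0 < normConst n := by unfold normConst; positivity

lemma fourierT_eq_vectorFourier (f : Space n → ℂ) :
    fourierT f = fun ξ => (normConst n : ℂ) * VectorFourier.fourierIntegral Real.fourierChar volume
      (scaledInner n).toLinearMap₁₂ f ξ := by
  funext ξ
  unfold fourierT normConst VectorFourier.fourierIntegral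
  congr 1
  refine integral_congr_ae (Eventually.of_forall fun x => ?_)
  -- `Real.fourierChar` is `t ↦ e^(2πit)`; the factor `(2π)⁻¹` in `scaledInner` turns it into `e^(-i
  -- x·ξ)`.
  change _ = Real.fourierChar (-((2 * Real.pi)⁻¹ * inner ℝ x ξ)) • f x
  rw [Circle.smul_def, Real.fourierChar_apply, smul_eq_mul, mul_comm]
  have := Real.pi_pos.ne'
  push_cast
  have : (Real.pi : ℂ) ≠ 0 := by exact_mod_cast this
  field_simp

-- Up to constants, `ξ^k D^l` of the transform of `f` is the transform of `D^k (x^l f)`, so the two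
-- indices of the bound trade places. Since `h'` and `K` do not depend on `f`, functionals of `S_s'`
-- stay bounded on each `S_{s,h}` after composition with the Fourier transform.
open VectorFourier in
lemma GSBound.exists_fourierT (n : ℕ) {s h : ℝ} (hs : 1 ≤ s) (h0 : 0 < h) :
    ∃ h' K : ℝ, 0 < h' ∧ 0 ≤ K ∧ ∀ (f : Space n → ℂ) (C : ℝ), ContDiff ℝ (⊤ : ℕ∞) f →
      GSBound s h C f → ContDiff ℝ (⊤ : ℕ∞) (fourierT f) ∧ GSBound s h' (K * C) (fourierT f) := by
  obtain ⟨K, hK, hd⟩ := GSBound.decay (n := n) (zero_le_one.trans hs) h0.le (n + 1)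
  set H := max (h * 2 ^ s) 1
  have hH : 1 ≤ H := le_max_right _ _
  set A := 2 * Real.pi * ‖scaledInner n‖ + 1 with hA
  have hA1 : 1 ≤ A := by rw [hA]; have := Real.pi_pos; linarith [show 0 ≤ 2 * Real.pi * ‖scaledInner n‖ by positivity]
  set J := ∫ x : Space n, ((1 + ‖x‖) ^ (n + 1))⁻¹
  have hJ : 0 ≤ J := integral_nonneg fun x => by positivity
  refine ⟨2 * (A * H), normConst n * (K * J), by positivity, ?_, fun f C hfs hf => ?_⟩
  · have := (normConst_pos n).le
    positivity
  have hC := hf.nonneg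
  have hint := hf.integrable (zero_le_one.trans hs) h0.le hfs
  have hcd : ContDiff ℝ (⊤ : ℕ∞) (fourierIntegral Real.fourierChar volume
      (scaledInner n).toLinearMap₁₂ f) :=
    contDiff_fourierIntegral _ fun k _ => by simpa using hint k 0
  rw [fourierT_eq_vectorFourier]
  refine ⟨contDiff_const.mul hcd, fun k l x => ?_⟩
  have hl : ((l : ℕ∞) : WithTop ℕ∞) ≤ ((⊤ : ℕ∞) : WithTop ℕ∞) := by exact_mod_cast le_top
  have hmul : iteratedFDeriv ℝ l (fun ξ => (normConst n : ℂ) * fourierIntegral Real.fourierChar volume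
      (scaledInner n).toLinearMap₁₂ f ξ) x = (normConst n : ℂ) • iteratedFDeriv ℝ l
      (fourierIntegral Real.fourierChar volume (scaledInner n).toLinearMap₁₂ f) x :=
    iteratedFDeriv_const_smul_apply (a := (normConst n : ℂ)) (hcd.of_le hl).contDiffAt
  rw [hmul, norm_smul, Complex.norm_real, Real.norm_of_nonneg (normConst_pos n).le]
  set D := iteratedFDeriv ℝ l (fourierIntegral Real.fourierChar volume
    (scaledInner n).toLinearMap₁₂ f) with hD
  -- Evaluating the multilinear map at `k` copies of `x` recovers the product; the common factor
  -- `‖x‖^k` is then cancelled, which is why `x = 0` is treated apart.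
  have e1 : ‖x‖ ^ k * ‖D x‖ ≤ ‖fourierPowSMulRight (-(scaledInner n).flip) D x k‖ := by
    rcases eq_or_ne x 0 with rfl | hx
    · rcases k.eq_zero_or_pos with rfl | hk
      · have := (fourierPowSMulRight (-(scaledInner n).flip) D 0 0).le_opNorm (fun _ => 0)
        simpa [fourierPowSMulRight_apply] using this
      · rw [norm_zero, zero_pow hk.ne', zero_mul]; exact norm_nonneg _
    · have hxp : 0 < ‖x‖ := norm_pos_iff.mpr hx
      have h1 := (fourierPowSMulRight (-(scaledInner n).flip) D x k).le_opNorm (fun _ => x)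
      have h2 : ‖fourierPowSMulRight (-(scaledInner n).flip) D x k (fun _ => x)‖
          = (‖x‖ ^ k * ‖D x‖) * ‖x‖ ^ k := by
        rw [fourierPowSMulRight_apply]
        simp only [neg_apply, ContinuousLinearMap.flip_apply, scaledInner_apply,
          Finset.prod_const, Finset.card_univ, Fintype.card_fin, real_inner_self_eq_norm_sq]
        rw [norm_smul, norm_smul, norm_pow, norm_pow, norm_neg, norm_neg]
        simp only [norm_mul, Complex.norm_ofNat, Complex.norm_real, Complex.norm_I, mul_one,
          Real.norm_eq_abs, abs_of_pos Real.pi_pos, norm_pow, norm_inv, abs_norm, abs_two]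
        rw [← mul_assoc, ← mul_pow, mul_right_comm (‖x‖ ^ k), ← mul_pow]
        congr 2
        have := Real.pi_pos.ne'
        field_simp
      rw [h2] at h1
      simp only [Finset.prod_const, Finset.card_univ, Fintype.card_fin] at h1
      exact le_of_mul_le_mul_right h1 (by positivity)
  -- Multiplication by powers of the frequency becomes differentiation under the integral.
  have e2 := fourierPowSMulRight_iteratedFDeriv_fourierIntegral (scaledInner n) (K := ⊤) (N := ⊤)
    hfs (fun k l _ _ => hint k l) (k := l) (n := k) le_top le_top (w := x)
  set M := (2 * (A * H)) ^ (k + l) * ((k.factorial : ℝ) * (l.factorial : ℝ)) ^ s with hM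
  have e3 : ∀ v, ‖iteratedFDeriv ℝ k (fun v => fourierPowSMulRight (scaledInner n) f v l) v‖
      ≤ K * C * M * ((1 + ‖v‖) ^ (n + 1))⁻¹ := by
    intro v
    refine (norm_iteratedFDeriv_fourierPowSMulRight_le_sum (scaledInner n) hfs
      (by exact_mod_cast le_top) v).trans ?_
    have hterm : ∀ i ∈ Finset.range (k + 1), (k.choose i : ℝ) * (l.descFactorial i *
        ‖scaledInner n‖ ^ l * ‖v‖ ^ (l - i)) * ‖iteratedFDeriv ℝ (k - i) f v‖ ≤
        (k.choose i : ℝ) * (‖scaledInner n‖ ^ l * (K * C * H ^ (k + l) *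
          ((k.factorial : ℝ) * (l.factorial : ℝ)) ^ s * ((1 + ‖v‖) ^ (n + 1))⁻¹)) := by
      intro i hi
      have hik : i ≤ k := Nat.lt_succ_iff.mp (Finset.mem_range.mp hi)
      rcases lt_or_ge l i with hli | hli
      · rw [Nat.descFactorial_eq_zero_iff_lt.mpr hli]
        simp only [Nat.cast_zero, zero_mul, mul_zero]
        positivity
      · have d1 := hd f C hf (l - i) (k - i) v
        -- Differentiating `v^l` repeatedly produces a falling factorial. It is the quotient
        -- `l!/(l-i)!`, so for `s ≥ 1` it merges with `((l-i)!)^s` into `(l!)^s`; a cruder power of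
        -- `l` would destroy the Gevrey bound.
        have d2 : (l.descFactorial i : ℝ) * ((l - i).factorial : ℝ) ^ s ≤ (l.factorial : ℝ) ^ s := by
          have h1 : ((l - i).factorial : ℝ) * (l.descFactorial i : ℝ) = l.factorial := by
            exact_mod_cast Nat.factorial_mul_descFactorial hli
          have h2 : (1 : ℝ) ≤ l.descFactorial i := by
            exact_mod_cast Nat.succ_le_of_lt (Nat.descFactorial_pos.mpr hli)
          rw [← h1, Real.mul_rpow (by positivity) (by positivity), mul_comm]
          gcongr
          calc (l.descFactorial i : ℝ) = (l.descFactorial i : ℝ) ^ (1 : ℝ) := (Real.rpow_one _).symm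
            _ ≤ _ := Real.rpow_le_rpow_of_exponent_le h2 hs
        have d3 : ((k - i).factorial : ℝ) ^ s ≤ (k.factorial : ℝ) ^ s :=
          factorial_rpow_mono (zero_le_one.trans hs) (Nat.sub_le _ _)
        rw [Real.mul_rpow (by positivity) (by positivity)] at d1 ⊢
        rw [mul_comm, ← le_div_iff₀ (by positivity), div_eq_mul_inv] at d1
        calc (k.choose i : ℝ) * (l.descFactorial i * ‖scaledInner n‖ ^ l * ‖v‖ ^ (l - i)) *
              ‖iteratedFDeriv ℝ (k - i) f v‖
            = (k.choose i : ℝ) * (‖scaledInner n‖ ^ l * (l.descFactorial i * (‖v‖ ^ (l - i) *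
              ‖iteratedFDeriv ℝ (k - i) f v‖))) := by ring
          _ ≤ (k.choose i : ℝ) * (‖scaledInner n‖ ^ l * (l.descFactorial i * (K * C *
              H ^ (k + l) * (((l - i).factorial : ℝ) ^ s * ((k - i).factorial : ℝ) ^ s)
                * ((1 + ‖v‖) ^ (n + 1))⁻¹))) := by
              refine mul_le_mul_of_nonneg_left (mul_le_mul_of_nonneg_left
                (mul_le_mul_of_nonneg_left (d1.trans ?_) (by positivity)) (by positivity))
                (by positivity)
              gcongr
              calc (h * 2 ^ s) ^ (l - i + (k - i)) ≤ H ^ (l - i + (k - i)) := by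
                    gcongr
                    exact le_max_left _ _
                _ ≤ H ^ (k + l) := pow_le_pow_right₀ hH (by omega)
          _ = (k.choose i : ℝ) * (‖scaledInner n‖ ^ l * (K * C * H ^ (k + l) *
              (((k - i).factorial : ℝ) ^ s * (l.descFactorial i * ((l - i).factorial : ℝ) ^ s))
                * ((1 + ‖v‖) ^ (n + 1))⁻¹)) := by ring
          _ ≤ _ := by gcongr
    calc (2 * Real.pi) ^ l * ∑ i ∈ Finset.range (k + 1), (k.choose i : ℝ) * (l.descFactorial i *
        ‖scaledInner n‖ ^ l * ‖v‖ ^ (l - i)) * ‖iteratedFDeriv ℝ (k - i) f v‖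
        ≤ (2 * Real.pi) ^ l * ∑ i ∈ Finset.range (k + 1), (k.choose i : ℝ) *
          (‖scaledInner n‖ ^ l * (K * C * H ^ (k + l) *
          ((k.factorial : ℝ) * (l.factorial : ℝ)) ^ s * ((1 + ‖v‖) ^ (n + 1))⁻¹)) := by
          gcongr ?_ * ?_
          exact Finset.sum_le_sum hterm
      _ = (2 : ℝ) ^ k * (2 * Real.pi * ‖scaledInner n‖) ^ l * (K * C * H ^ (k + l) *
          ((k.factorial : ℝ) * (l.factorial : ℝ)) ^ s * ((1 + ‖v‖) ^ (n + 1))⁻¹) := by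
          rw [← Finset.sum_mul]
          have : ∑ i ∈ Finset.range (k + 1), (k.choose i : ℝ) = 2 ^ k := by
            exact_mod_cast Nat.sum_range_choose k
          rw [this, mul_pow _ ‖scaledInner n‖]
          ring
      _ ≤ (2 : ℝ) ^ (k + l) * A ^ (k + l) * (K * C * H ^ (k + l) *
          ((k.factorial : ℝ) * (l.factorial : ℝ)) ^ s * ((1 + ‖v‖) ^ (n + 1))⁻¹) := by
          have p1 : (2 : ℝ) ^ k ≤ 2 ^ (k + l) := pow_le_pow_right₀ (by norm_num) (by omega)
          have p2 : (2 * Real.pi * ‖scaledInner n‖) ^ l ≤ A ^ (k + l) := by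
            have := Real.pi_pos
            calc (2 * Real.pi * ‖scaledInner n‖) ^ l ≤ A ^ l := by
                  gcongr
                  linarith
              _ ≤ _ := pow_le_pow_right₀ hA1 (by omega)
          gcongr
      _ = _ := by rw [hM, mul_pow, mul_pow]; ring
  have e4 : ‖x‖ ^ k * ‖D x‖ ≤ K * C * M * J := by
    refine e1.trans ?_
    rw [hD, e2]
    refine (norm_fourierIntegral_le_integral_norm _ _ _ _ _).trans ?_
    rw [← integral_const_mul]
    refine integral_mono_of_nonneg (Eventually.of_forall fun _ => norm_nonneg _) ?_
      (Eventually.of_forall e3)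
    exact (integrable_one_add_norm_pow n).const_mul _
  calc ‖x‖ ^ k * (normConst n * ‖D x‖) = normConst n * (‖x‖ ^ k * ‖D x‖) := by ring
    _ ≤ normConst n * (K * C * M * J) := by gcongr; exact (normConst_pos n).le
    _ = _ := by rw [hM]; ring

lemma GelfandShilov.fourierT (hs : 1 ≤ s) (hf : f ∈ GelfandShilov n s) :
    fourierT f ∈ GelfandShilov n s := by
  obtain ⟨hfs, h, C, h0, hb⟩ := hf
  obtain ⟨h', K, h'0, -, H⟩ := GSBound.exists_fourierT n hs h0
  obtain ⟨h1, h2⟩ := H f C hfs hb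
  exact ⟨h1, h', K * C, h'0, h2⟩

end FourierBounds

/-! ### Convolutions and translates in `S_s` -/

section Convolution

set_option maxSynthPendingDepth 3

variable {n : ℕ} {s h C : ℝ} {f g w : Space n → ℂ}

/-- The convolution `∫ w(y) g(x - y) dy`. -/
noncomputable def conv (w g : Space n → ℂ) (x : Space n) : ℂ := ∫ y, w y * g (x - y)

/-- Measurable functions with the decay of an element of `S_s`. -/
def HasDecay (s : ℝ) (w : Space n → ℂ) : Prop :=
  AEStronglyMeasurable w ∧ ∃ h C : ℝ, 0 < h ∧ ∀ k x, ‖x‖ ^ k * ‖w x‖ ≤ C * h ^ k * (k.factorial : ℝ) ^ s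

-- All derivatives fall on `g`, so `w` needs no smoothness. This matters later, when `w` is a block
-- times an element of `S_s`, of which only continuity and decay are used.
open ContinuousMultilinearMap in
lemma conv_taylor (hg : ContDiff ℝ (⊤ : ℕ∞) g) (hb : ∀ l : ℕ, ∃ B, ∀ x, ‖iteratedFDeriv ℝ l g x‖ ≤ B)
    (hw : Integrable w) :
    HasFTaylorSeriesUpTo (⊤ : ℕ∞) (conv w g)
      (fun x l => ∫ y, w y • iteratedFDeriv ℝ l g (x - y)) := by
  have hcont : ∀ l : ℕ, Continuous (iteratedFDeriv ℝ l g) := fun l =>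
    hg.continuous_iteratedFDeriv (by exact_mod_cast le_top)
  have hmeas : ∀ (l : ℕ) x, AEStronglyMeasurable (fun y => w y • iteratedFDeriv ℝ l g (x - y)) := by
    intro l x
    have := hcont l
    exact hw.1.smul (by fun_prop : Continuous fun y => iteratedFDeriv ℝ l g (x - y)).aestronglyMeasurable
  have hle : ∀ (l : ℕ) B, (∀ x, ‖iteratedFDeriv ℝ l g x‖ ≤ B) → ∀ x y,
      ‖w y • iteratedFDeriv ℝ l g (x - y)‖ ≤ ‖w y‖ * B := by
    intro l B hB x y
    rw [norm_smul]
    gcongr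
    exact hB _
  have hint : ∀ (l : ℕ) x, Integrable (fun y => w y • iteratedFDeriv ℝ l g (x - y)) := by
    intro l x
    obtain ⟨B, hB⟩ := hb l
    exact (hw.norm.mul_const B).mono' (hmeas l x) (Eventually.of_forall (hle l B hB x))
  have hder : ∀ (l : ℕ) x, HasFDerivAt (fun x => ∫ y, w y • iteratedFDeriv ℝ l g (x - y))
      (∫ y, w y • iteratedFDeriv ℝ (l + 1) g (x - y)).curryLeft x := by
    intro l x
    obtain ⟨B, hB⟩ := hb (l + 1)
    let e := continuousMultilinearCurryLeftEquiv ℝ (fun _ : Fin (l + 1) => Space n) ℂ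
    have e1 : (∫ y, w y • iteratedFDeriv ℝ (l + 1) g (x - y)).curryLeft
        = ∫ y, (w y • iteratedFDeriv ℝ (l + 1) g (x - y)).curryLeft := by
      exact (e.toContinuousLinearEquiv.toContinuousLinearMap.integral_comp_comm (hint (l + 1) x)).symm
    rw [e1]
    refine hasFDerivAt_integral_of_dominated_of_fderiv_le (𝕜 := ℝ) (s := univ)
      (F' := fun x y => (w y • iteratedFDeriv ℝ (l + 1) g (x - y)).curryLeft) (bound := fun y => ‖w y‖ * B)
      univ_mem (Eventually.of_forall fun x => hmeas l x) (hint l x) ?_ ?_ (hw.norm.mul_const B) ?_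
    · exact e.toContinuousLinearEquiv.toContinuousLinearMap.continuous.comp_aestronglyMeasurable
        (hmeas (l + 1) x)
    · refine Eventually.of_forall fun y x _ => ?_
      have : ‖(w y • iteratedFDeriv ℝ (l + 1) g (x - y)).curryLeft‖ =
        ‖w y • iteratedFDeriv ℝ (l + 1) g (x - y)‖ := e.norm_map _
      rw [this]
      exact hle (l + 1) B hB x y
    · refine Eventually.of_forall fun y x _ => ?_
      have h1 : HasFDerivAt (iteratedFDeriv ℝ l g) (iteratedFDeriv ℝ (l + 1) g (x - y)).curryLeft
          (x - y) := by
        have h2 := (hg.ftaylorSeries.fderiv l (by exact_mod_cast ENat.natCast_lt_top l) (x - y))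
        exact h2
      have h3 := (h1.comp x ((hasFDerivAt_id x).sub_const y)).const_smul (w y)
      exact h3
  refine ⟨fun x => ?_, fun l _ x => hder l x, fun l _ => ?_⟩
  · rw [curry0_apply, ContinuousMultilinearMap.integral_apply (hint 0 x)]
    simp [conv]
  · exact continuous_iff_continuousAt.mpr fun x => (hder l x).continuousAt

lemma contDiff_conv (hg : ContDiff ℝ (⊤ : ℕ∞) g)
    (hb : ∀ l : ℕ, ∃ B, ∀ x, ‖iteratedFDeriv ℝ l g x‖ ≤ B) (hw : Integrable w) :
    ContDiff ℝ (⊤ : ℕ∞) (conv w g) := (conv_taylor hg hb hw).contDiff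

lemma iteratedFDeriv_conv (hg : ContDiff ℝ (⊤ : ℕ∞) g)
    (hb : ∀ l : ℕ, ∃ B, ∀ x, ‖iteratedFDeriv ℝ l g x‖ ≤ B) (hw : Integrable w) (l : ℕ) (x : Space n) :
    iteratedFDeriv ℝ l (conv w g) x = ∫ y, w y • iteratedFDeriv ℝ l g (x - y) :=
  ((conv_taylor hg hb hw).eq_iteratedFDeriv (by exact_mod_cast le_top) x).symm

lemma GelfandShilov.hasDecay (hf : f ∈ GelfandShilov n s) : HasDecay s f := by
  obtain ⟨hfs, h, C, h0, hb⟩ := hf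
  exact ⟨hfs.continuous.aestronglyMeasurable, h, C, h0, fun k x => by simpa using hb k 0 x⟩

/-- Multiplication by a bounded function preserves decay. -/
lemma HasDecay.mul_bounded (hw : HasDecay s w) {u : Space n → ℂ} (hu : AEStronglyMeasurable u)
    {M : ℝ} (hM : ∀ x, ‖u x‖ ≤ M) : HasDecay s (fun x => u x * w x) := by
  obtain ⟨hm, h, C, h0, hb⟩ := hw
  refine ⟨hu.mul hm, h, M * C, h0, fun k x => ?_⟩
  have hM0 : 0 ≤ M := (norm_nonneg _).trans (hM x)
  calc ‖x‖ ^ k * ‖u x * w x‖ = ‖u x‖ * (‖x‖ ^ k * ‖w x‖) := by rw [norm_mul]; ring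
    _ ≤ M * (C * h ^ k * (k.factorial : ℝ) ^ s) :=
      mul_le_mul (hM x) (hb k x) (by positivity) hM0
    _ = _ := by ring

/-- Decay with extra integrability. -/
lemma HasDecay.exists_bound (hs : 0 ≤ s) (hw : HasDecay s w) :
    ∃ H K : ℝ, 0 < H ∧ 0 ≤ K ∧ ∀ k x, ‖x‖ ^ k * ‖w x‖
      ≤ K * H ^ k * (k.factorial : ℝ) ^ s * ((1 + ‖x‖) ^ (n + 1))⁻¹ := by
  obtain ⟨hm, h, C, h0, hb⟩ := hw
  have hC : 0 ≤ C := by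
    have := hb 0 0
    simp only [pow_zero, Nat.factorial_zero, Nat.cast_one, mul_one, Real.one_rpow, one_mul] at this
    exact (norm_nonneg _).trans this
  have h2s : (1 : ℝ) ≤ 2 ^ s := Real.one_le_rpow (by norm_num) hs
  refine ⟨h * 2 ^ s, 2 ^ (n + 1) * (1 + h ^ (n + 1) * (2 ^ s) ^ (n + 1) * ((n + 1).factorial : ℝ) ^ s) * C,
    by positivity, by positivity, fun k x => ?_⟩
  rw [← div_eq_mul_inv, le_div_iff₀ (by positivity)]
  have e1 : (1 + ‖x‖) ^ (n + 1) ≤ 2 ^ (n + 1) * (1 + ‖x‖ ^ (n + 1)) := by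
    calc (1 + ‖x‖) ^ (n + 1) ≤ 2 ^ ((n + 1) - 1) * (1 ^ (n + 1) + ‖x‖ ^ (n + 1)) :=
          add_pow_le (by positivity) (by positivity) _
      _ ≤ 2 ^ (n + 1) * (1 ^ (n + 1) + ‖x‖ ^ (n + 1)) := by
          gcongr
          · norm_num
          · omega
      _ = _ := by rw [one_pow]
  have e2 : ‖x‖ ^ k * ‖w x‖ ≤ C * (h * 2 ^ s) ^ k * (k.factorial : ℝ) ^ s := by
    refine (hb k x).trans ?_
    gcongr
    exact le_mul_of_one_le_right h0.le h2s
  have e3 : ‖x‖ ^ (k + (n + 1)) * ‖w x‖ ≤ h ^ (n + 1) * (2 ^ s) ^ (n + 1) *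
      ((n + 1).factorial : ℝ) ^ s * (C * (h * 2 ^ s) ^ k * (k.factorial : ℝ) ^ s) := by
    calc ‖x‖ ^ (k + (n + 1)) * ‖w x‖ ≤ C * h ^ (k + (n + 1)) * (((2 : ℝ) ^ s) ^ (k + (n + 1)) *
          ((k.factorial : ℝ) ^ s * ((n + 1).factorial : ℝ) ^ s)) := by
          refine (hb _ x).trans ?_
          gcongr
          exact factorial_add_rpow_le hs k (n + 1)
      _ = _ := by rw [mul_pow, pow_add, pow_add]; ring
  calc ‖x‖ ^ k * ‖w x‖ * (1 + ‖x‖) ^ (n + 1)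
      ≤ ‖x‖ ^ k * ‖w x‖ * (2 ^ (n + 1) * (1 + ‖x‖ ^ (n + 1))) := by gcongr
    _ = 2 ^ (n + 1) * (‖x‖ ^ k * ‖w x‖ + ‖x‖ ^ (k + (n + 1)) * ‖w x‖) := by rw [pow_add]; ring
    _ ≤ 2 ^ (n + 1) * (C * (h * 2 ^ s) ^ k * (k.factorial : ℝ) ^ s + h ^ (n + 1) * (2 ^ s) ^ (n + 1) *
      ((n + 1).factorial : ℝ) ^ s * (C * (h * 2 ^ s) ^ k * (k.factorial : ℝ) ^ s)) := by gcongr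
    _ = _ := by ring

lemma HasDecay.integrable (hs : 0 ≤ s) (hw : HasDecay s w) : Integrable w := by
  obtain ⟨H, K, hH, hK, hb⟩ := hw.exists_bound hs
  refine ((integrable_one_add_norm_pow n).const_mul K).mono' hw.1 (Eventually.of_forall fun x => ?_)
  simpa using hb 0 x

lemma GSBound.deriv_bounded (hg : GSBound s h C g) (l : ℕ) :
    ∃ B, ∀ x, ‖iteratedFDeriv ℝ l g x‖ ≤ B := ⟨_, fun x => hg.gevBound l x⟩

lemma norm_pow_le_two_pow_mul (x y : Space n) (k : ℕ) :
    ‖x‖ ^ k ≤ 2 ^ k * (‖x - y‖ ^ k + ‖y‖ ^ k) := by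
  calc ‖x‖ ^ k ≤ (‖x - y‖ + ‖y‖) ^ k := by
        gcongr
        simpa using norm_add_le (x - y) y
    _ ≤ 2 ^ (k - 1) * (‖x - y‖ ^ k + ‖y‖ ^ k) := add_pow_le (norm_nonneg _) (norm_nonneg _) k
    _ ≤ _ := by
        gcongr
        · norm_num
        · omega

/-- Bounds for translates, with constants that are uniform in the translation once multiplied by a
factor that compensates the growth of the powers of `‖y‖`. -/
lemma GSBound.translate_aux {H M b : ℝ} (h0 : 0 ≤ h) (hH : 0 ≤ H)
    (hg : GSBound s h C g) (y : Space n) (hb : 0 ≤ b) (hM : 0 ≤ M)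
    (hy : ∀ k : ℕ, ‖y‖ ^ k * b ≤ M * H ^ k * (k.factorial : ℝ) ^ s) (k l : ℕ) (x : Space n) :
    ‖x‖ ^ k * (b * ‖iteratedFDeriv ℝ l g (x - y)‖) ≤ (2 * M * C) * (2 * max h H) ^ (k + l) *
      ((k.factorial : ℝ) * (l.factorial : ℝ)) ^ s := by
  have hC := hg.nonneg
  set D := ‖iteratedFDeriv ℝ l g (x - y)‖
  have hbM : b ≤ M := by simpa using hy 0
  have e1 := hg k l (x - y)
  have e2 := hg 0 l (x - y)
  simp only [pow_zero, one_mul, Nat.factorial_zero, Nat.cast_one, zero_add] at e2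
  have hm1 : h ≤ max h H := le_max_left _ _
  have hm2 : H ≤ max h H := le_max_right _ _
  rw [Real.mul_rpow (by positivity) (by positivity)] at e1 ⊢
  have f1 : b * (‖x - y‖ ^ k * D) ≤
      M * (C * (max h H) ^ (k + l) * ((k.factorial : ℝ) ^ s * (l.factorial : ℝ) ^ s)) := by
    refine mul_le_mul hbM (e1.trans ?_) (by positivity) hM
    gcongr
  have f2 : (‖y‖ ^ k * b) * D ≤
      M * (C * (max h H) ^ (k + l) * ((k.factorial : ℝ) ^ s * (l.factorial : ℝ) ^ s)) := by
    calc (‖y‖ ^ k * b) * D ≤ (M * (max h H) ^ k * (k.factorial : ℝ) ^ s) *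
          (C * (max h H) ^ l * (l.factorial : ℝ) ^ s) := by
          refine mul_le_mul ((hy k).trans ?_) (e2.trans ?_) (by positivity) (by positivity)
          · gcongr
          · gcongr
      _ = _ := by rw [pow_add]; ring
  have p1 : (2 : ℝ) ^ k ≤ 2 ^ (k + l) := pow_le_pow_right₀ (by norm_num) (by omega)
  calc ‖x‖ ^ k * (b * D) ≤ (2 ^ k * (‖x - y‖ ^ k + ‖y‖ ^ k)) * (b * D) := by
        gcongr
        exact norm_pow_le_two_pow_mul x y k
    _ = 2 ^ k * (b * (‖x - y‖ ^ k * D) + (‖y‖ ^ k * b) * D) := by ring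
    _ ≤ 2 ^ (k + l) * (M * (C * (max h H) ^ (k + l) * ((k.factorial : ℝ) ^ s * (l.factorial : ℝ) ^ s)) +
        M * (C * (max h H) ^ (k + l) * ((k.factorial : ℝ) ^ s * (l.factorial : ℝ) ^ s))) := by
        gcongr
    _ = _ := by rw [mul_pow]; ring

/-- One term of the exponential series. It provides the constant `M` of `GSBound.translate_aux` for
a translation of length `r`, with `b = 1`. -/
lemma pow_le_exp_mul {r H : ℝ} (hr : 0 ≤ r) (hH : 0 < H) (hs : 1 ≤ s) (k : ℕ) :
    r ^ k ≤ Real.exp (r / H) * H ^ k * (k.factorial : ℝ) ^ s := by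
  have h1 := Real.pow_div_factorial_le_exp (r / H) (by positivity) k
  have h2 : (1 : ℝ) ≤ k.factorial := by exact_mod_cast Nat.succ_le_of_lt k.factorial_pos
  have h3 : (k.factorial : ℝ) ≤ (k.factorial : ℝ) ^ s := by
    calc (k.factorial : ℝ) = (k.factorial : ℝ) ^ (1 : ℝ) := (Real.rpow_one _).symm
      _ ≤ _ := Real.rpow_le_rpow_of_exponent_le h2 hs
  rw [div_le_iff₀ (by positivity), div_pow, div_le_iff₀ (by positivity)] at h1
  calc r ^ k ≤ Real.exp (r / H) * k.factorial * H ^ k := h1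
    _ = Real.exp (r / H) * H ^ k * k.factorial := by ring
    _ ≤ _ := by gcongr

lemma iteratedFDeriv_translate (g : Space n → ℂ) (y : Space n) (l : ℕ) (x : Space n) :
    iteratedFDeriv ℝ l (fun x => g (x - y)) x = iteratedFDeriv ℝ l g (x - y) := by
  rw [iteratedFDeriv_comp_sub]

lemma GSBound.translate {H : ℝ} (hs : 1 ≤ s) (h0 : 0 ≤ h) (hH : 0 < H) (hg : GSBound s h C g) (y : Space n) :
    GSBound s (2 * max h H) (2 * Real.exp (‖y‖ / H) * C) (fun x => g (x - y)) := by
  intro k l x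
  rw [iteratedFDeriv_translate]
  have := hg.translate_aux (b := 1) (M := Real.exp (‖y‖ / H)) h0 hH.le y zero_le_one (by positivity)
    (fun k => by rw [mul_one]; exact pow_le_exp_mul (norm_nonneg y) hH hs k) k l x
  simpa using this

lemma GelfandShilov.translate (hs : 1 ≤ s) (hg : g ∈ GelfandShilov n s) (y : Space n) :
    (fun x => g (x - y)) ∈ GelfandShilov n s := by
  obtain ⟨hgs, h, C, h0, hb⟩ := hg
  exact ⟨hgs.comp (contDiff_id.sub contDiff_const), _, _, by positivity,
    hb.translate hs h0.le one_pos y⟩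

/-- Translates depend continuously on the translation, in a fixed space `S_{s,h}`. -/
lemma GSBound.translate_sub {H r : ℝ} (hs : 1 ≤ s) (h0 : 0 ≤ h) (hH : 0 < H)
    (hgs : ContDiff ℝ (⊤ : ℕ∞) g) (hg : GSBound s h C g) {y z : Space n} (hy : ‖y‖ ≤ r) (hz : ‖z‖ ≤ r) :
    GSBound s (2 * max h H * 2 ^ s) (2 * Real.exp (r / H) * C * (2 * max h H * 2 ^ s) * ‖y - z‖)
      (fun x => g (x - y) - g (x - z)) := by
  intro k l x
  have hC := hg.nonneg
  have hl : ((l : ℕ∞) : WithTop ℕ∞) ≤ ((⊤ : ℕ∞) : WithTop ℕ∞) := by exact_mod_cast le_top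
  have hsub : iteratedFDeriv ℝ l (fun x => g (x - y) - g (x - z)) x =
      iteratedFDeriv ℝ l g (x - y) - iteratedFDeriv ℝ l g (x - z) := by
    have h1 : ContDiff ℝ l (fun x => g (x - y)) :=
      (hgs.of_le hl).comp (contDiff_id.sub contDiff_const)
    have h2 : ContDiff ℝ l (fun x => g (x - z)) :=
      (hgs.of_le hl).comp (contDiff_id.sub contDiff_const)
    rw [← iteratedFDeriv_translate, ← iteratedFDeriv_translate g z]
    exact iteratedFDeriv_sub_apply h1.contDiffAt h2.contDiffAt
  rw [hsub]
  set Q := 2 * Real.exp (r / H) * C * (2 * max h H * 2 ^ s) * (2 * max h H * 2 ^ s) ^ (k + l) *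
    ((k.factorial : ℝ) * (l.factorial : ℝ)) ^ s with hQ
  have hdiff : Differentiable ℝ (iteratedFDeriv ℝ l g) :=
    hgs.differentiable_iteratedFDeriv (by exact_mod_cast ENat.natCast_lt_top l)
  -- Mean value inequality on the ball of radius `r` about `x`, the weight `‖x‖^k` being frozen. The
  -- additional derivative replaces `l!` by `(l+1)!`, whence the factor `2^s` in the new parameter.
  have key : ‖‖x‖ ^ k • iteratedFDeriv ℝ l g (x - y) - ‖x‖ ^ k • iteratedFDeriv ℝ l g (x - z)‖ ≤
      Q * ‖(x - y) - (x - z)‖ := by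
    refine Convex.norm_image_sub_le_of_norm_fderiv_le (𝕜 := ℝ)
      (f := fun u => ‖x‖ ^ k • iteratedFDeriv ℝ l g u) (s := Metric.closedBall x r)
      (fun u _ => (hdiff u).fun_const_smul _) (fun u hu => ?_) (convex_closedBall _ _)
      (by simpa using hz) (by simpa using hy)
    rw [fderiv_fun_const_smul (hdiff u), norm_smul, norm_fderiv_iteratedFDeriv, norm_pow, norm_norm]
    have hur : ‖x - u‖ ≤ r := by rwa [mem_closedBall_iff_norm'] at hu
    have := hg.translate_aux (b := 1) (M := Real.exp (r / H)) h0 hH.le (x - u) zero_le_one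
      (by positivity) (fun k => by
        rw [mul_one]
        calc ‖x - u‖ ^ k ≤ r ^ k := by gcongr
          _ ≤ _ := pow_le_exp_mul ((norm_nonneg _).trans hur) hH hs k) k (l + 1) x
    rw [sub_sub_cancel, one_mul] at this
    refine this.trans ?_
    have h2s : (1 : ℝ) ≤ 2 ^ s := Real.one_le_rpow (by norm_num) (by linarith)
    have hm : 0 ≤ max h H := le_max_of_le_left h0
    have hfac : ((l + 1).factorial : ℝ) ^ s ≤ (2 ^ s) ^ (l + 1) * (l.factorial : ℝ) ^ s := by
      have := factorial_add_rpow_le (s := s) (by linarith) l 1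
      simpa using this
    have p1 : ((2 : ℝ) ^ s) ^ (l + 1) ≤ (2 ^ s) ^ (k + (l + 1)) :=
      pow_le_pow_right₀ h2s (by omega)
    rw [hQ, Real.mul_rpow (by positivity) (by positivity), Real.mul_rpow (by positivity) (by positivity)]
    calc 2 * Real.exp (r / H) * C * (2 * max h H) ^ (k + (l + 1)) *
          ((k.factorial : ℝ) ^ s * ((l + 1).factorial : ℝ) ^ s)
        ≤ 2 * Real.exp (r / H) * C * (2 * max h H) ^ (k + (l + 1)) *
          ((k.factorial : ℝ) ^ s * ((2 ^ s) ^ (k + (l + 1)) * (l.factorial : ℝ) ^ s)) := by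
          gcongr
          exact hfac.trans (by gcongr)
      _ = _ := by rw [mul_pow (2 * max h H) (2 ^ s), pow_add, pow_add, pow_add, pow_add]; ring
  have e : (x - y) - (x - z) = -(y - z) := by abel
  rw [← smul_sub, norm_smul, norm_pow, norm_norm, e, norm_neg] at key
  refine key.trans (le_of_eq ?_)
  rw [hQ]; ring

end Convolution

/-! ### Functionals commute with convolution integrals -/

section Extension

set_option maxSynthPendingDepth 3

variable {n : ℕ} {s h C : ℝ} {f g w : Space n → ℂ}

lemma pair_of_mem {T : GelfandShilovDual n s} (hg : g ∈ GelfandShilov n s) :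
    pair T g = (T : GelfandShilov n s →ₗ[ℂ] ℂ) ⟨g, hg⟩ := dif_pos hg

lemma pair_add (T : GelfandShilovDual n s) (hf : f ∈ GelfandShilov n s) (hg : g ∈ GelfandShilov n s) :
    pair T (f + g) = pair T f + pair T g := by
  rw [pair_of_mem hf, pair_of_mem hg, pair_of_mem (Submodule.add_mem _ hf hg), ← map_add]
  rfl

lemma pair_smul (T : GelfandShilovDual n s) (c : ℂ) (hf : f ∈ GelfandShilov n s) :
    pair T (c • f) = c * pair T f := by
  rw [pair_of_mem hf, pair_of_mem (Submodule.smul_mem _ c hf), ← smul_eq_mul, ← map_smul]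
  rfl

lemma pair_sub (T : GelfandShilovDual n s) (hf : f ∈ GelfandShilov n s) (hg : g ∈ GelfandShilov n s) :
    pair T (f - g) = pair T f - pair T g := by
  rw [pair_of_mem hf, pair_of_mem hg, pair_of_mem (Submodule.sub_mem _ hf hg), ← map_sub]
  rfl

lemma pair_zero (T : GelfandShilovDual n s) : pair T 0 = 0 := by
  rw [pair_of_mem (Submodule.zero_mem _)]
  exact map_zero (T : GelfandShilov n s →ₗ[ℂ] ℂ)

lemma pair_bound (T : GelfandShilovDual n s) (h0 : 0 < h) :
    ∃ K : ℝ, 0 ≤ K ∧ ∀ (f : Space n → ℂ) (C : ℝ), ContDiff ℝ (⊤ : ℕ∞) f → GSBound s h C f →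
      ‖pair T f‖ ≤ K * C := by
  obtain ⟨K, hK⟩ := T.2 h h0
  refine ⟨|K|, abs_nonneg K, fun f C hfs hf => ?_⟩
  have hmem : f ∈ GelfandShilov n s := ⟨hfs, h, C, h0, hf⟩
  rw [pair_of_mem hmem]
  refine (hK ⟨f, hmem⟩ C hf).trans ?_
  have := hf.nonneg
  gcongr
  exact le_abs_self K

/-- The coordinates in which `S_{s,h}` is embedded into a space of bounded families. -/
abbrev GSCoord (n : ℕ) (i : ℕ × ℕ × Space n) := ContinuousMultilinearMap ℝ (fun _ : Fin i.2.1 => Space n) ℂ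

/-- The weight with which `Dˡ f(x)` enters the norm of `S_{s,h}`. -/
noncomputable def gsWeight (s h : ℝ) (i : ℕ × ℕ × Space n) : ℝ :=
  (h ^ (i.1 + i.2.1) * ((i.1.factorial : ℝ) * (i.2.1.factorial : ℝ)) ^ s)⁻¹ * ‖i.2.2‖ ^ i.1

/-- The weighted jet of a function. -/
noncomputable def gsJet (s h : ℝ) (f : Space n → ℂ) (i : ℕ × ℕ × Space n) : GSCoord n i :=
  gsWeight s h i • iteratedFDeriv ℝ i.2.1 f i.2.2

lemma gsWeight_nonneg (h0 : 0 ≤ h) (i : ℕ × ℕ × Space n) : 0 ≤ gsWeight s h i := by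
  unfold gsWeight; positivity

lemma norm_gsJet_le (h0 : 0 < h) {i : ℕ × ℕ × Space n} {B : ℝ} :
    ‖gsJet s h f i‖ ≤ B ↔ ‖i.2.2‖ ^ i.1 * ‖iteratedFDeriv ℝ i.2.1 f i.2.2‖
      ≤ B * h ^ (i.1 + i.2.1) * ((i.1.factorial : ℝ) * (i.2.1.factorial : ℝ)) ^ s := by
  have hp : 0 < h ^ (i.1 + i.2.1) * ((i.1.factorial : ℝ) * (i.2.1.factorial : ℝ)) ^ s := by positivity
  unfold gsJet
  rw [norm_smul, Real.norm_of_nonneg (gsWeight_nonneg h0.le i), gsWeight, mul_assoc,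
    inv_mul_le_iff₀ hp]
  constructor <;> intro h <;> linarith

lemma GSBound.norm_gsJet_le (h0 : 0 < h) (hf : GSBound s h C f) (i : ℕ × ℕ × Space n) :
    ‖gsJet s h f i‖ ≤ C := (GevreyModulation.norm_gsJet_le h0).mpr (hf _ _ _)

/-- Functions of `S_{s,h}` as elements of `ℓ^∞`. -/
noncomputable def gsEmb (h0 : 0 < h) (hf : GSBound s h C f) : lp (GSCoord n) ∞ :=
  ⟨gsJet s h f, memℓp_infty ⟨C, by rintro _ ⟨i, rfl⟩; exact hf.norm_gsJet_le h0 i⟩⟩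

lemma gsEmb_apply (h0 : 0 < h) (hf : GSBound s h C f) (i : ℕ × ℕ × Space n) :
    gsEmb h0 hf i = gsJet s h f i := rfl

lemma norm_gsEmb_le (h0 : 0 < h) (hf : GSBound s h C f) : ‖gsEmb h0 hf‖ ≤ C :=
  lp.norm_le_of_forall_le hf.nonneg (hf.norm_gsJet_le h0)

/-- The function with a given jet. -/
noncomputable def ofJet (z : lp (GSCoord n) ∞) (x : Space n) : ℂ := z (0, 0, x) 0

lemma ofJet_gsEmb (h0 : 0 < h) (hf : GSBound s h C f) : ofJet (gsEmb h0 hf) = f := by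
  funext x
  simp only [ofJet, gsEmb_apply, gsJet, gsWeight, add_zero, pow_zero, Nat.factorial_zero,
    Nat.cast_one, mul_one, Real.one_rpow, inv_one, one_smul]
  exact iteratedFDeriv_zero_apply _

/-- The subspace of jets of smooth functions. -/
noncomputable def jetSubmodule (n : ℕ) (s h : ℝ) : Submodule ℂ (lp (GSCoord n) ∞) where
  carrier := {z | ContDiff ℝ (⊤ : ℕ∞) (ofJet z) ∧ ∀ i, z i = gsJet s h (ofJet z) i}
  zero_mem' := by
    have : ofJet (0 : lp (GSCoord n) ∞) = fun _ => 0 := rfl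
    refine ⟨by rw [this]; exact contDiff_const, fun i => ?_⟩
    rw [this, gsJet, iteratedFDeriv_fun_zero]
    simp
  add_mem' := by
    rintro y z ⟨hy, hy'⟩ ⟨hz, hz'⟩
    have : ofJet (y + z) = ofJet y + ofJet z := rfl
    refine ⟨by rw [this]; exact hy.add hz, fun i => ?_⟩
    have hl : ((i.2.1 : ℕ∞) : WithTop ℕ∞) ≤ ((⊤ : ℕ∞) : WithTop ℕ∞) := by exact_mod_cast le_top
    rw [this, gsJet, iteratedFDeriv_add_apply (hy.of_le hl).contDiffAt (hz.of_le hl).contDiffAt,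
      smul_add, lp.coeFn_add, Pi.add_apply, hy', hz']
    rfl
  smul_mem' := by
    rintro c z ⟨hz, hz'⟩
    have : ofJet (c • z) = c • ofJet z := rfl
    refine ⟨by rw [this]; exact contDiff_const.smul hz, fun i => ?_⟩
    have hl : ((i.2.1 : ℕ∞) : WithTop ℕ∞) ≤ ((⊤ : ℕ∞) : WithTop ℕ∞) := by exact_mod_cast le_top
    rw [this, gsJet, iteratedFDeriv_const_smul_apply (hz.of_le hl).contDiffAt,
      lp.coeFn_smul, Pi.smul_apply, hz', smul_comm]
    rfl

lemma gsEmb_mem (h0 : 0 < h) (hfs : ContDiff ℝ (⊤ : ℕ∞) f) (hf : GSBound s h C f) :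
    gsEmb h0 hf ∈ jetSubmodule n s h := by
  refine ⟨by rwa [ofJet_gsEmb], fun i => ?_⟩
  rw [ofJet_gsEmb, gsEmb_apply]

lemma gsBound_ofJet (h0 : 0 < h) {z : lp (GSCoord n) ∞} (hz : z ∈ jetSubmodule n s h) :
    GSBound s h ‖z‖ (ofJet z) := by
  intro k l x
  refine (norm_gsJet_le (i := (k, l, x)) h0).mp ?_
  rw [← hz.2]
  exact lp.norm_apply_le_norm ENNReal.top_ne_zero z _

/-- A functional in `S_s'` is, on `S_{s,h}`, given by a bounded functional on `ℓ^∞`. -/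
lemma exists_extension (T : GelfandShilovDual n s) (h0 : 0 < h) :
    ∃ L : StrongDual ℂ (lp (GSCoord n) ∞), ∀ (f : Space n → ℂ) (C : ℝ) (_ : ContDiff ℝ (⊤ : ℕ∞) f)
      (hf : GSBound s h C f), L (gsEmb h0 hf) = pair T f := by
  obtain ⟨K, hK0, hK⟩ := pair_bound T h0
  have hmem : ∀ z ∈ jetSubmodule n s h, ofJet z ∈ GelfandShilov n s :=
    fun z hz => ⟨hz.1, h, _, h0, gsBound_ofJet h0 hz⟩
  let F : jetSubmodule n s h →ₗ[ℂ] ℂ :=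
    { toFun := fun z => pair T (ofJet (z : lp (GSCoord n) ∞))
      map_add' := fun y z => pair_add T (hmem y y.2) (hmem z z.2)
      map_smul' := fun c z => pair_smul T c (hmem z z.2) }
  let G : StrongDual ℂ (jetSubmodule n s h) :=
    F.mkContinuous K (fun z => hK _ _ z.2.1 (gsBound_ofJet h0 z.2))
  -- Hahn–Banach moves the functional to all of `ℓ^∞`. There Bochner integrals are available without
  -- proving that `S_{s,h}` is complete.
  obtain ⟨L, hL, -⟩ := exists_extension_norm_eq (jetSubmodule n s h) G
  refine ⟨L, fun f C hfs hf => ?_⟩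
  rw [hL ⟨_, gsEmb_mem h0 hfs hf⟩]
  change pair T (ofJet (gsEmb h0 hf)) = _
  rw [ofJet_gsEmb]

/-- The coordinates are bounded linear. -/
noncomputable def coordCLM (n : ℕ) (i : ℕ × ℕ × Space n) : lp (GSCoord n) ∞ →L[ℂ] GSCoord n i :=
  LinearMap.mkContinuous
    { toFun := fun z => z i
      map_add' := fun _ _ => rfl
      map_smul' := fun _ _ => rfl } 1
    (fun z => by rw [one_mul]; exact lp.norm_apply_le_norm ENNReal.top_ne_zero z i)

/-- Functionals in `S_s'` commute with convolution integrals. -/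
theorem pair_conv (hs : 1 ≤ s) (T : GelfandShilovDual n s) (hg : g ∈ GelfandShilov n s)
    (hw : HasDecay s w) :
    conv w g ∈ GelfandShilov n s ∧ Continuous (fun y => pair T (fun x => g (x - y))) ∧
      Integrable (fun y => w y * pair T (fun x => g (x - y))) ∧
      pair T (conv w g) = ∫ y, w y * pair T (fun x => g (x - y)) := by
  obtain ⟨hgs, h₁, C₁, h₁0, hb⟩ := hg
  obtain ⟨H, K, hH, hK, hwb⟩ := hw.exists_bound (by linarith)
  have hwi := hw.integrable (by linarith)
  have hC₁ := hb.nonneg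
  have h2s : (1 : ℝ) ≤ 2 ^ s := Real.one_le_rpow (by norm_num) (by linarith)
  have hm0 : 0 < max h₁ H := lt_max_of_lt_left h₁0
  -- One parameter for all translates of `g` and for their differences; the factor `2^s` comes from
  -- `GSBound.translate_sub`.
  set h := 2 * max h₁ H * 2 ^ s with hh
  have hmh : 2 * max h₁ H ≤ h := le_mul_of_one_le_right (by positivity) h2s
  have h0 : 0 < h := by positivity
  have htr : ∀ y, GSBound s h (2 * Real.exp (‖y‖ / H) * C₁) (fun x => g (x - y)) := fun y =>
    (hb.translate hs h₁0.le hH y).mono (by positivity) hmh le_rfl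
  have hsm : ∀ y, ContDiff ℝ (⊤ : ℕ∞) (fun x => g (x - y)) := fun y =>
    hgs.comp (contDiff_id.sub contDiff_const)
  let Φ : Space n → lp (GSCoord n) ∞ := fun y => gsEmb h0 (htr y)
  have hΦc : Continuous Φ := by
    refine continuous_iff_continuousAt.mpr fun y₀ => ?_
    rw [ContinuousAt, tendsto_iff_norm_sub_tendsto_zero]
    set r := ‖y₀‖ + 1
    have hbd : ∀ᶠ y in 𝓝 y₀, ‖Φ y - Φ y₀‖ ≤ 2 * Real.exp (r / H) * C₁ * h * ‖y - y₀‖ := by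
      filter_upwards [Metric.ball_mem_nhds y₀ one_pos] with y hy
      have hyr : ‖y‖ ≤ r := by
        have h1 : ‖y - y₀‖ < 1 := by rwa [mem_ball_iff_norm] at hy
        have := norm_add_le (y - y₀) y₀
        rw [sub_add_cancel] at this
        linarith
      have hsub := hb.translate_sub hs h₁0.le hH hgs hyr (by linarith [norm_nonneg y₀] : ‖y₀‖ ≤ r)
      have heq : Φ y - Φ y₀ = gsEmb h0 hsub := by
        refine lp.ext (funext fun i => ?_)
        have hl : ((i.2.1 : ℕ∞) : WithTop ℕ∞) ≤ ((⊤ : ℕ∞) : WithTop ℕ∞) := by exact_mod_cast le_top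
        change gsJet s h (fun x => g (x - y)) i - gsJet s h (fun x => g (x - y₀)) i =
          gsJet s h ((fun x => g (x - y)) - (fun x => g (x - y₀))) i
        rw [gsJet, gsJet, gsJet, ← smul_sub, iteratedFDeriv_sub_apply
          ((hsm y).of_le hl).contDiffAt ((hsm y₀).of_le hl).contDiffAt]
      rw [heq]
      exact norm_gsEmb_le h0 hsub
    refine squeeze_zero' (Eventually.of_forall fun _ => norm_nonneg _) hbd ?_
    have : Tendsto (fun y => 2 * Real.exp (r / H) * C₁ * h * ‖y - y₀‖) (𝓝 y₀)
        (𝓝 (2 * Real.exp (r / H) * C₁ * h * ‖y₀ - y₀‖)) := by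
      apply Continuous.tendsto
      fun_prop
    simpa using this
  -- The available bound for `Φ y` alone grows like `e^(‖y‖/H)`. Estimating the product at once lets
  -- the decay of `w` pay for the powers of `‖y‖`.
  have hΦn : ∀ y, ‖w y • Φ y‖ ≤ 2 * K * C₁ * ((1 + ‖y‖) ^ (n + 1))⁻¹ := by
    intro y
    refine lp.norm_le_of_forall_le (by positivity) fun i => ?_
    have e1 : (w y • Φ y) i = w y • gsJet s h (fun x => g (x - y)) i := rfl
    rw [e1, norm_smul]
    have e2 : ‖w y‖ * ‖gsJet s h (fun x => g (x - y)) i‖ = gsWeight s h i *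
        (‖w y‖ * ‖iteratedFDeriv ℝ i.2.1 g (i.2.2 - y)‖) := by
      rw [gsJet, norm_smul, Real.norm_of_nonneg (gsWeight_nonneg h0.le i), iteratedFDeriv_translate]
      ring
    have e3 := hb.translate_aux (b := ‖w y‖) (M := K * ((1 + ‖y‖) ^ (n + 1))⁻¹) h₁0.le hH.le y
      (norm_nonneg _) (by positivity) (fun k => (hwb k y).trans (le_of_eq (by ring))) i.1 i.2.1 i.2.2
    have hp : 0 < h ^ (i.1 + i.2.1) * ((i.1.factorial : ℝ) * (i.2.1.factorial : ℝ)) ^ s := by positivity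
    rw [e2, gsWeight, mul_assoc, inv_mul_le_iff₀ hp]
    refine e3.trans ?_
    calc 2 * (K * ((1 + ‖y‖) ^ (n + 1))⁻¹) * C₁ * (2 * max h₁ H) ^ (i.1 + i.2.1) *
          ((i.1.factorial : ℝ) * (i.2.1.factorial : ℝ)) ^ s
        ≤ 2 * (K * ((1 + ‖y‖) ^ (n + 1))⁻¹) * C₁ * h ^ (i.1 + i.2.1) *
          ((i.1.factorial : ℝ) * (i.2.1.factorial : ℝ)) ^ s := by gcongr
      _ = _ := by ring
  have hΦi : Integrable (fun y => w y • Φ y) :=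
    ((integrable_one_add_norm_pow n).const_mul (2 * K * C₁)).mono'
      (hw.1.smul hΦc.aestronglyMeasurable) (Eventually.of_forall hΦn)
  have hbd := hb.deriv_bounded
  have hcs := contDiff_conv hgs hbd hwi
  -- Coordinates are continuous, so the Bochner integral is the jet of the convolution. This also
  -- gives the `S_{s,h}` bound for `conv w g`.
  have hZ : ∀ i, (∫ y, w y • Φ y) i = gsJet s h (conv w g) i := by
    intro i
    change coordCLM n i (∫ y, w y • Φ y) = _
    rw [← (coordCLM n i).integral_comp_comm hΦi, gsJet, iteratedFDeriv_conv hgs hbd hwi,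
      ← integral_smul]
    refine integral_congr_ae (Eventually.of_forall fun y => ?_)
    change w y • gsJet s h (fun x => g (x - y)) i = _
    rw [gsJet, iteratedFDeriv_translate, smul_comm]
  have hcb : GSBound s h ‖∫ y, w y • Φ y‖ (conv w g) := by
    intro k l x
    refine (norm_gsJet_le (i := (k, l, x)) h0).mp ?_
    rw [← hZ]
    exact lp.norm_apply_le_norm ENNReal.top_ne_zero _ _
  obtain ⟨L, hL⟩ := exists_extension T h0
  have hLΦ : ∀ y, L (Φ y) = pair T (fun x => g (x - y)) := fun y => hL _ _ (hsm y) (htr y)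
  refine ⟨⟨hcs, h, _, h0, hcb⟩, ?_, ?_, ?_⟩
  · simp_rw [← hLΦ]
    exact L.continuous.comp hΦc
  · have := L.integrable_comp hΦi
    refine this.congr (Eventually.of_forall fun y => ?_)
    simp only [map_smul, hLΦ, smul_eq_mul]
  · rw [← hL _ _ hcs hcb]
    have : gsEmb h0 hcb = ∫ y, w y • Φ y := lp.ext (funext fun i => (hZ i).symm)
    rw [this, ← L.integral_comp_comm hΦi]
    refine integral_congr_ae (Eventually.of_forall fun y => ?_)
    simp only [map_smul, hLΦ, smul_eq_mul]

end Extension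

/-! ### Fourier calculus on `S_s` and spectral windows -/

section Fourier

variable {n : ℕ} {s h C : ℝ} {f g w χ : Space n → ℂ}

open FourierTransform in
lemma fourierT_eq_fourier (f : Space n → ℂ) (ξ : Space n) :
    fourierT f ξ = (normConst n : ℂ) * 𝓕 f ((2 * Real.pi)⁻¹ • ξ) := by
  rw [fourierT_eq_vectorFourier]
  simp only
  congr 1
  rw [Real.fourier_eq]
  refine integral_congr_ae (Eventually.of_forall fun x => ?_)
  change Real.fourierChar (-((2 * Real.pi)⁻¹ * inner ℝ x ξ)) • f x = _
  simp only [inner_smul_right]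

lemma normConst_sq (n : ℕ) : normConst n * normConst n * (2 * Real.pi) ^ n = 1 := by
  unfold normConst
  have h2 : (0 : ℝ) < 2 * Real.pi := by positivity
  rw [← Real.rpow_add h2, ← Real.rpow_natCast, ← Real.rpow_add h2]
  ring_nf
  exact Real.rpow_zero _

lemma fourierT_const_mul (a : ℂ) (f : Space n → ℂ) :
    fourierT (fun x => a * f x) = fun ξ => a * fourierT f ξ := by
  funext ξ
  unfold fourierT
  simp_rw [mul_assoc]
  rw [integral_const_mul]
  ring

lemma integrable_mul_cexp (hf : Integrable f) (a : Space n) :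
    Integrable (fun x => f x * Complex.exp (-(Complex.I * ((inner ℝ x a : ℝ) : ℂ)))) := by
  refine hf.norm.mono' (hf.1.mul (Continuous.aestronglyMeasurable (by fun_prop)))
    (Eventually.of_forall fun x => ?_)
  rw [norm_mul, Complex.norm_exp]
  simp

lemma fourierT_add (hf : Integrable f) (hg : Integrable g) :
    fourierT (fun x => f x + g x) = fun ξ => fourierT f ξ + fourierT g ξ := by
  funext ξ
  unfold fourierT
  simp_rw [add_mul]
  rw [integral_add (integrable_mul_cexp hf ξ) (integrable_mul_cexp hg ξ)]
  ring

lemma fourierT_sub (hf : Integrable f) (hg : Integrable g) :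
    fourierT (fun x => f x - g x) = fun ξ => fourierT f ξ - fourierT g ξ := by
  funext ξ
  unfold fourierT
  simp_rw [sub_mul]
  rw [integral_sub (integrable_mul_cexp hf ξ) (integrable_mul_cexp hg ξ)]
  ring

/-- The Fourier transform of a modulated function is a translate. -/
lemma fourierT_modulate (f : Space n → ℂ) (y : Space n) :
    fourierT (fun x => f x * Complex.exp (Complex.I * ((inner ℝ y x : ℝ) : ℂ)))
      = fun ξ => fourierT f (ξ - y) := by
  funext ξ
  unfold fourierT
  congr 1
  refine integral_congr_ae (Eventually.of_forall fun x => ?_)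
  simp only
  rw [mul_assoc, ← Complex.exp_add, inner_sub_right, real_inner_comm y x]
  congr 2
  push_cast
  ring

/-- The Fourier transform of a translate is modulated. -/
lemma fourierT_translate (f : Space n → ℂ) (a ξ : Space n) :
    fourierT (fun x => f (x + a)) ξ = Complex.exp (Complex.I * ((inner ℝ a ξ : ℝ) : ℂ)) * fourierT f ξ := by
  unfold fourierT
  rw [mul_left_comm]
  congr 1
  rw [← integral_const_mul, ← integral_add_right_eq_self (μ := volume)
    (fun x => Complex.exp (Complex.I * ((inner ℝ a ξ : ℝ) : ℂ)) *
      (f x * Complex.exp (-(Complex.I * ((inner ℝ x ξ : ℝ) : ℂ))))) a]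
  refine integral_congr_ae (Eventually.of_forall fun x => ?_)
  simp only
  rw [mul_left_comm, ← Complex.exp_add, inner_add_left]
  congr 2
  push_cast
  ring

lemma fourierT_neg_arg (f : Space n → ℂ) (ξ : Space n) :
    fourierT (fun x => f (-x)) ξ = fourierT f (-ξ) := by
  unfold fourierT
  congr 1
  rw [← integral_neg_eq_self _ (volume : Measure (Space n))]
  refine integral_congr_ae (Eventually.of_forall fun x => ?_)
  simp

lemma GelfandShilov.neg_arg (hf : f ∈ GelfandShilov n s) : (fun x => f (-x)) ∈ GelfandShilov n s := by
  obtain ⟨hfs, h, C, h0, hb⟩ := hf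
  refine ⟨hfs.comp contDiff_neg, h, C, h0, fun k l x => ?_⟩
  have := (LinearIsometryEquiv.neg ℝ (E := Space n)).norm_iteratedFDeriv_comp_right f x l
  have e : (f ∘ (LinearIsometryEquiv.neg ℝ (E := Space n))) = fun x => f (-x) := rfl
  rw [e] at this
  rw [this]
  have := hb k l (-x)
  rwa [norm_neg] at this

open FourierTransform in
/-- Fourier inversion on `S_s`. -/
lemma fourierT_fourierT (hs : 1 ≤ s) (hf : f ∈ GelfandShilov n s) (x : Space n) :
    fourierT (fourierT f) x = f (-x) := by
  have hpi : (0 : ℝ) < 2 * Real.pi := by positivity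
  have hc : (normConst n : ℂ) ≠ 0 := by exact_mod_cast (normConst_pos n).ne'
  have hfi := GelfandShilov.integrable (by linarith) hf
  have hFi := GelfandShilov.integrable (by linarith) (GelfandShilov.fourierT hs hf)
  have e1 : 𝓕 f = fun η => (normConst n : ℂ)⁻¹ * fourierT f ((2 * Real.pi) • η) := by
    funext η
    rw [fourierT_eq_fourier, smul_smul, inv_mul_cancel₀ hpi.ne', one_smul, inv_mul_cancel_left₀ hc]
  have h2 : Integrable (𝓕 f) := by
    rw [e1]
    exact (hFi.comp_smul hpi.ne').const_mul _
  have h3 := congrFun ((GelfandShilov.continuous hf).fourierInv_fourier_eq hfi h2) (-x)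
  rw [← h3, Real.fourierInv_eq]
  have e2 : fourierT (fourierT f) x = (normConst n : ℂ) * ∫ ξ, (fun η => (normConst n : ℂ) *
      (Real.fourierChar (inner ℝ η (-x)) • 𝓕 f η)) ((2 * Real.pi)⁻¹ • ξ) := by
    have : fourierT f = fun ξ => (normConst n : ℂ) * 𝓕 f ((2 * Real.pi)⁻¹ • ξ) :=
      funext (fourierT_eq_fourier f)
    rw [this]
    unfold fourierT
    congr 1
    refine integral_congr_ae (Eventually.of_forall fun ξ => ?_)
    simp only
    rw [mul_assoc]
    congr 1
    rw [Circle.smul_def, Real.fourierChar_apply, smul_eq_mul, mul_comm]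
    congr 2
    rw [inner_smul_left, inner_neg_right]
    have : (Real.pi : ℂ) ≠ 0 := by exact_mod_cast Real.pi_pos.ne'
    push_cast
    simp only [conj_trivial]
    push_cast
    field_simp
  rw [e2, Measure.integral_comp_smul volume (fun η => (normConst n : ℂ) *
      (Real.fourierChar (inner ℝ η (-x)) • 𝓕 f η)) ((2 * Real.pi)⁻¹), integral_const_mul, finrank_euclideanSpace_fin]
  have e3 : |(((2 * Real.pi)⁻¹ ^ n)⁻¹ : ℝ)| = (2 * Real.pi) ^ n := by
    rw [inv_pow, inv_inv, abs_of_pos (by positivity)]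
  rw [e3, Complex.real_smul]
  have e4 : ((normConst n : ℂ) * (normConst n : ℂ) * (((2 * Real.pi) ^ n : ℝ) : ℂ)) = 1 := by
    exact_mod_cast normConst_sq n
  linear_combination (∫ v, Real.fourierChar (inner ℝ v (-x)) • 𝓕 f v) * e4

open FourierTransform in
/-- The Fourier transform of a convolution. -/
lemma fourierT_conv (hw : Integrable w) (hg : Integrable g) (ξ : Space n) :
    fourierT (conv w g) ξ = (normConst n : ℂ)⁻¹ * (fourierT w ξ * fourierT g ξ) := by
  have hc : (normConst n : ℂ) ≠ 0 := by exact_mod_cast (normConst_pos n).ne'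
  have h1 := Real.fourier_mul_convolution_eq hw hg ((2 * Real.pi)⁻¹ • ξ)
  have h2 : conv w g = MeasureTheory.convolution w g (ContinuousLinearMap.mul ℂ ℂ) volume := rfl
  simp only [fourierT_eq_fourier]
  rw [h2, h1]
  field_simp

/-- The function `F⁻¹(χ F T)`. -/
noncomputable def specWin (T : GelfandShilovDual n s) (χ : Space n → ℂ) (x : Space n) : ℂ :=
  (normConst n : ℂ) * pair T (fun ξ => fourierT χ (ξ - x))

lemma continuous_specWin (hs : 1 ≤ s) (T : GelfandShilovDual n s) (hχ : χ ∈ GelfandShilov n s) :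
    Continuous (specWin T χ) :=
  (pair_conv hs T (GelfandShilov.fourierT hs hχ)
    (GelfandShilov.hasDecay hχ)).2.1.const_mul _

/-- The exchange formula `⟨F T, χ F⁻¹w⟩ = ∫ w F⁻¹(χ F T)`. -/
theorem pair_fourierT_mul (hs : 1 ≤ s) (T : GelfandShilovDual n s) (hχ : χ ∈ GelfandShilov n s)
    (hw : HasDecay s w) :
    (fun ξ => χ ξ * fourierT w (-ξ)) ∈ GelfandShilov n s ∧
      Integrable (fun y => w y * specWin T χ y) ∧
      pair T (fourierT (fun ξ => χ ξ * fourierT w (-ξ))) = ∫ y, w y * specWin T χ y := by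
  have hc : (normConst n : ℂ) ≠ 0 := by exact_mod_cast (normConst_pos n).ne'
  have hFχ := GelfandShilov.fourierT hs hχ
  obtain ⟨hG, -, hint, hpair⟩ := pair_conv hs T hFχ hw
  have hθ := GelfandShilov.neg_arg (GelfandShilov.fourierT hs hG)
  -- By inversion, this test function is a multiple of the reflected transform of `conv w (fourierT
  -- χ)`. Its own transform is thus a convolution, to which `pair_conv` applies.
  have e1 : (fun ξ => χ ξ * fourierT w (-ξ)) =
      (normConst n : ℂ) • fun x => fourierT (conv w (fourierT χ)) (-x) := by
    funext ξ
    rw [Pi.smul_apply, fourierT_conv (hw.integrable (by linarith))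
      (GelfandShilov.integrable (by linarith) hFχ),
      fourierT_fourierT hs hχ, neg_neg, smul_eq_mul, mul_inv_cancel_left₀ hc, mul_comm]
  have e2 : fourierT (fun ξ => χ ξ * fourierT w (-ξ)) = (normConst n : ℂ) • conv w (fourierT χ) := by
    rw [e1]
    funext x
    have := congrFun (fourierT_const_mul (normConst n : ℂ)
      (fun x => fourierT (conv w (fourierT χ)) (-x))) x
    refine this.trans ?_
    rw [fourierT_neg_arg, fourierT_fourierT hs hG, neg_neg]
    rfl
  have e3 : ∀ y, w y * specWin T χ y = (normConst n : ℂ) *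
      (w y * pair T (fun x => fourierT χ (x - y))) := fun y => by
    rw [specWin]; ring
  refine ⟨by rw [e1]; exact Submodule.smul_mem _ _ hθ, ?_, ?_⟩
  · simp_rw [e3]
    exact hint.const_mul _
  · rw [e2, pair_smul T _ hG, hpair, ← integral_const_mul]
    simp_rw [e3]

/-- The same formula for `w = F ψ`. -/
theorem pair_fourierT_mul' (hs : 1 ≤ s) (T : GelfandShilovDual n s) (hχ : χ ∈ GelfandShilov n s)
    {ψ : Space n → ℂ} (hψ : ψ ∈ GelfandShilov n s) :
    Integrable (fun y => fourierT ψ y * specWin T χ y) ∧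
      pair T (fourierT (fun ξ => χ ξ * ψ ξ)) = ∫ y, fourierT ψ y * specWin T χ y := by
  obtain ⟨-, h2, h3⟩ := pair_fourierT_mul hs T hχ (GelfandShilov.hasDecay (GelfandShilov.fourierT hs hψ))
  refine ⟨h2, ?_⟩
  rw [← h3]
  congr 2
  funext ξ
  rw [fourierT_fourierT hs hψ, neg_neg]

/-- The transform turns modulation into translation, so invariance under `fourierT` and under
translation suffices; no derivative of the exponential has to be estimated. -/
lemma GelfandShilov.modulate (hs : 1 ≤ s) (hf : f ∈ GelfandShilov n s) (y : Space n) :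
    (fun x => f x * Complex.exp (Complex.I * ((inner ℝ y x : ℝ) : ℂ))) ∈ GelfandShilov n s := by
  have h1 := GelfandShilov.translate hs (GelfandShilov.fourierT hs hf) y
  have h2 := GelfandShilov.neg_arg (GelfandShilov.fourierT hs h1)
  convert h2 using 1
  funext x
  have e : (fun x => GevreyModulation.fourierT f (x - y)) = fun x => GevreyModulation.fourierT f (x + -y) := by
    simp_rw [sub_eq_add_neg]
  rw [e, fourierT_translate, fourierT_fourierT hs hf, neg_neg, mul_comm]
  simp

/-- A spectral projection reproduces itself by convolution. -/
theorem specWin_reproduce (hs : 1 ≤ s) (T : GelfandShilovDual n s) (hχ : χ ∈ GelfandShilov n s)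
    {χ₁ : Space n → ℂ} (hχ₁ : χ₁ ∈ GelfandShilov n s) (hmul : ∀ ξ, χ ξ * χ₁ ξ = χ ξ) (x : Space n) :
    specWin T χ x = (normConst n : ℂ) * ∫ y, fourierT χ₁ (y - x) * specWin T χ y := by
  have h := (pair_fourierT_mul' hs T hχ (GelfandShilov.modulate hs hχ₁ x)).2
  rw [fourierT_modulate] at h
  rw [← h, specWin, ← fourierT_modulate]
  simp_rw [← mul_assoc, hmul]

end Fourier

/-! ### Inverses and dilations of Gevrey functions -/

section Inverse

variable {n : ℕ} {s h C : ℝ} {f : Space n → ℂ}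

/-- A geometric sum of ratio at most `1/2`, read from its largest term; it closes the induction in
`GevBound.exists_inv`. -/
lemma sum_mul_pow_le {a M : ℝ} (ha : 0 ≤ a) (hM : 2 * a ≤ M) (l : ℕ) :
    ∑ i ∈ Finset.range (l + 1), M ^ i * a ^ (l - i) ≤ 2 * M ^ l := by
  have hM0 : 0 ≤ M := by linarith
  induction l with
  | zero => simp
  | succ l ih =>
    rw [Finset.sum_range_succ, Nat.sub_self, pow_zero, mul_one]
    have e : ∑ i ∈ Finset.range (l + 1), M ^ i * a ^ (l + 1 - i) =
        a * ∑ i ∈ Finset.range (l + 1), M ^ i * a ^ (l - i) := by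
      rw [Finset.mul_sum]
      refine Finset.sum_congr rfl fun i hi => ?_
      have : i ≤ l := Nat.lt_succ_iff.mp (Finset.mem_range.mp hi)
      rw [show l + 1 - i = (l - i) + 1 by omega, pow_succ]
      ring
    rw [e]
    calc a * ∑ i ∈ Finset.range (l + 1), M ^ i * a ^ (l - i) + M ^ (l + 1)
        ≤ a * (2 * M ^ l) + M ^ (l + 1) := by gcongr
      _ = (2 * a) * M ^ l + M ^ (l + 1) := by ring
      _ ≤ M * M ^ l + M ^ (l + 1) := by gcongr
      _ = _ := by ring

/-- Gevrey classes are closed under inversion. -/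
lemma GevBound.exists_inv (hs : 1 ≤ s) (h0 : 0 ≤ h) (hfs : ContDiff ℝ (⊤ : ℕ∞) f) (hf : GevBound s h C f)
    {c : ℝ} (hc : 0 < c) (hcf : ∀ x, c ≤ ‖f x‖) :
    ∃ h' : ℝ, 0 < h' ∧ GevBound s h' c⁻¹ (fun x => (f x)⁻¹) := by
  have hC := hf.nonneg
  have hne : ∀ x, f x ≠ 0 := fun x => norm_pos_iff.mp (hc.trans_le (hcf x))
  set g : Space n → ℂ := fun x => (f x)⁻¹ with hg
  have hgs : ContDiff ℝ (⊤ : ℕ∞) g := hfs.inv hne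
  set G := c⁻¹ with hG
  have hG0 : 0 < G := inv_pos.mpr hc
  set a := h * 2 ^ s with ha
  have ha0 : 0 ≤ a := by positivity
  -- `M ≥ 2a` controls the geometric sum, `M ≥ 2aCG` makes the induction reproduce the constant `G`,
  -- and the `1` gives positivity.
  set M := 2 * a + 2 * a * C * G + 1 with hM
  have hM1 : 2 * a ≤ M := by
    have : 0 ≤ 2 * a * C * G := by positivity
    linarith
  have hM2 : 2 * a * C * G ≤ M := by linarith
  have hM0 : 0 < M := by positivity
  refine ⟨M, hM0, fun l => ?_⟩
  induction l using Nat.strong_induction_on with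
  | _ l ih =>
  rcases l with _ | l
  · intro x
    simp only [norm_iteratedFDeriv_zero, pow_zero, mul_one, Nat.factorial_zero, Nat.cast_one,
      Real.one_rpow, hg, norm_inv]
    exact inv_anti₀ hc (hcf x)
  intro x
  have hl : ((l : ℕ∞) : WithTop ℕ∞) ≤ ((⊤ : ℕ∞) : WithTop ℕ∞) := by exact_mod_cast le_top
  -- The identity `D(1/f) = -(1/f)² Df` expresses order `l + 1` of the inverse through its orders up
  -- to `l`.
  have hder : fderiv ℝ g = fun x => (-(g x * g x)) • fderiv ℝ f x := by
    funext x
    have h1 := (hasFDerivAt_inv' (𝕜 := ℝ) (hne x)).comp x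
      ((hfs.differentiable (by simp)) x).hasFDerivAt
    have h2 : fderiv ℝ g x = _ := h1.fderiv
    rw [h2]
    ext v
    simp [hg]
    ring
  have hfd : ContDiff ℝ (⊤ : ℕ∞) (fderiv ℝ f) := hfs.fderiv_right (by simp)
  have hgg : ContDiff ℝ (⊤ : ℕ∞) (fun x => -(g x * g x)) := (hgs.mul hgs).neg
  rw [← norm_iteratedFDeriv_fderiv, hder]
  refine (norm_iteratedFDeriv_smul_le (𝕜 := ℝ) hgg hfd x hl).trans ?_
  have hsq : ∀ i ≤ l, ‖iteratedFDeriv ℝ i (fun x => -(g x * g x)) x‖ ≤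
      G ^ 2 * M ^ i * (l + 1) * (i.factorial : ℝ) ^ s := by
    intro i hi
    have e1 : iteratedFDeriv ℝ i (fun x => -(g x * g x)) x = -iteratedFDeriv ℝ i (fun x => g x * g x) x := by
      have := iteratedFDeriv_neg_apply (𝕜 := ℝ) (i := i) (f := fun x => g x * g x) (x := x)
      exact this
    rw [e1, norm_neg]
    refine (norm_iteratedFDeriv_mul_le (𝕜 := ℝ) (N := (⊤ : ℕ∞)) hgs hgs x (n := i)
      (by exact_mod_cast le_top)).trans ?_
    calc ∑ j ∈ Finset.range (i + 1), (i.choose j : ℝ) * ‖iteratedFDeriv ℝ j g x‖ *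
          ‖iteratedFDeriv ℝ (i - j) g x‖
        ≤ ∑ j ∈ Finset.range (i + 1), G ^ 2 * M ^ i * (i.factorial : ℝ) ^ s := by
          refine Finset.sum_le_sum fun j hj => ?_
          have hji : j ≤ i := Nat.lt_succ_iff.mp (Finset.mem_range.mp hj)
          have b1 := ih j (by omega) x
          have b2 := ih (i - j) (by omega) x
          calc (i.choose j : ℝ) * ‖iteratedFDeriv ℝ j g x‖ * ‖iteratedFDeriv ℝ (i - j) g x‖
              ≤ (i.choose j : ℝ) * (G * M ^ j * (j.factorial : ℝ) ^ s) *
                (G * M ^ (i - j) * ((i - j).factorial : ℝ) ^ s) := by gcongr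
            _ = G ^ 2 * M ^ i * ((i.choose j : ℝ) * ((j.factorial : ℝ) ^ s *
                ((i - j).factorial : ℝ) ^ s)) := by
                rw [show M ^ i = M ^ j * M ^ (i - j) by rw [← pow_add]; congr 1; omega]
                ring
            _ ≤ _ := by
                gcongr
                exact choose_mul_factorial_rpow_le hs hji
      _ = (i + 1 : ℕ) * (G ^ 2 * M ^ i * (i.factorial : ℝ) ^ s) := by simp
      _ ≤ ((l : ℝ) + 1) * (G ^ 2 * M ^ i * (i.factorial : ℝ) ^ s) := by
          gcongr
          exact_mod_cast Nat.succ_le_succ hi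
      _ = _ := by ring
  -- The factor `l + 1`, left by the Leibniz rule for the square, is absorbed in passing from `l!`
  -- to `(l+1)!`.
  have hfac : ((l : ℝ) + 1) * (l.factorial : ℝ) ^ s ≤ ((l + 1).factorial : ℝ) ^ s := by
    rw [Nat.factorial_succ, Nat.cast_mul, Real.mul_rpow (by positivity) (by positivity)]
    gcongr
    push_cast
    calc (l : ℝ) + 1 = ((l : ℝ) + 1) ^ (1 : ℝ) := (Real.rpow_one _).symm
      _ ≤ _ := Real.rpow_le_rpow_of_exponent_le (by linarith [Nat.cast_nonneg (α := ℝ) l]) hs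
  calc ∑ i ∈ Finset.range (l + 1), (l.choose i : ℝ) * ‖iteratedFDeriv ℝ i (fun x => -(g x * g x)) x‖ *
        ‖iteratedFDeriv ℝ (l - i) (fderiv ℝ f) x‖
      ≤ ∑ i ∈ Finset.range (l + 1), (a * C * G ^ 2 * ((l : ℝ) + 1) * (l.factorial : ℝ) ^ s) *
          (M ^ i * a ^ (l - i)) := by
        refine Finset.sum_le_sum fun i hi => ?_
        have hil : i ≤ l := Nat.lt_succ_iff.mp (Finset.mem_range.mp hi)
        have b1 := hsq i hil
        have b2 : ‖iteratedFDeriv ℝ (l - i) (fderiv ℝ f) x‖ ≤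
            C * (a ^ (l - i) * a) * ((l - i).factorial : ℝ) ^ s := by
          rw [norm_iteratedFDeriv_fderiv]
          refine (hf _ x).trans ?_
          have := factorial_add_rpow_le (s := s) (by linarith) (l - i) 1
          simp only [Nat.factorial_one, Nat.cast_one, Real.one_rpow, mul_one] at this
          calc C * h ^ (l - i + 1) * ((l - i + 1).factorial : ℝ) ^ s
              ≤ C * h ^ (l - i + 1) * ((2 ^ s) ^ (l - i + 1) * ((l - i).factorial : ℝ) ^ s) := by gcongr
            _ = _ := by rw [ha, ← pow_succ, mul_pow]; ring
        calc (l.choose i : ℝ) * ‖iteratedFDeriv ℝ i (fun x => -(g x * g x)) x‖ *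
              ‖iteratedFDeriv ℝ (l - i) (fderiv ℝ f) x‖
            ≤ (l.choose i : ℝ) * (G ^ 2 * M ^ i * (l + 1) * (i.factorial : ℝ) ^ s) *
              (C * (a ^ (l - i) * a) * ((l - i).factorial : ℝ) ^ s) := by gcongr
          _ = (a * C * G ^ 2 * ((l : ℝ) + 1)) * (M ^ i * a ^ (l - i)) * ((l.choose i : ℝ) *
              ((i.factorial : ℝ) ^ s * ((l - i).factorial : ℝ) ^ s)) := by ring
          _ ≤ (a * C * G ^ 2 * ((l : ℝ) + 1)) * (M ^ i * a ^ (l - i)) * (l.factorial : ℝ) ^ s := by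
              gcongr
              exact choose_mul_factorial_rpow_le hs hil
          _ = _ := by ring
    _ ≤ (a * C * G ^ 2 * ((l : ℝ) + 1) * (l.factorial : ℝ) ^ s) * (2 * M ^ l) := by
        rw [← Finset.mul_sum]
        gcongr
        exact sum_mul_pow_le ha0 hM1 l
    _ = (2 * a * C * G) * G * M ^ l * (((l : ℝ) + 1) * (l.factorial : ℝ) ^ s) := by ring
    _ ≤ M * G * M ^ l * ((l + 1).factorial : ℝ) ^ s := by gcongr
    _ = _ := by ring

lemma GevBound.comp_smul (hf : GevBound s h C f) (hfs : ContDiff ℝ (⊤ : ℕ∞) f) (a : ℝ) :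
    GevBound s (|a| * h) C (fun x => f (a • x)) := by
  intro l x
  have hl : ((l : ℕ∞) : WithTop ℕ∞) ≤ ((⊤ : ℕ∞) : WithTop ℕ∞) := by exact_mod_cast le_top
  rw [iteratedFDeriv_comp_const_smul a (hfs.of_le hl), norm_smul, norm_pow, Real.norm_eq_abs]
  calc |a| ^ l * ‖iteratedFDeriv ℝ l f (a • x)‖ ≤ |a| ^ l * (C * h ^ l * (l.factorial : ℝ) ^ s) := by
        gcongr
        exact hf l _
    _ = _ := by rw [mul_pow]; ring

end Inverse

/-! ### The partition of unity `σ_k` -/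

section Window

variable {n : ℕ} {s : ℝ} {ρ : Space n → ℝ}

/-- The factor `n` is crude (`√n` is sharp) but the constants may depend on `n`; it is the source of
every `3 * n` below. -/
lemma norm_le_of_abs_le {x : Space n} {a : ℝ} (ha : 0 ≤ a) (hx : ∀ i, |x i| ≤ a) : ‖x‖ ≤ n * a := by
  rw [EuclideanSpace.norm_eq]
  refine Real.sqrt_le_iff.mpr ⟨by positivity, ?_⟩
  calc ∑ i, ‖x i‖ ^ 2 ≤ ∑ _i : Fin n, a ^ 2 := by
        refine Finset.sum_le_sum fun i _ => ?_
        gcongr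
        exact hx i
    _ = n * a ^ 2 := by simp
    _ ≤ (n * n : ℕ) * a ^ 2 := by
        gcongr
        exact_mod_cast Nat.le_mul_self n
    _ = _ := by push_cast; ring

lemma abs_apply_le_norm (x : Space n) (i : Fin n) : |x i| ≤ ‖x‖ := PiLp.norm_apply_le x i

lemma latticePt_apply (k : Fin n → ℤ) (i : Fin n) : (latticePt k : Space n) i = k i := rfl

lemma latticePt_add (k m : Fin n → ℤ) : (latticePt (k + m) : Space n) = latticePt k + latticePt m := by
  ext i
  simp [latticePt_apply]

lemma latticePt_sub (k m : Fin n → ℤ) : (latticePt (k - m) : Space n) = latticePt k - latticePt m := by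
  ext i
  simp [latticePt_apply]

lemma latticePt_zero : (latticePt 0 : Space n) = 0 := by
  ext i
  simp [latticePt_apply]

/-- The lattice points of the cube `[-N,N]ⁿ`. -/
noncomputable def intBox (n N : ℕ) : Finset (Fin n → ℤ) := Fintype.piFinset fun _ => Finset.Icc (-(N : ℤ)) N

lemma mem_intBox {N : ℕ} {m : Fin n → ℤ} : m ∈ intBox n N ↔ ∀ i, |m i| ≤ N := by
  simp only [intBox, Fintype.mem_piFinset, Finset.mem_Icc, abs_le]

/-- `∑_m ρ(ξ - m)`. -/
noncomputable def windowSum (ρ : Space n → ℝ) (ξ : Space n) : ℝ := ∑' m : Fin n → ℤ, ρ (ξ - latticePt m)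

lemma sigma_eq (k : Fin n → ℤ) (ξ : Space n) : sigma ρ k ξ = ρ (ξ - latticePt k) / windowSum ρ ξ := rfl

namespace IsDecompositionWindow

variable (hρ : IsDecompositionWindow ρ)
include hρ

lemma abs_sub_le {ξ : Space n} {m : Fin n → ℤ} (h : ρ (ξ - latticePt m) ≠ 0) (i : Fin n) :
    |ξ i - m i| ≤ 1 :=
  hρ.tsupport_subset (subset_tsupport _ h) i

lemma mem_intBox_of_ne {ξ : Space n} {m : Fin n → ℤ} {N : ℕ} (hξ : ‖ξ‖ < N)
    (h : ρ (ξ - latticePt m) ≠ 0) : m ∈ intBox n N := by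
  refine mem_intBox.mpr fun i => ?_
  have h1 := hρ.abs_sub_le h i
  have h2 := abs_apply_le_norm ξ i
  have h3 : |(m i : ℝ)| < N + 1 := by
    have := abs_sub_abs_le_abs_sub (m i : ℝ) (ξ i)
    rw [abs_sub_comm] at this
    linarith
  have h4 : |m i| < (N : ℤ) + 1 := by exact_mod_cast h3
  omega

lemma windowSum_eq_sum {ξ : Space n} {N : ℕ} (hξ : ‖ξ‖ < N) :
    windowSum ρ ξ = ∑ m ∈ intBox n N, ρ (ξ - latticePt m) :=
  tsum_eq_sum fun m hm => by
    by_contra h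
    exact hm (hρ.mem_intBox_of_ne hξ h)

lemma windowSum_pos (ξ : Space n) : 0 < windowSum ρ ξ := hρ.sum_pos ξ

lemma sum_sigma {ξ : Space n} {N : ℕ} (hξ : ‖ξ‖ < N) : ∑ m ∈ intBox n N, sigma ρ m ξ = 1 := by
  simp_rw [sigma_eq]
  rw [← Finset.sum_div, ← hρ.windowSum_eq_sum hξ, div_self (hρ.windowSum_pos ξ).ne']

omit hρ in
lemma windowSum_add (ξ : Space n) (k : Fin n → ℤ) : windowSum ρ (ξ + latticePt k) = windowSum ρ ξ := by
  unfold windowSum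
  rw [← (Equiv.addRight k).tsum_eq]
  refine tsum_congr fun m => ?_
  simp [latticePt_add]

omit hρ in
lemma windowSum_sub (ξ : Space n) (k : Fin n → ℤ) : windowSum ρ (ξ - latticePt k) = windowSum ρ ξ := by
  rw [← windowSum_add (ξ - latticePt k) k, sub_add_cancel]

-- The denominator is periodic, so all windows are translates of a single one. This is why the
-- Bernstein and kernel constants do not depend on `k`.
omit hρ in
lemma sigma_eq_translate (k : Fin n → ℤ) (ξ : Space n) : sigma ρ k ξ = sigma ρ 0 (ξ - latticePt k) := by
  rw [sigma_eq, sigma_eq, latticePt_zero, sub_zero, windowSum_sub]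

lemma windowSum_eventuallyEq {ξ : Space n} {N : ℕ} (hξ : ‖ξ‖ < N) :
    windowSum ρ =ᶠ[𝓝 ξ] fun ξ => ∑ m ∈ intBox n N, ρ (ξ - latticePt m) := by
  have : ∀ᶠ η : Space n in 𝓝 ξ, ‖η‖ < N := (continuous_norm.tendsto ξ).eventually_lt_const hξ
  filter_upwards [this] with η hη using hρ.windowSum_eq_sum hη

lemma contDiff_windowSum : ContDiff ℝ (⊤ : ℕ∞) (windowSum ρ) := by
  refine contDiff_iff_contDiffAt.mpr fun ξ => ?_
  obtain ⟨N, hN⟩ := exists_nat_gt ‖ξ‖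
  refine ContDiffAt.congr_of_eventuallyEq ?_ (hρ.windowSum_eventuallyEq hN)
  exact (ContDiff.sum fun m _ => hρ.contDiff.comp (contDiff_id.sub contDiff_const)).contDiffAt

omit hρ in
lemma exists_sub_latticePt_le (ξ : Space n) : ∃ k : Fin n → ℤ, ‖ξ - latticePt k‖ ≤ n := by
  refine ⟨fun i => ⌊ξ i⌋, ?_⟩
  have := norm_le_of_abs_le (x := ξ - latticePt fun i => ⌊ξ i⌋) zero_le_one (fun i => ?_)
  · simpa using this
  · have h1 := Int.floor_le (ξ i)
    have h2 := Int.lt_floor_add_one (ξ i)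
    change |ξ i - (⌊ξ i⌋ : ℝ)| ≤ 1
    rw [abs_le]
    constructor <;> linarith

/-- Positivity is uniform because the sum is continuous and lattice-periodic, so a compact set of
frequencies decides. -/
lemma exists_le_windowSum : ∃ c : ℝ, 0 < c ∧ ∀ ξ, c ≤ windowSum ρ ξ := by
  have hK : IsCompact (Metric.closedBall (0 : Space n) n) := isCompact_closedBall _ _
  obtain ⟨ξ₀, -, h₀⟩ := hK.exists_isMinOn ⟨0, by simp⟩ hρ.contDiff_windowSum.continuous.continuousOn
  refine ⟨windowSum ρ ξ₀, hρ.windowSum_pos ξ₀, fun ξ => ?_⟩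
  obtain ⟨k, hk⟩ := exists_sub_latticePt_le ξ
  rw [← windowSum_sub ξ k]
  exact h₀ (by simpa using hk)

/-- Periodicity moves `ξ` into the ball of radius `n`, near which a fixed finite set of translates
of `ρ` contributes. -/
lemma exists_gevBound_windowSum (hgs : (fun ξ => (ρ ξ : ℂ)) ∈ GelfandShilov n s) :
    ∃ h C : ℝ, 0 < h ∧ GevBound s h C (fun ξ => (windowSum ρ ξ : ℂ)) := by
  obtain ⟨hρs, h, C, h0, hb⟩ := hgs
  refine ⟨h, (intBox n (n + 1)).card * C, h0, fun l ξ => ?_⟩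
  obtain ⟨k, hk⟩ := exists_sub_latticePt_le ξ
  have e1 : (fun ξ => (windowSum ρ ξ : ℂ)) = fun ξ => (windowSum ρ (ξ - latticePt k) : ℂ) := by
    simp_rw [windowSum_sub]
  rw [e1, iteratedFDeriv_translate (fun ξ => (windowSum ρ ξ : ℂ))]
  set η := ξ - latticePt k
  have hη : ‖η‖ < (n + 1 : ℕ) := by
    push_cast; linarith
  have e2 : (fun ξ => (windowSum ρ ξ : ℂ)) =ᶠ[𝓝 η]
      fun ξ => ∑ m ∈ intBox n (n + 1), (fun ξ => (ρ ξ : ℂ)) (ξ - latticePt m) := by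
    filter_upwards [hρ.windowSum_eventuallyEq hη] with ζ hζ
    rw [hζ]
    push_cast
    rfl
  rw [(e2.iteratedFDeriv ℝ l).eq_of_nhds]
  have hl : ((l : ℕ∞) : WithTop ℕ∞) ≤ ((⊤ : ℕ∞) : WithTop ℕ∞) := by exact_mod_cast le_top
  have hsm : ∀ m ∈ intBox n (n + 1),
      ContDiffAt ℝ l (fun ξ => (fun ξ => (ρ ξ : ℂ)) (ξ - latticePt m)) η := fun m _ =>
    ((hρs.of_le hl).comp (contDiff_id.sub contDiff_const)).contDiffAt
  rw [iteratedFDeriv_fun_sum_apply hsm]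
  refine (norm_sum_le _ _).trans ?_
  calc ∑ m ∈ intBox n (n + 1), ‖iteratedFDeriv ℝ l (fun ξ => (fun ξ => (ρ ξ : ℂ)) (ξ - latticePt m)) η‖
      ≤ ∑ m ∈ intBox n (n + 1), C * h ^ l * (l.factorial : ℝ) ^ s := by
        refine Finset.sum_le_sum fun m _ => ?_
        rw [iteratedFDeriv_translate (fun ξ => (ρ ξ : ℂ))]
        exact hb.gevBound l _
    _ = _ := by rw [Finset.sum_const, nsmul_eq_mul]; ring

/-- The functions `σ_k` belong to `S_s`. -/
lemma sigma_mem (hs : 1 ≤ s) (hgs : (fun ξ => (ρ ξ : ℂ)) ∈ GelfandShilov n s) (k : Fin n → ℤ) :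
    (fun ξ => (sigma ρ k ξ : ℂ)) ∈ GelfandShilov n s := by
  obtain ⟨h, C, h0, hb⟩ := hρ.exists_gevBound_windowSum hgs
  obtain ⟨c, hc, hcw⟩ := hρ.exists_le_windowSum
  have hsm : ContDiff ℝ (⊤ : ℕ∞) (fun ξ => (windowSum ρ ξ : ℂ)) :=
    Complex.ofRealCLM.contDiff.comp hρ.contDiff_windowSum
  have hcw' : ∀ ξ, c ≤ ‖(windowSum ρ ξ : ℂ)‖ := fun ξ => by
    rw [Complex.norm_real, Real.norm_of_nonneg (hρ.windowSum_pos ξ).le]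
    exact hcw ξ
  obtain ⟨h', h'0, hb'⟩ := hb.exists_inv hs h0.le hsm hc hcw'
  have hne : ∀ ξ, (windowSum ρ ξ : ℂ) ≠ 0 := fun ξ => by exact_mod_cast (hρ.windowSum_pos ξ).ne'
  have := GelfandShilov.mul_gev hs h'0.le (hsm.inv hne) hb'
    (GelfandShilov.translate hs hgs (latticePt k))
  convert this using 2 with ξ
  rw [sigma_eq]
  push_cast
  rw [div_eq_inv_mul]
  rfl

lemma sigma_ne_zero {k : Fin n → ℤ} {ξ : Space n} (h : sigma ρ k ξ ≠ 0) (i : Fin n) : |ξ i - k i| ≤ 1 := by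
  refine hρ.abs_sub_le (fun h' => h ?_) i
  rw [sigma_eq, h', zero_div]

lemma tsupport_sigma_subset (k : Fin n → ℤ) :
    tsupport (fun ξ => (sigma ρ k ξ : ℂ)) ⊆ {ξ | ∀ i, |ξ i - k i| ≤ 1} := by
  refine closure_minimal (fun ξ hξ i => ?_) ?_
  · exact hρ.sigma_ne_zero (fun h => hξ (by simp [h])) i
  · simp only [ofPred_forall]
    exact isClosed_iInter fun i => isClosed_le (by fun_prop) continuous_const

/-- Windows with overlapping supports have indices differing by at most `2` in each coordinate, so
the neighbours sum to one wherever `σ_k` is nonzero. -/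
lemma sigma_sum_neighbours {k : Fin n → ℤ} {ξ : Space n} :
    (sigma ρ k ξ : ℂ) * ∑ m ∈ intBox n 2, (sigma ρ (k + m) ξ : ℂ) = sigma ρ k ξ := by
  by_cases h : sigma ρ k ξ = 0
  · simp [h]
  · have h1 : ∀ i, |(ξ - latticePt k) i| ≤ 1 := hρ.sigma_ne_zero h
    have h2 : ∑ m ∈ intBox n 2, sigma ρ (k + m) ξ = 1 := by
      obtain ⟨N, hN⟩ := exists_nat_gt (max ‖ξ - latticePt k‖ 2)
      have hN2 : 2 ≤ N := by
        have : (2 : ℝ) < N := (le_max_right _ _).trans_lt hN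
        exact_mod_cast this.le
      rw [← hρ.sum_sigma (ξ := ξ - latticePt k) (N := N) ((le_max_left _ _).trans_lt hN)]
      have e : ∀ m, sigma ρ (k + m) ξ = sigma ρ m (ξ - latticePt k) := fun m => by
        rw [sigma_eq_translate (k + m), sigma_eq_translate m, latticePt_add, sub_sub]
      simp_rw [e]
      refine Finset.sum_subset (fun m hm => mem_intBox.mpr fun i => ?_) (fun m _ hm => ?_)
      · exact (mem_intBox.mp hm i).trans (by exact_mod_cast hN2)
      · by_contra h3
        refine hm (mem_intBox.mpr fun i => ?_)
        have h4 := hρ.sigma_ne_zero h3 i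
        have h5 := h1 i
        have h6 : |(m i : ℝ)| ≤ 2 := by
          have := abs_sub_abs_le_abs_sub (m i : ℝ) ((ξ - latticePt k) i)
          rw [abs_sub_comm] at this
          linarith
        exact_mod_cast h6
    have h3 : ∑ m ∈ intBox n 2, (sigma ρ (k + m) ξ : ℂ) = 1 := by exact_mod_cast h2
    rw [h3, mul_one]

end IsDecompositionWindow

end Window

/-! ### What determines a distribution, and localisation on the Fourier side -/

section Determination

variable {n : ℕ} {s : ℝ} {ρ : Space n → ℝ}

lemma one_le_factorial_rpow (hs : 0 ≤ s) (k : ℕ) : (1 : ℝ) ≤ (k.factorial : ℝ) ^ s :=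
  Real.one_le_rpow (by exact_mod_cast Nat.succ_le_of_lt k.factorial_pos) hs

/-- Bounded functions with bounded support have the decay of elements of `S_s`. -/
lemma hasDecay_of_bounded_support (hs : 0 ≤ s) {w : Space n → ℂ} (hw : AEStronglyMeasurable w)
    {B R : ℝ} (hR : 0 < R) (hB : ∀ x, ‖w x‖ ≤ B) (hsupp : ∀ x, w x ≠ 0 → ‖x‖ ≤ R) : HasDecay s w := by
  have hB0 : 0 ≤ B := (norm_nonneg _).trans (hB 0)
  refine ⟨hw, R, B, hR, fun k x => ?_⟩
  by_cases hx : w x = 0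
  · rw [hx, norm_zero, mul_zero]; positivity
  · calc ‖x‖ ^ k * ‖w x‖ ≤ R ^ k * B := by
          gcongr
          · exact hsupp x hx
          · exact hB x
      _ = B * R ^ k * 1 := by ring
      _ ≤ _ := by
          gcongr
          exact one_le_factorial_rpow hs k

lemma pair_fourierT_sum (hs : 1 ≤ s) (T : GelfandShilovDual n s) {ι : Type*} (F : Finset ι)
    (f : ι → Space n → ℂ) (hf : ∀ i, f i ∈ GelfandShilov n s) :
    (fun ξ => ∑ i ∈ F, f i ξ) ∈ GelfandShilov n s ∧
      pair T (fourierT fun ξ => ∑ i ∈ F, f i ξ) = ∑ i ∈ F, pair T (fourierT (f i)) := by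
  classical
  induction F using Finset.induction_on with
  | empty =>
    have : (fun _ : Space n => (0 : ℂ)) = 0 := rfl
    simp only [Finset.sum_empty]
    refine ⟨Submodule.zero_mem _, ?_⟩
    have h1 : fourierT (fun _ : Space n => (0 : ℂ)) = 0 := by
      funext ξ
      simp [fourierT]
    rw [h1, pair_zero]
  | insert i F hi ih =>
    simp only [Finset.sum_insert hi]
    refine ⟨Submodule.add_mem _ (hf i) ih.1, ?_⟩
    rw [fourierT_add (GelfandShilov.integrable (by linarith) (hf i))
      (GelfandShilov.integrable (by linarith) ih.1)]
    have := pair_add T (GelfandShilov.fourierT hs (hf i)) (GelfandShilov.fourierT hs ih.1)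
    rw [← ih.2, ← this]
    rfl

lemma GelfandShilov.dilate_mul (hs : 1 ≤ s) {χ ψ : Space n → ℂ} (hχ : χ ∈ GelfandShilov n s)
    (hψ : ψ ∈ GelfandShilov n s) (a : ℝ) : (fun ξ => χ (a • ξ) * ψ ξ) ∈ GelfandShilov n s := by
  obtain ⟨hχs, h, C, h0, hb⟩ := hχ
  exact GelfandShilov.mul_gev hs (by positivity) (hχs.comp (contDiff_const_smul a))
    (hb.gevBound.comp_smul hχs a) hψ

/-- A functional that vanishes on the Fourier transforms of compactly supported functions is zero. -/
theorem pair_eq_zero_of_compactSupport (hs : 1 ≤ s) (hρ : IsDecompositionWindow ρ)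
    (hgs : (fun ξ => (ρ ξ : ℂ)) ∈ GelfandShilov n s) (T : GelfandShilovDual n s)
    (hT : ∀ ψ ∈ GelfandShilov n s, HasCompactSupport ψ → pair T (fourierT ψ) = 0)
    {ψ : Space n → ℂ} (hψ : ψ ∈ GelfandShilov n s) : pair T (fourierT ψ) = 0 := by
  obtain ⟨hρs, h₁, C₁, h₁0, hb₁⟩ := id hgs
  obtain ⟨hψs, h₂, C₂, h₂0, hb₂⟩ := id hψ
  have hC₁ := hb₁.nonneg
  have hC₂ := hb₂.nonneg
  set H := 2 * max h₁ h₂ with hH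
  have hm0 : 0 < max h₁ h₂ := lt_max_of_lt_left h₁0
  have hH0 : 0 < H := by positivity
  set H' := H * 2 ^ s with hH'
  have hH'0 : 0 < H' := by positivity
  have h2s : (1 : ℝ) ≤ 2 ^ s := Real.one_le_rpow (by norm_num) (by linarith)
  have hHH' : H ≤ H' := le_mul_of_one_le_right hH0.le h2s
  set A := C₂ + C₁ * C₂ with hA
  have hA0 : 0 ≤ A := by positivity
  let cut : ℕ → Space n → ℂ := fun N ξ => (ρ (((N : ℝ) + 1)⁻¹ • ξ) : ℂ) * ψ ξ
  have hcutmem : ∀ N, cut N ∈ GelfandShilov n s := fun N =>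
    GelfandShilov.dilate_mul hs hgs hψ _
  have hcutc : ∀ N, HasCompactSupport (cut N) := by
    intro N
    refine HasCompactSupport.of_support_subset_isCompact
      (isCompact_closedBall (0 : Space n) (((N : ℝ) + 1) * n)) fun ξ hξ => ?_
    have h1 : ρ (((N : ℝ) + 1)⁻¹ • ξ) ≠ 0 := fun h => hξ (by simp [cut, h])
    have h2 := norm_le_of_abs_le zero_le_one (hρ.tsupport_subset (subset_tsupport _ h1))
    rw [norm_smul, Real.norm_of_nonneg (by positivity), inv_mul_le_iff₀ (by positivity), mul_one] at h2
    simpa using h2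
  have hcutb : ∀ N, GSBound s H (C₁ * C₂) (cut N) := by
    intro N
    -- Dilating by a factor at most one does not increase Gevrey bounds, so the cut-offs are bounded
    -- in one `S_{s,h}` uniformly in `N`.
    have h1 : |((N : ℝ) + 1)⁻¹| ≤ 1 := by
      rw [abs_of_nonneg (by positivity)]
      exact inv_le_one_of_one_le₀ (by linarith [Nat.cast_nonneg (α := ℝ) N])
    have h2 : GevBound s h₁ C₁ (fun ξ => (ρ (((N : ℝ) + 1)⁻¹ • ξ) : ℂ)) :=
      (hb₁.gevBound.comp_smul hρs (((N : ℝ) + 1)⁻¹)).mono (by positivity)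
        (mul_le_of_le_one_left h₁0.le h1) le_rfl
    exact GSBound.mul_gevBound hs h₁0.le h₂0.le (hρs.comp (contDiff_const_smul _)) hψs h2 hb₂
  have hdiffb : ∀ N, GSBound s H A (fun ξ => ψ ξ - cut N ξ) := by
    intro N k l x
    have hl : ((l : ℕ∞) : WithTop ℕ∞) ≤ ((⊤ : ℕ∞) : WithTop ℕ∞) := by exact_mod_cast le_top
    have e : iteratedFDeriv ℝ l (fun ξ => ψ ξ - cut N ξ) x =
        iteratedFDeriv ℝ l ψ x - iteratedFDeriv ℝ l (cut N) x :=
      iteratedFDeriv_sub_apply (hψs.of_le hl).contDiffAt ((hcutmem N).1.of_le hl).contDiffAt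
    have hb₂' := hb₂.mono (h' := H) h₂0.le (by linarith [le_max_right h₁ h₂]) le_rfl
    rw [e]
    calc ‖x‖ ^ k * ‖iteratedFDeriv ℝ l ψ x - iteratedFDeriv ℝ l (cut N) x‖
        ≤ ‖x‖ ^ k * (‖iteratedFDeriv ℝ l ψ x‖ + ‖iteratedFDeriv ℝ l (cut N) x‖) := by
          gcongr
          exact norm_sub_le _ _
      _ = ‖x‖ ^ k * ‖iteratedFDeriv ℝ l ψ x‖ + ‖x‖ ^ k * ‖iteratedFDeriv ℝ l (cut N) x‖ := by ring
      _ ≤ _ := add_le_add (hb₂' k l x) (hcutb N k l x)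
      _ = _ := by rw [hA]; ring
  -- The difference vanishes for `‖x‖ < (N+1)/2`, where the cut-off is one. Elsewhere one further
  -- power of `‖x‖`, at the price of a larger parameter, is worth the factor `2/(N+1)`.
  have hsmall : ∀ N : ℕ, GSBound s H' (2 / ((N : ℝ) + 1) * (A * H')) (fun ξ => ψ ξ - cut N ξ) := by
    intro N k l x
    by_cases hx : ‖x‖ < ((N : ℝ) + 1) / 2
    · have e : (fun ξ => ψ ξ - cut N ξ) =ᶠ[𝓝 x] fun _ => 0 := by
        have : ∀ᶠ y : Space n in 𝓝 x, ‖y‖ < ((N : ℝ) + 1) / 2 :=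
          (continuous_norm.tendsto x).eventually_lt_const hx
        filter_upwards [this] with y hy
        have h1 : ρ (((N : ℝ) + 1)⁻¹ • y) = 1 := by
          refine hρ.eq_one _ ?_
          rw [norm_smul, Real.norm_of_nonneg (by positivity), inv_mul_le_iff₀ (by positivity)]
          linarith
        simp [cut, h1]
      rw [(e.iteratedFDeriv ℝ l).eq_of_nhds, iteratedFDeriv_fun_zero]
      simp only [Pi.zero_apply, norm_zero, mul_zero]
      positivity
    · push Not at hx
      have h1 : 1 ≤ 2 / ((N : ℝ) + 1) * ‖x‖ := by
        rw [div_mul_eq_mul_div, le_div_iff₀ (by positivity)]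
        linarith
      set D := ‖iteratedFDeriv ℝ l (fun ξ => ψ ξ - cut N ξ) x‖
      have h3 := factorial_add_rpow_le (s := s) (by linarith) k 1
      simp only [Nat.factorial_one, Nat.cast_one, Real.one_rpow, mul_one] at h3
      have h4 := hdiffb N (k + 1) l x
      rw [Real.mul_rpow (by positivity) (by positivity)] at h4 ⊢
      calc ‖x‖ ^ k * D ≤ (2 / ((N : ℝ) + 1) * ‖x‖) * (‖x‖ ^ k * D) :=
            le_mul_of_one_le_left (by positivity) h1
        _ = 2 / ((N : ℝ) + 1) * (‖x‖ ^ (k + 1) * D) := by ring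
        _ ≤ 2 / ((N : ℝ) + 1) * (A * H ^ (k + 1 + l) *
            (((2 ^ s) ^ (k + 1) * (k.factorial : ℝ) ^ s) * (l.factorial : ℝ) ^ s)) := by
            exact mul_le_mul_of_nonneg_left (h4.trans (mul_le_mul_of_nonneg_left
              (mul_le_mul_of_nonneg_right h3 (by positivity)) (by positivity))) (by positivity)
        _ ≤ 2 / ((N : ℝ) + 1) * (A * H ^ (k + 1 + l) *
            (((2 ^ s) ^ (k + 1 + l) * (k.factorial : ℝ) ^ s) * (l.factorial : ℝ) ^ s)) := by
            have h5 : ((2 : ℝ) ^ s) ^ (k + 1) ≤ (2 ^ s) ^ (k + 1 + l) :=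
              pow_le_pow_right₀ h2s (by omega)
            gcongr
        _ = _ := by
            rw [hH', show k + 1 + l = (k + l) + 1 by ring, pow_succ, pow_succ, mul_pow]
            ring
  obtain ⟨H'', K', hH'', hK', hF⟩ := GSBound.exists_fourierT n hs hH'0
  obtain ⟨K, hK, hpb⟩ := pair_bound T hH''
  have hle : ∀ N : ℕ, ‖pair T (fourierT ψ)‖ ≤ K * (K' * (2 / ((N : ℝ) + 1) * (A * H'))) := by
    intro N
    have hdm : (fun ξ => ψ ξ - cut N ξ) ∈ GelfandShilov n s := Submodule.sub_mem _ hψ (hcutmem N)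
    obtain ⟨f1, f2⟩ := hF _ _ hdm.1 (hsmall N)
    have f3 := hpb _ _ f1 f2
    rw [fourierT_sub (GelfandShilov.integrable (by linarith) hψ)
      (GelfandShilov.integrable (by linarith) (hcutmem N))] at f3
    have f4 := pair_sub T (GelfandShilov.fourierT hs hψ) (GelfandShilov.fourierT hs (hcutmem N))
    rw [hT _ (hcutmem N) (hcutc N), sub_zero] at f4
    rw [← f4]
    exact f3
  have hlim : Tendsto (fun N : ℕ => K * (K' * (2 / ((N : ℝ) + 1) * (A * H')))) atTop (𝓝 0) := by
    have h1 : Tendsto (fun N : ℕ => 2 / ((N : ℝ) + 1)) atTop (𝓝 0) := by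
      have := (tendsto_one_div_add_atTop_nhds_zero_nat (𝕜 := ℝ)).const_mul 2
      simpa [div_eq_mul_inv] using this
    have := ((h1.mul_const (A * H')).const_mul K').const_mul K
    simpa using this
  exact norm_le_zero_iff.mp (ge_of_tendsto' hlim hle)

/-- Every element of `S_s` is the Fourier transform of another one, so tests of the form `fourierT
ψ` see the whole functional. -/
lemma eq_of_pair_eq (hs : 1 ≤ s) (hρ : IsDecompositionWindow ρ)
    (hgs : (fun ξ => (ρ ξ : ℂ)) ∈ GelfandShilov n s) (T U : GelfandShilovDual n s)
    (hT : ∀ ψ ∈ GelfandShilov n s, HasCompactSupport ψ → pair T (fourierT ψ) = pair U (fourierT ψ)) :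
    T = U := by
  have hsub : ∀ g ∈ GelfandShilov n s, pair (T - U) g = pair T g - pair U g := by
    intro g hg
    rw [pair_of_mem hg, pair_of_mem hg, pair_of_mem hg]
    rfl
  rw [← sub_eq_zero]
  refine Subtype.ext (LinearMap.ext fun φ => ?_)
  have h1 := GelfandShilov.neg_arg (GelfandShilov.fourierT hs φ.2)
  have h2 : fourierT (fun x => fourierT (φ : Space n → ℂ) (-x)) = φ := by
    funext x
    rw [fourierT_neg_arg, fourierT_fourierT hs φ.2, neg_neg]
  have h3 := pair_eq_zero_of_compactSupport hs hρ hgs (T - U) (fun ψ hψ hc => by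
    rw [hsub _ (GelfandShilov.fourierT hs hψ), hT ψ hψ hc, sub_self]) h1
  rw [h2, pair_of_mem φ.2] at h3
  exact h3

/-- `F T` vanishes on test functions supported away from its support. -/
theorem pair_fourierT_eq_zero_of_disjoint (hs : 1 ≤ s) (hρ : IsDecompositionWindow ρ)
    (hgs : (fun ξ => (ρ ξ : ℂ)) ∈ GelfandShilov n s) (T : GelfandShilovDual n s)
    {φ : Space n → ℂ} (hφ : φ ∈ GelfandShilov n s) (hc : HasCompactSupport φ)
    (hd : Disjoint (tsupport φ) (fourierSupport T)) : pair T (fourierT φ) = 0 := by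
  -- The open sets on which `F T` vanishes. They cover the support of `φ`, and a partition of unity
  -- finer than a Lebesgue number of the cover passes from local to global vanishing.
  let ι := {U : Set (Space n) // IsOpen U ∧ ∀ φ ∈ GelfandShilov n s, HasCompactSupport φ →
    tsupport φ ⊆ U → pair T (fourierT φ) = 0}
  have hcover : tsupport φ ⊆ ⋃ U : ι, (U : Set (Space n)) := by
    intro ξ hξ
    have h1 : ξ ∉ fourierSupport T := fun h => disjoint_left.mp hd hξ h
    unfold fourierSupport at h1
    simp only [mem_ofPred_eq, not_forall] at h1
    obtain ⟨U, hU, hξU, h2⟩ := h1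
    push Not at h2
    exact mem_iUnion.mpr ⟨⟨U, hU, h2⟩, hξU⟩
  obtain ⟨δ, hδ, hleb⟩ := lebesgue_number_lemma_of_metric hc (fun U : ι => U.2.1) hcover
  -- Points of one dilated window differ by at most `2t` per coordinate, hence by at most `2nt = δ
  -- n/(n+1) < δ` in norm.
  set t := δ / (2 * ((n : ℝ) + 1)) with ht
  have ht0 : 0 < t := by positivity
  obtain ⟨r, hr⟩ := hc.isBounded.exists_norm_le
  obtain ⟨N, hN⟩ := exists_nat_gt (t⁻¹ * r)
  have hmem : ∀ m : Fin n → ℤ, (fun ξ => (sigma ρ m (t⁻¹ • ξ) : ℂ) * φ ξ) ∈ GelfandShilov n s :=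
    fun m => GelfandShilov.dilate_mul hs (hρ.sigma_mem hs hgs m) hφ _
  have hsum : φ = fun ξ => ∑ m ∈ intBox n N, (sigma ρ m (t⁻¹ • ξ) : ℂ) * φ ξ := by
    funext ξ
    by_cases hξ : φ ξ = 0
    · simp [hξ]
    · have h1 := hr ξ (subset_tsupport _ hξ)
      have h2 : ‖t⁻¹ • ξ‖ < N := by
        rw [norm_smul, Real.norm_of_nonneg (by positivity)]
        refine lt_of_le_of_lt ?_ hN
        gcongr
      have h3 := hρ.sum_sigma h2
      rw [← Finset.sum_mul]
      have h4 : ∑ m ∈ intBox n N, (sigma ρ m (t⁻¹ • ξ) : ℂ) = 1 := by exact_mod_cast h3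
      rw [h4, one_mul]
  rw [hsum, (pair_fourierT_sum hs T (intBox n N) _ hmem).2]
  refine Finset.sum_eq_zero fun m _ => ?_
  set f : Space n → ℂ := fun ξ => (sigma ρ m (t⁻¹ • ξ) : ℂ) * φ ξ with hf
  by_cases hne : (tsupport f).Nonempty
  swap
  · rw [not_nonempty_iff_eq_empty, tsupport_eq_empty_iff] at hne
    rw [hne]
    have h1 : fourierT (0 : Space n → ℂ) = 0 := by
      funext ξ
      simp [fourierT]
    rw [h1, pair_zero]
  obtain ⟨ξ₀, hξ₀⟩ := hne
  have hsub : tsupport f ⊆ tsupport φ := tsupport_mul_subset_right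
  have hsub2 : tsupport f ⊆ {ξ | ∀ i, |(t⁻¹ • ξ) i - m i| ≤ 1} := by
    refine closure_minimal (fun ξ hξ => ?_) ?_
    · exact hρ.sigma_ne_zero (fun h => hξ (by simp [hf, h]))
    · simp only [ofPred_forall]
      exact isClosed_iInter fun i => isClosed_le (by fun_prop) continuous_const
  obtain ⟨U, hU⟩ := hleb ξ₀ (hsub hξ₀)
  refine U.2.2 f (hmem m) (hc.mono (Function.support_mul_subset_right _ _)) (fun ξ hξ => hU ?_)
  rw [mem_ball_iff_norm]
  have h1 : ∀ i, |(ξ - ξ₀) i| ≤ 2 * t := by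
    intro i
    have a1 := hsub2 hξ i
    have a2 := hsub2 hξ₀ i
    have a3 : |t⁻¹ * (ξ - ξ₀) i| ≤ 2 := by
      have e : t⁻¹ * (ξ - ξ₀) i = ((t⁻¹ • ξ) i - m i) - ((t⁻¹ • ξ₀) i - m i) := by
        simp only [PiLp.sub_apply, PiLp.smul_apply, smul_eq_mul]; ring
      rw [e]
      refine (abs_sub _ _).trans ?_
      linarith
    rwa [abs_mul, abs_of_pos (inv_pos.mpr ht0), inv_mul_le_iff₀ ht0, mul_comm] at a3
  refine (norm_le_of_abs_le (by positivity) h1).trans_lt ?_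
  rw [ht]
  have : (n : ℝ) * (2 * (δ / (2 * ((n : ℝ) + 1)))) = δ * (n / ((n : ℝ) + 1)) := by field_simp
  rw [this]
  have h2 : (n : ℝ) / ((n : ℝ) + 1) < 1 := by
    rw [div_lt_one (by positivity)]
    linarith
  exact mul_lt_of_lt_one_right hδ h2

/-- The mollifications of a continuous function belong to `S_s`. -/
lemma conv_mem_gelfandShilov (hs : 1 ≤ s) {w g : Space n → ℂ} (hg : g ∈ GelfandShilov n s)
    (hw : HasDecay s w) : conv w g ∈ GelfandShilov n s := (pair_conv hs 0 hg hw).1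

lemma IsRepresentedBy.exists_bound {T : GelfandShilovDual n s} {u : Space n → ℂ}
    (hu : IsRepresentedBy T u) : ∃ M : ℝ, 0 ≤ M ∧ ∀ᵐ x, ‖u x‖ ≤ M := by
  have h1 : eLpNormEssSup u volume < ∞ := by
    have := hu.1.2
    rwa [eLpNorm_exponent_top] at this
  refine ⟨(eLpNormEssSup u volume).toReal, ENNReal.toReal_nonneg, ?_⟩
  filter_upwards [ae_le_eLpNormEssSup (f := u) (μ := volume)] with x hx
  have := ENNReal.toReal_mono h1.ne hx
  simpa using this

/-- A bounded function is determined by its integrals against `S_s`. -/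
theorem ae_eq_zero_of_integral_eq_zero (hs : 1 ≤ s) (hρ : IsDecompositionWindow ρ)
    (hgs : (fun ξ => (ρ ξ : ℂ)) ∈ GelfandShilov n s) {u : Space n → ℂ} (hum : AEStronglyMeasurable u)
    {M : ℝ} (hM0 : 0 ≤ M) (hM : ∀ᵐ x, ‖u x‖ ≤ M)
    (h0 : ∀ φ ∈ GelfandShilov n s, ∫ x, u x * φ x = 0) : ∀ᵐ x, u x = 0 := by
  obtain ⟨hρs, h₁, C₁, h₁0, hb₁⟩ := id hgs
  have hloc : LocallyIntegrable u := by
    refine (locallyIntegrable_const M).mono hum ?_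
    filter_upwards [hM] with x hx
    rwa [Real.norm_of_nonneg hM0]
  have hρsupp : ∀ x, ρ x ≠ 0 → ‖x‖ ≤ n := fun x hx => by
    have := norm_le_of_abs_le zero_le_one (hρ.tsupport_subset (subset_tsupport _ hx))
    simpa using this
  have hρc : HasCompactSupport ρ := HasCompactSupport.of_support_subset_isCompact
    (isCompact_closedBall (0 : Space n) n) fun x hx => by simpa using hρsupp x hx
  have hρi : Integrable ρ := hρ.contDiff.continuous.integrable_of_hasCompactSupport hρc
  have hI : 0 < ∫ x, ρ x := by
    refine (integral_pos_iff_support_of_nonneg (fun x => (hρ.mem_Icc x).1) hρi).mpr ?_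
    refine hρ.contDiff.continuous.isOpen_support.measure_pos _ ⟨0, ?_⟩
    have := hρ.eq_one 0 (by norm_num)
    simp [this]
  set I := ∫ x, ρ x
  let φ : Space n → ℝ := fun x => I⁻¹ * ρ x
  refine ae_eq_zero_of_integral_contDiff_smul_eq_zero hloc fun g hg hgc => ?_
  obtain ⟨B, hB⟩ := hgc.exists_bound_of_continuous hg.continuous
  have hB0 : 0 ≤ B := (norm_nonneg _).trans (hB 0)
  obtain ⟨R, hR⟩ := hgc.isBounded.exists_norm_le
  have hgsupp : ∀ x, g x ≠ 0 → ‖x‖ ≤ max R 1 := fun x hx => (hR x (subset_tsupport _ hx)).trans (le_max_left _ _)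
  have hgi : Integrable g := hg.continuous.integrable_of_hasCompactSupport hgc
  let gC : Space n → ℂ := fun x => (g x : ℂ)
  have hgCc : Continuous gC := Complex.continuous_ofReal.comp hg.continuous
  have hgd : HasDecay s gC := hasDecay_of_bounded_support (by linarith) hgCc.aestronglyMeasurable
    (R := max R 1) (by positivity) (fun x => by simpa [gC] using hB x)
    (fun x hx => hgsupp x (fun h => hx (by simp [gC, h])))
  -- An approximate identity made from `ρ`. Being Gevrey, it carries an arbitrary smooth compactly
  -- supported test function into `S_s` by convolution.
  let φC : ℕ → Space n → ℂ := fun N x => ((((N : ℝ) + 1) ^ n * φ (((N : ℝ) + 1) • x) : ℝ) : ℂ)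
  have hφC : ∀ N, φC N ∈ GelfandShilov n s := by
    intro N
    have h1 := hb₁.gevBound.comp_smul hρs ((N : ℝ) + 1)
    have h2 : (fun x => (ρ (((N : ℝ) + 1) • x) : ℂ)) ∈ GelfandShilov n s := by
      refine ⟨hρs.comp (contDiff_const_smul _), _, _, ?_, h1.gsBound_of_support (by linarith)
        (by positivity) (r := (n : ℝ) + 1) (by linarith [Nat.cast_nonneg (α := ℝ) n]) fun x hx => ?_⟩
      · exact lt_max_of_lt_right (by positivity)
      · have h3 := hρsupp (((N : ℝ) + 1) • x) (by exact_mod_cast hx)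
        rw [norm_smul, Real.norm_of_nonneg (by positivity)] at h3
        nlinarith [norm_nonneg x, Nat.cast_nonneg (α := ℝ) N]
    have h3 := Submodule.smul_mem _ ((((N : ℝ) + 1) ^ n * I⁻¹ : ℝ) : ℂ) h2
    convert h3 using 1
    funext x
    simp only [φC, φ, Pi.smul_apply, smul_eq_mul]
    push_cast
    ring
  have hz : ∀ N, ∫ x, u x * conv gC (φC N) x = 0 := fun N =>
    h0 _ (conv_mem_gelfandShilov hs (hφC N) hgd)
  have hreal : ∀ N x, conv gC (φC N) x =
      ((∫ y, (((N : ℝ) + 1) ^ n * φ (((N : ℝ) + 1) • (x - y))) • g y : ℝ) : ℂ) := by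
    intro N x
    rw [← integral_complex_ofReal]
    refine integral_congr_ae (Eventually.of_forall fun y => ?_)
    simp only [gC, φC, smul_eq_mul]
    push_cast
    ring
  have hφ0 : ∀ x, 0 ≤ φ x := fun x => mul_nonneg (inv_nonneg.mpr hI.le) (hρ.mem_Icc x).1
  have hφ1 : ∫ x, φ x = 1 := by
    simp only [φ]
    rw [integral_const_mul, inv_mul_cancel₀ hI.ne']
  have hφcs : HasCompactSupport φ := hρc.mul_left
  have hφt : Tendsto (fun x : Space n => ‖x‖ ^ Module.finrank ℝ (Space n) * φ x)
      (Bornology.cobounded (Space n)) (𝓝 0) := by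
    have h1 : HasCompactSupport fun x : Space n => ‖x‖ ^ Module.finrank ℝ (Space n) * φ x :=
      hφcs.mul_left
    rw [Metric.cobounded_eq_cocompact]
    exact h1.is_zero_at_infty
  have hlim : ∀ x, Tendsto (fun N : ℕ => conv gC (φC N) x) atTop (𝓝 (gC x)) := by
    intro x
    have h1 := tendsto_integral_comp_smul_smul_of_integrable' (μ := volume) hφ0 hφ1 hφt hgi
      (hg.continuous.continuousAt (x := x))
    have h2 : Tendsto (fun N : ℕ => (N : ℝ) + 1) atTop atTop :=
      tendsto_natCast_atTop_atTop.atTop_add tendsto_const_nhds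
    have h3 := (Complex.continuous_ofReal.tendsto _).comp (h1.comp h2)
    refine h3.congr fun N => ?_
    rw [hreal]
    simp only [Function.comp, finrank_euclideanSpace_fin]
  -- The mollifiers have mass one and support in the ball of radius `n`, so the mollified functions
  -- share the sup bound `B` and a bounded support.
  have hbound : ∀ N x, ‖conv gC (φC N) x‖ ≤ (Metric.closedBall (0 : Space n) (max R 1 + n)).indicator
      (fun _ => B) x := by
    intro N x
    have hN1 : (1 : ℝ) ≤ (N : ℝ) + 1 := by linarith [Nat.cast_nonneg (α := ℝ) N]
    rw [hreal, Complex.norm_real]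
    by_cases hx : x ∈ Metric.closedBall (0 : Space n) (max R 1 + n)
    · rw [indicator_of_mem hx]
      have hi1 : Integrable (fun y => ((N : ℝ) + 1) ^ n * φ (((N : ℝ) + 1) • (x - y))) := by
        have h1 : Integrable φ := hρi.const_mul _
        have h2 := h1.comp_smul (R := (N : ℝ) + 1) (by linarith)
        exact ((h2.comp_sub_left x)).const_mul _
      have hone : ∫ y, ((N : ℝ) + 1) ^ n * φ (((N : ℝ) + 1) • (x - y)) = 1 := by
        rw [integral_const_mul, integral_sub_left_eq_self (fun y => φ (((N : ℝ) + 1) • y)) volume x,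
          Measure.integral_comp_smul, hφ1, finrank_euclideanSpace_fin, abs_of_pos (by positivity),
          smul_eq_mul, mul_one, mul_inv_cancel₀ (by positivity)]
      refine (norm_integral_le_of_norm_le (hi1.mul_const B) (Eventually.of_forall fun y => ?_)).trans
        (le_of_eq ?_)
      · rw [norm_smul, Real.norm_of_nonneg (mul_nonneg (by positivity) (hφ0 _))]
        exact mul_le_mul_of_nonneg_left (hB y) (mul_nonneg (by positivity) (hφ0 _))
      · rw [integral_mul_const, hone, one_mul]
    · rw [indicator_of_notMem hx, norm_le_zero_iff]
      refine integral_eq_zero_of_ae (Eventually.of_forall fun y => ?_)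
      simp only [smul_eq_mul, Pi.zero_apply, mul_eq_zero]
      by_contra hcon
      push Not at hcon
      obtain ⟨⟨-, h1⟩, h2⟩ := hcon
      have h3 : ρ (((N : ℝ) + 1) • (x - y)) ≠ 0 := fun h => h1 (by simp [φ, h])
      have h4 := hρsupp _ h3
      have h5 := hgsupp y h2
      rw [norm_smul, Real.norm_of_nonneg (by positivity)] at h4
      have h6 : ‖x - y‖ ≤ n := by nlinarith [norm_nonneg (x - y)]
      have h7 := norm_add_le (x - y) y
      rw [sub_add_cancel] at h7
      exact hx (by simpa using by linarith)
  have hdct := tendsto_integral_of_dominated_convergence (μ := volume)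
    (F := fun (N : ℕ) x => u x * conv gC (φC N) x) (f := fun x => u x * gC x)
    (fun x => M * (Metric.closedBall (0 : Space n) (max R 1 + n)).indicator (fun _ => B) x)
    (fun N => hum.mul (conv_mem_gelfandShilov hs (hφC N) hgd).1.continuous.aestronglyMeasurable)
    (((integrable_indicator_iff Metric.isClosed_closedBall.measurableSet).mpr
      (integrableOn_const measure_closedBall_lt_top.ne)).const_mul M)
    (fun N => by
      filter_upwards [hM] with x hx
      rw [norm_mul]
      exact mul_le_mul hx (hbound N x) (norm_nonneg _) hM0)
    (Eventually.of_forall fun x => (hlim x).const_mul (u x))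
  simp only [hz] at hdct
  have h1 := tendsto_nhds_unique hdct tendsto_const_nhds
  rw [← h1]
  refine integral_congr_ae (Eventually.of_forall fun x => ?_)
  simp only [gC, Complex.real_smul]
  ring

end Determination

/-! ### Hölder, Minkowski and Young for functions with values in `[0,∞]` -/

section LpInequalities

variable {α : Type*} [MeasurableSpace α] {μ : Measure α} {p q : ℝ≥0∞}

lemma eLpNorm_ennreal_eq (hq0 : q ≠ 0) (hq : q ≠ ∞) (f : α → ℝ≥0∞) :
    eLpNorm f q μ = (∫⁻ x, f x ^ q.toReal ∂μ) ^ (1 / q.toReal) := by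
  simp [eLpNorm_eq_lintegral_rpow_enorm_toReal hq0 hq]

lemma eLpNorm_ennreal_top (f : α → ℝ≥0∞) : eLpNorm f ∞ μ = essSup f μ := by
  simp [eLpNormEssSup]

lemma eLpNorm_ennreal_const_mul (c : ℝ≥0∞) {f : α → ℝ≥0∞} (hf : Measurable f) (hq0 : q ≠ 0) :
    eLpNorm (fun x => c * f x) q μ = c * eLpNorm f q μ := by
  by_cases hq : q = ∞
  · subst hq
    rw [eLpNorm_ennreal_top, eLpNorm_ennreal_top, ENNReal.essSup_const_mul]
  · have h0 := ENNReal.toReal_pos hq0 hq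
    rw [eLpNorm_ennreal_eq hq0 hq, eLpNorm_ennreal_eq hq0 hq]
    simp only [ENNReal.mul_rpow_of_nonneg _ _ h0.le]
    rw [lintegral_const_mul _ (hf.pow_const _), ENNReal.mul_rpow_of_nonneg _ _ (by positivity),
      ← ENNReal.rpow_mul, mul_one_div_cancel h0.ne', ENNReal.rpow_one]

lemma toReal_inv_add_inv (h : p⁻¹ + q⁻¹ = 1) (hp : p ≠ ∞) (hq : q ≠ ∞) :
    p ≠ 0 ∧ q ≠ 0 ∧ p.toReal⁻¹ + q.toReal⁻¹ = 1 := by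
  have hp0 : p ≠ 0 := by rintro rfl; simp at h
  have hq0 : q ≠ 0 := by rintro rfl; simp at h
  refine ⟨hp0, hq0, ?_⟩
  rw [← ENNReal.toReal_inv, ← ENNReal.toReal_inv, ← ENNReal.toReal_add (by simpa) (by simpa), h,
    ENNReal.toReal_one]

/-- Hölder's inequality. -/
theorem lintegral_mul_le_eLpNorm_mul {f g : α → ℝ≥0∞} (hf : AEMeasurable f μ)
    (hg : AEMeasurable g μ) (h : p⁻¹ + q⁻¹ = 1) :
    ∫⁻ x, f x * g x ∂μ ≤ eLpNorm f p μ * eLpNorm g q μ := by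
  by_cases hp : p = ∞
  · subst hp
    have hq : q = 1 := by simpa using h
    subst hq
    rw [eLpNorm_ennreal_top, eLpNorm_ennreal_eq one_ne_zero ENNReal.one_ne_top]
    simp only [ENNReal.toReal_one, ENNReal.rpow_one, div_one]
    rw [← lintegral_const_mul'' _ hg]
    refine lintegral_mono_ae ?_
    filter_upwards [ENNReal.ae_le_essSup f] with x hx using by gcongr
  by_cases hq : q = ∞
  · subst hq
    have hp1 : p = 1 := by simpa using h
    subst hp1
    rw [eLpNorm_ennreal_top, eLpNorm_ennreal_eq one_ne_zero ENNReal.one_ne_top]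
    simp only [ENNReal.toReal_one, ENNReal.rpow_one, div_one]
    rw [← lintegral_mul_const'' _ hf]
    refine lintegral_mono_ae ?_
    filter_upwards [ENNReal.ae_le_essSup g] with x hx using by gcongr
  obtain ⟨hp0, hq0, h1⟩ := toReal_inv_add_inv h hp hq
  have h2 := ENNReal.toReal_pos hp0 hp
  have h3 := ENNReal.toReal_pos hq0 hq
  rw [eLpNorm_ennreal_eq hp0 hp, eLpNorm_ennreal_eq hq0 hq, one_div, one_div]
  have h4 := ENNReal.lintegral_mul_norm_pow_le (hf.pow_const p.toReal) (hg.pow_const q.toReal)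
    (inv_nonneg.mpr h2.le) (inv_nonneg.mpr h3.le) h1
  refine le_trans (le_of_eq (lintegral_congr fun x => ?_)) h4
  rw [← ENNReal.rpow_mul, ← ENNReal.rpow_mul, mul_inv_cancel₀ h2.ne', mul_inv_cancel₀ h3.ne',
    ENNReal.rpow_one, ENNReal.rpow_one]

/-- Minkowski's inequality for countable sums. -/
theorem eLpNorm_tsum_le {ι : Type*} [Countable ι] {f : ι → α → ℝ≥0∞} (hf : ∀ i, Measurable (f i))
    (hq : 1 ≤ q) : eLpNorm (fun x => ∑' i, f i x) q μ ≤ ∑' i, eLpNorm (f i) q μ := by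
  have hq0 : q ≠ 0 := (zero_lt_one.trans_le hq).ne'
  by_cases hqt : q = ∞
  · subst hqt
    simp only [eLpNorm_ennreal_top]
    refine essSup_le_of_ae_le _ ?_
    filter_upwards [ae_all_iff.mpr fun i => ENNReal.ae_le_essSup (μ := μ) (f i)] with x hx
      using ENNReal.tsum_le_tsum hx
  have h0 := ENNReal.toReal_pos hq0 hqt
  have h1 : ∀ F : Finset ι, ∫⁻ x, (∑ i ∈ F, f i x) ^ q.toReal ∂μ ≤
      (∑' i, eLpNorm (f i) q μ) ^ q.toReal := by
    intro F
    have h2 := (eLpNorm_sum_le (μ := μ) (s := F) (fun i _ => (hf i).aestronglyMeasurable) hq).trans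
      (ENNReal.sum_le_tsum F)
    rw [eLpNorm_ennreal_eq hq0 hqt, one_div] at h2
    simpa using (ENNReal.rpow_inv_le_iff h0).mp h2
  rw [eLpNorm_ennreal_eq hq0 hqt, one_div, ENNReal.rpow_inv_le_iff h0]
  -- The power is an order isomorphism of `[0,∞]`, so it commutes with the supremum over finite
  -- sums, and monotone convergence applies.
  have h3 : ∀ x, (∑' i, f i x) ^ q.toReal = ⨆ F : Finset ι, (∑ i ∈ F, f i x) ^ q.toReal := by
    intro x
    rw [ENNReal.tsum_eq_iSup_sum]
    exact (ENNReal.orderIsoRpow _ h0).map_iSup _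
  simp only [h3]
  rw [lintegral_iSup_directed (fun F => by fun_prop)]
  · exact iSup_le h1
  · refine Monotone.directed_le fun F G hFG x => ?_
    exact ENNReal.rpow_le_rpow (Finset.sum_le_sum_of_subset hFG) h0.le

/-- Young's convolution inequality with an integrable kernel. -/
theorem eLpNorm_lintegral_kernel_le {n : ℕ} {G κ : Space n → ℝ≥0∞} (hG : Measurable G)
    (hκ : Measurable κ) (hp : 1 ≤ p) :
    eLpNorm (fun x => ∫⁻ y, G y * κ (y - x)) p volume ≤ (∫⁻ y, κ y) * eLpNorm G p volume := by
  have hp0 : p ≠ 0 := (zero_lt_one.trans_le hp).ne'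
  have hA : ∀ x, ∫⁻ y, κ (y - x) = ∫⁻ y, κ y := fun x => lintegral_sub_right_eq_self κ x
  by_cases hpt : p = ∞
  · subst hpt
    simp only [eLpNorm_ennreal_top]
    refine essSup_le_of_ae_le _ (Eventually.of_forall fun x => ?_)
    have h1 : ∫⁻ y, G y * κ (y - x) ≤ ∫⁻ y, essSup G volume * κ (y - x) := by
      refine lintegral_mono_ae ?_
      filter_upwards [ENNReal.ae_le_essSup G] with y hy using by gcongr
    refine h1.trans ?_
    rw [lintegral_const_mul _ (by fun_prop), hA, mul_comm]
  have h0 := ENNReal.toReal_pos hp0 hpt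
  set r := p.toReal
  have hr1 : 1 ≤ r := by
    rw [← ENNReal.toReal_one]
    exact ENNReal.toReal_mono hpt hp
  have hr2 : r⁻¹ ≤ 1 := inv_le_one_of_one_le₀ hr1
  set A := ∫⁻ y, κ y
  -- Hölder with respect to the measure `κ(y - x) dy`, of mass `A`; Tonelli then integrates out `x`.
  have key : ∀ x, (∫⁻ y, G y * κ (y - x)) ^ r ≤
      (∫⁻ y, G y ^ r * κ (y - x)) * A ^ (r - 1) := by
    intro x
    have h2 := ENNReal.lintegral_mul_norm_pow_le (μ := volume)
      (f := fun y => G y ^ r * κ (y - x)) (g := fun y => κ (y - x))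
      (by fun_prop) (by fun_prop) (inv_nonneg.mpr h0.le) (sub_nonneg.mpr hr2)
      (add_sub_cancel _ _)
    have h3 : ∀ y, (G y ^ r * κ (y - x)) ^ r⁻¹ * κ (y - x) ^ (1 - r⁻¹) = G y * κ (y - x) := by
      intro y
      rw [ENNReal.mul_rpow_of_nonneg _ _ (inv_nonneg.mpr h0.le), ENNReal.rpow_rpow_inv h0.ne',
        mul_assoc, ← ENNReal.rpow_add_of_nonneg _ _ (inv_nonneg.mpr h0.le) (sub_nonneg.mpr hr2)]
      simp
    simp only [h3, hA] at h2
    refine (ENNReal.rpow_le_rpow h2 h0.le).trans ?_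
    rw [ENNReal.mul_rpow_of_nonneg _ _ h0.le, ENNReal.rpow_inv_rpow h0.ne', ← ENNReal.rpow_mul,
      sub_mul, inv_mul_cancel₀ h0.ne', one_mul]
  rw [eLpNorm_ennreal_eq hp0 hpt, eLpNorm_ennreal_eq hp0 hpt, one_div, ENNReal.rpow_inv_le_iff h0,
    ENNReal.mul_rpow_of_nonneg _ _ h0.le, ENNReal.rpow_inv_rpow h0.ne']
  refine (lintegral_mono key).trans ?_
  rw [lintegral_mul_const _ (by fun_prop), lintegral_lintegral_swap (by fun_prop)]
  have hA' : ∀ y, ∫⁻ x, G y ^ r * κ (y - x) = G y ^ r * A := by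
    intro y
    rw [lintegral_const_mul _ (by fun_prop), lintegral_sub_left_eq_self κ y]
  simp only [hA']
  rw [lintegral_mul_const _ (by fun_prop), mul_assoc, mul_comm]
  gcongr
  nth_rewrite 1 [← ENNReal.rpow_one A]
  rw [← ENNReal.rpow_add_of_nonneg _ _ zero_le_one (by linarith), add_sub_cancel]

end LpInequalities

/-! ### Sequence norms on `ℤⁿ` and the discrete bilinear estimate -/

section SequenceNorm

variable {n : ℕ} {p q q' : ℝ≥0∞}

/-- The `ℓ^q`-norm on `ℤⁿ`. -/
noncomputable def seqNorm (q : ℝ≥0∞) (a : (Fin n → ℤ) → ℝ≥0∞) : ℝ≥0∞ :=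
  eLpNorm a q Measure.count

lemma gmNorm_eq_seqNorm {s : ℝ} {ρ : Space n → ℝ} (hq : q ≠ 0) (T : GelfandShilovDual n s) :
    gmNorm ρ p q T = seqNorm q (blockNorm ρ p T) := by
  unfold gmNorm seqNorm
  split_ifs with h
  · subst h
    simp [eLpNormEssSup_count]
  · rw [eLpNorm_ennreal_eq hq h, lintegral_count]

lemma seqNorm_mono {a b : (Fin n → ℤ) → ℝ≥0∞} (h : ∀ k, a k ≤ b k) : seqNorm q a ≤ seqNorm q b :=
  eLpNorm_mono_enorm h

lemma seqNorm_const_mul (hq : q ≠ 0) (c : ℝ≥0∞) (a : (Fin n → ℤ) → ℝ≥0∞) :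
    seqNorm q (fun k => c * a k) = c * seqNorm q a :=
  eLpNorm_ennreal_const_mul c (measurable_of_countable a) hq

lemma seqNorm_tsum_le {ι : Type*} [Countable ι] (hq : 1 ≤ q) (f : ι → (Fin n → ℤ) → ℝ≥0∞) :
    seqNorm q (fun k => ∑' i, f i k) ≤ ∑' i, seqNorm q (f i) :=
  eLpNorm_tsum_le (fun i => measurable_of_countable (f i)) hq

lemma seqNorm_add_le (hq : 1 ≤ q) (a b : (Fin n → ℤ) → ℝ≥0∞) :
    seqNorm q (fun k => a k + b k) ≤ seqNorm q a + seqNorm q b :=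
  eLpNorm_add_le (measurable_of_countable a).aestronglyMeasurable
    (measurable_of_countable b).aestronglyMeasurable hq

lemma tsum_mul_le_seqNorm (h : q⁻¹ + q'⁻¹ = 1) (a b : (Fin n → ℤ) → ℝ≥0∞) :
    ∑' k, a k * b k ≤ seqNorm q a * seqNorm q' b := by
  rw [← lintegral_count]
  exact lintegral_mul_le_eLpNorm_mul (measurable_of_countable a).aemeasurable
    (measurable_of_countable b).aemeasurable h

lemma seqNorm_comp_equiv (hq : q ≠ 0) (e : (Fin n → ℤ) ≃ (Fin n → ℤ)) (a : (Fin n → ℤ) → ℝ≥0∞) :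
    seqNorm q (fun k => a (e k)) = seqNorm q a := by
  unfold seqNorm
  by_cases h : q = ∞
  · subst h
    simp only [eLpNorm_exponent_top, eLpNormEssSup_count]
    exact e.iSup_comp (g := fun k => ‖a k‖ₑ)
  · rw [eLpNorm_ennreal_eq hq h, eLpNorm_ennreal_eq hq h, lintegral_count, lintegral_count]
    congr 1
    exact e.tsum_eq fun k => a k ^ q.toReal

/-- `ℓ¹ * ℓ^q ⊆ ℓ^q`. -/
lemma seqNorm_conv_le (hq : 1 ≤ q) (c b : (Fin n → ℤ) → ℝ≥0∞) (j : Fin n → ℤ) :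
    seqNorm q (fun k => ∑' l, c l * b (k - l + j)) ≤ (∑' l, c l) * seqNorm q b := by
  have hq0 : q ≠ 0 := (zero_lt_one.trans_le hq).ne'
  refine (seqNorm_tsum_le hq fun l k => c l * b (k - l + j)).trans ?_
  rw [← ENNReal.tsum_mul_right]
  refine ENNReal.tsum_le_tsum fun l => le_of_eq ?_
  rw [seqNorm_const_mul hq0 (c l) fun k => b (k - l + j)]
  congr 1
  exact seqNorm_comp_equiv hq0 ((Equiv.subRight l).trans (Equiv.addRight j)) b

/-- The bilinear estimate behind the algebra property. -/
theorem seqNorm_bilinear_le (hq : 1 ≤ q) (h : q⁻¹ + q'⁻¹ = 1) (J : Finset (Fin n → ℤ))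
    (a b w : (Fin n → ℤ) → ℝ≥0∞) :
    seqNorm q (fun k => ∑ j ∈ J, ∑' l, a l * b (k - l + j) * (w l + w (k - l + j))) ≤
      2 * J.card * seqNorm q' w * (seqNorm q a * seqNorm q b) := by
  have h1 : ∀ j ∈ J, seqNorm q (fun k => ∑' l, a l * b (k - l + j) * (w l + w (k - l + j))) ≤
      2 * seqNorm q' w * (seqNorm q a * seqNorm q b) := by
    intro j _
    -- The involution `l ↦ k + j - l` exchanges the two indices, so both halves become convolutions
    -- whose `ℓ¹` factor carries `w`.
    have h2 : ∀ k, ∑' l, a l * b (k - l + j) * (w l + w (k - l + j)) =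
        ∑' l, (a l * w l) * b (k - l + j) + ∑' l, (b l * w l) * a (k - l + j) := by
      intro k
      have h3 := (Equiv.subLeft (k + j)).tsum_eq fun l => (b l * w l) * a (k - l + j)
      rw [← h3, ← ENNReal.tsum_add]
      refine tsum_congr fun l => ?_
      have e1 : (Equiv.subLeft (k + j)) l = k - l + j := by
        simp only [Equiv.subLeft_apply]; abel
      rw [e1, show k - (k - l + j) + j = l by abel]
      ring
    simp only [h2]
    refine (seqNorm_add_le hq _ _).trans ?_
    have h4 := (seqNorm_conv_le hq (fun l => a l * w l) b j).trans
      (mul_le_mul_left (tsum_mul_le_seqNorm h a w) (seqNorm q b))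
    have h5 := (seqNorm_conv_le hq (fun l => b l * w l) a j).trans
      (mul_le_mul_left (tsum_mul_le_seqNorm h b w) (seqNorm q a))
    refine (add_le_add h4 h5).trans (le_of_eq ?_)
    ring
  have h6 : seqNorm q (fun k => ∑ j ∈ J, ∑' l, a l * b (k - l + j) * (w l + w (k - l + j))) ≤
      ∑ j ∈ J, seqNorm q (fun k => ∑' l, a l * b (k - l + j) * (w l + w (k - l + j))) := by
    refine le_of_eq_of_le ?_ (eLpNorm_sum_le (μ := Measure.count) (s := J) (f := fun j k =>
      ∑' l, a l * b (k - l + j) * (w l + w (k - l + j)))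
      (fun j _ => (measurable_of_countable _).aestronglyMeasurable) hq)
    unfold seqNorm
    congr 1
    ext k
    simp
  refine h6.trans ((Finset.sum_le_sum h1).trans (le_of_eq ?_))
  rw [Finset.sum_const, nsmul_eq_mul]
  ring

end SequenceNorm

/-! ### The radial integral in `D(R)` and its decay -/

section RadialIntegral

variable {n : ℕ} {s a R : ℝ}

lemma integrableOn_rpow_mul_exp_neg (hn : 1 ≤ n) (hs : 0 < s) :
    IntegrableOn (fun y : ℝ => y ^ (s * n - 1) * Real.exp (-y)) (Ioi 0) := by
  have h0 : 0 < s * n := mul_pos hs (by exact_mod_cast hn)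
  have := integrableOn_rpow_mul_exp_neg_mul_rpow (p := 1) (s := s * n - 1) (b := 1) (by linarith)
    one_pos one_pos
  simpa using this

/-- The tails of the radial integral, computed in polar coordinates. -/
lemma setIntegral_exp_neg_norm_rpow (hn : 1 ≤ n) (hs : 0 < s) (ha : 0 < a) (hR : 0 ≤ R) :
    ∫ y in {y : Space n | R < ‖y‖}, Real.exp (-(a * ‖y‖ ^ (1 / s))) =
      s * omegaN n * a ^ (-(s * n)) *
        ∫ y in Ioi (a * R ^ (1 / s)), y ^ (s * n - 1) * Real.exp (-y) := by
  have : Nonempty (Fin n) := ⟨⟨0, hn⟩⟩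
  have hmeas : MeasurableSet {y : Space n | R < ‖y‖} :=
    measurableSet_lt measurable_const measurable_norm
  have e1 : ∫ y in {y : Space n | R < ‖y‖}, Real.exp (-(a * ‖y‖ ^ (1 / s))) =
      ∫ y : Space n, (Ioi R).indicator (fun t => Real.exp (-(a * t ^ (1 / s)))) ‖y‖ := by
    rw [← integral_indicator hmeas]
    rfl
  rw [e1, integral_fun_norm_addHaar]
  have e2 : ∫ y in Ioi (0 : ℝ), y ^ (Module.finrank ℝ (Space n) - 1) •
      (Ioi R).indicator (fun t => Real.exp (-(a * t ^ (1 / s)))) y =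
      ∫ y in Ioi R, y ^ (n - 1) * Real.exp (-(a * y ^ (1 / s))) := by
    rw [← integral_indicator measurableSet_Ioi, ← integral_indicator measurableSet_Ioi]
    congr 1
    ext y
    by_cases hy : R < y
    · simp [indicator, hy, hR.trans_lt hy]
    · simp [indicator, hy]
  -- Substitute the `s`-th power of a new variable for `y`, then scale by `a`.
  have e3 : ∫ y in Ioi R, y ^ (n - 1) * Real.exp (-(a * y ^ (1 / s))) =
      s * (a ^ (-(s * n)) * ∫ y in Ioi (a * R ^ (1 / s)), y ^ (s * n - 1) * Real.exp (-y)) := by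
    rw [← integral_comp_rpow_Ioi_of_pos' hs hR, one_div]
    have e4 := integral_comp_mul_left_Ioi (fun y : ℝ => y ^ (s * n - 1) * Real.exp (-y))
      (R ^ s⁻¹) ha
    have e5 : ∫ y in Ioi (a * R ^ s⁻¹), y ^ (s * n - 1) * Real.exp (-y) =
        a * ∫ x in Ioi (R ^ s⁻¹), (a * x) ^ (s * n - 1) * Real.exp (-(a * x)) := by
      rw [e4, smul_eq_mul, mul_inv_cancel_left₀ ha.ne']
    rw [e5, ← mul_assoc, ← mul_assoc, ← integral_const_mul]
    refine setIntegral_congr_fun measurableSet_Ioi fun x hx => ?_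
    have hx0 : 0 < x := (Real.rpow_nonneg hR _).trans_lt hx
    simp only [smul_eq_mul]
    rw [← Real.rpow_mul hx0.le, mul_inv_cancel₀ hs.ne', Real.rpow_one,
      Real.mul_rpow ha.le hx0.le, ← Real.rpow_natCast (x ^ s), ← Real.rpow_mul hx0.le,
      Nat.cast_sub hn, Nat.cast_one]
    have e6 : x ^ (s * n - 1) = x ^ (s - 1) * x ^ (s * ((n : ℝ) - 1)) := by
      rw [← Real.rpow_add hx0]
      ring_nf
    have e7 : a ^ (-(s * n)) * a * a ^ (s * n - 1) = 1 := by
      nth_rewrite 2 [← Real.rpow_one a]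
      rw [← Real.rpow_add ha, ← Real.rpow_add ha]
      ring_nf
      exact Real.rpow_zero a
    calc s * x ^ (s - 1) * (x ^ (s * ((n : ℝ) - 1)) * Real.exp (-(a * x)))
        = s * (a ^ (-(s * n)) * a * a ^ (s * n - 1)) *
          (x ^ (s - 1) * x ^ (s * ((n : ℝ) - 1)) * Real.exp (-(a * x))) := by rw [e7]; ring
      _ = _ := by rw [← e6]; ring
  rw [e2, e3, omegaN, Measure.toSphere_real_apply_univ]
  simp only [nsmul_eq_mul, smul_eq_mul]
  ring

lemma integrable_exp_neg_norm_rpow (hn : 1 ≤ n) (hs : 0 < s) (ha : 0 < a) :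
    Integrable fun y : Space n => Real.exp (-(a * ‖y‖ ^ (1 / s))) := by
  have : Nonempty (Fin n) := ⟨⟨0, hn⟩⟩
  rw [integrable_fun_norm_addHaar volume (f := fun t => Real.exp (-(a * t ^ (1 / s))))]
  have h1 := integrableOn_rpow_mul_exp_neg_mul_rpow (p := 1 / s) (s := ((n - 1 : ℕ) : ℝ)) (b := a)
    (by have : (0 : ℝ) ≤ ((n - 1 : ℕ) : ℝ) := by positivity
        linarith) (by positivity) ha
  simpa using h1

lemma tendsto_algebraConst (hn : 1 ≤ n) (hs : 0 < s) (C₀ : ℝ) {δ : ℝ} (hδ : 0 < δ) {q' : ℝ≥0∞}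
    (hq' : q' ≠ 0) : Tendsto (fun R : ℝ => algebraConst n C₀ s δ q' R) atTop (𝓝 0) := by
  have hpow : ∀ b : ℝ, 0 < b → Tendsto (fun R : ℝ => b * R ^ (1 / s)) atTop atTop := fun b hb =>
    (tendsto_rpow_atTop (by positivity)).const_mul_atTop hb
  unfold algebraConst
  split_ifs with h
  · have := (Real.tendsto_exp_neg_atTop_nhds_zero.comp (hpow δ hδ)).const_mul C₀
    simpa using this
  · have hr := ENNReal.toReal_pos hq' h
    have hT : Tendsto (fun t : ℝ => ∫ y in Ioi t, y ^ (s * n - 1) * Real.exp (-y)) atTop (𝓝 0) := by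
      have hI := (integrable_indicator_iff measurableSet_Ioi).mpr
        (integrableOn_rpow_mul_exp_neg (n := n) hn hs)
      -- Truncating at `max t 0` keeps all integrands below the one on `(0,∞)`, also for the
      -- irrelevant negative `t`.
      have h1 := tendsto_integral_filter_of_dominated_convergence (μ := volume) (l := atTop)
        (F := fun (t : ℝ) y => (Ioi (max t 0)).indicator
          (fun y : ℝ => y ^ (s * n - 1) * Real.exp (-y)) y) (f := fun _ => (0 : ℝ))
        (fun y => ‖(Ioi (0 : ℝ)).indicator (fun y : ℝ => y ^ (s * n - 1) * Real.exp (-y)) y‖)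
        (Eventually.of_forall fun t => by
          refine (((integrableOn_rpow_mul_exp_neg (n := n) hn hs).mono_set
            (Ioi_subset_Ioi (le_max_right t 0))).integrable_indicator
            measurableSet_Ioi).aestronglyMeasurable)
        (Eventually.of_forall fun t => Eventually.of_forall fun y => by
          by_cases hy : max t 0 < y
          · have hy' : 0 < y := (le_max_right t 0).trans_lt hy
            rw [indicator_of_mem (mem_Ioi.mpr hy), indicator_of_mem (mem_Ioi.mpr hy')]
          · rw [indicator_of_notMem (by simpa using hy), norm_zero]
            positivity)
        hI.norm
        (Eventually.of_forall fun y => by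
          refine tendsto_const_nhds.congr' ?_
          filter_upwards [eventually_ge_atTop y] with t ht
          rw [indicator_of_notMem (by simp [ht])])
      rw [integral_zero] at h1
      refine h1.congr' ?_
      filter_upwards [eventually_ge_atTop 0] with t ht
      rw [integral_indicator measurableSet_Ioi, max_eq_left ht]
    have h2 := ((hT.comp (hpow (δ * q'.toReal) (by positivity))).const_mul
      (s * omegaN n * (δ * q'.toReal) ^ (-(s * n)))).rpow_const (p := 1 / q'.toReal)
      (Or.inr (by positivity))
    have h3 := h2.const_mul C₀
    simp only [mul_zero] at h3
    rw [Real.zero_rpow (by positivity), mul_zero] at h3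
    exact h3

end RadialIntegral

/-! ### The weight summed over lattice points near `P_R(ε)` -/

section LatticeSum

variable {n : ℕ} {s δ R : ℝ} {ε : Fin n → Fin 2}

/-- The lattice points `m` whose cube `m + [-1,1]ⁿ` meets `P_R(ε)`. -/
def nearPiece (ε : Fin n → Fin 2) (R : ℝ) : Set (Fin n → ℤ) :=
  {m | ∃ ξ ∈ orthantP ε R, ∀ i, |ξ i - m i| ≤ 1}

/-- The signs of the coordinates in the orthant `ε`. -/
def orthantSign (ε : Fin n → Fin 2) (i : Fin n) : ℤ := (-1) ^ (ε i : ℕ)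

lemma orthantSign_eq (ε : Fin n → Fin 2) (i : Fin n) : orthantSign ε i = 1 ∨ orthantSign ε i = -1 :=
  neg_one_pow_eq_or ℤ _

lemma mem_orthantP_iff {ξ : Space n} :
    ξ ∈ orthantP ε R ↔ (∀ i, 0 < orthantSign ε i * ξ i) ∧ ∃ i, R < |ξ i| := by
  have h1 : ∀ i, Real.sign (ξ i) = (-1) ^ (ε i : ℕ) ↔ 0 < orthantSign ε i * ξ i := by
    intro i
    have h2 : ((-1 : ℝ)) ^ (ε i : ℕ) = orthantSign ε i := by simp [orthantSign]
    rw [h2]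
    rcases orthantSign_eq ε i with h | h <;> rw [h] <;>
      rcases lt_trichotomy (ξ i) 0 with h3 | h3 | h3
    · rw [Real.sign_of_neg h3]; norm_num; linarith
    · rw [h3, Real.sign_zero]; norm_num
    · rw [Real.sign_of_pos h3]; norm_num; linarith
    · rw [Real.sign_of_neg h3]; norm_num; linarith
    · rw [h3, Real.sign_zero]; norm_num
    · rw [Real.sign_of_pos h3]; norm_num; linarith
  simp only [orthantP, cubeP, Set.mem_sdiff, mem_ofPred_eq, h1, not_forall, not_le]

/-- Cubes near `P_R(ε)` can be shifted off the cube `[-R,R]ⁿ`. -/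
lemma nearPiece_shift {m : Fin n → ℤ} (hm : m ∈ nearPiece ε R) {y : Space n}
    (hy : ∀ i, ⌊y i⌋ = m i + 2 * orthantSign ε i) :
    R < ‖y‖ ∧ ‖y‖ ≤ ‖(latticePt m : Space n)‖ + 3 * n := by
  obtain ⟨ξ, hξ, h1⟩ := hm
  obtain ⟨h2, j, hj⟩ := mem_orthantP_iff.mp hξ
  -- The cube of `m` contains a point of the piece, and some coordinate of that point exceeds `R` in
  -- modulus. For a negative sign the half-open cube reaches up to `m j - 2 + 1 ≤ ξ j`, so the shift
  -- has to be `2` and not `1`.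
  have hb : ∀ i, (m i : ℝ) + 2 * orthantSign ε i ≤ y i ∧ y i < m i + 2 * orthantSign ε i + 1 := by
    intro i
    obtain ⟨h3, h4⟩ := Int.floor_eq_iff.mp (hy i)
    push_cast at h3 h4
    exact ⟨h3, h4⟩
  constructor
  · refine lt_of_lt_of_le ?_ (abs_apply_le_norm y j)
    obtain ⟨h3, h4⟩ := hb j
    have h5 := abs_le.mp (h1 j)
    have h6 := h2 j
    rcases orthantSign_eq ε j with h | h <;> rw [h] at h3 h4 h6 <;> norm_num at h3 h4 h6
    · rw [abs_of_pos h6] at hj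
      rw [lt_abs]
      left
      linarith
    · rw [abs_of_neg h6] at hj
      rw [lt_abs]
      right
      linarith
  · have h3 : ‖y - latticePt m‖ ≤ n * 3 := by
      refine norm_le_of_abs_le (by norm_num) fun i => ?_
      obtain ⟨h3, h4⟩ := hb i
      rw [PiLp.sub_apply, latticePt_apply, abs_le]
      rcases orthantSign_eq ε i with h | h <;> rw [h] at h3 h4 <;> norm_num at h3 h4 <;>
        constructor <;> linarith
    have h4 := norm_add_le (y - latticePt m) (latticePt m)
    rw [sub_add_cancel] at h4
    linarith

/-- Subadditivity of `t ↦ t^θ`: moving the argument by `t ≥ 1` changes its power by at most `t^θ ≤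
t`. -/
lemma exp_weight_le {θ x y t b : ℝ} (hθ0 : 0 ≤ θ) (hθ : θ ≤ 1) (hx : 0 ≤ x) (hy : 0 ≤ y) (ht : 1 ≤ t)
    (hb : 0 ≤ b) (h : y ≤ x + t) :
    Real.exp (-(b * x ^ θ)) ≤ Real.exp (b * t) * Real.exp (-(b * y ^ θ)) := by
  rw [← Real.exp_add, Real.exp_le_exp]
  have h1 : y ^ θ ≤ x ^ θ + t :=
    calc y ^ θ ≤ (x + t) ^ θ := Real.rpow_le_rpow hy h hθ0
      _ ≤ x ^ θ + t ^ θ := Real.rpow_add_le_add_rpow hx (by linarith) hθ0 hθ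
      _ ≤ x ^ θ + t := by
        gcongr
        exact (Real.rpow_le_rpow_of_exponent_le ht hθ).trans_eq (Real.rpow_one t)
  nlinarith

/-- The half-open unit cube with corner `k`. -/
def floorCube (k : Fin n → ℤ) : Set (Space n) := {y | ∀ i, ⌊y i⌋ = k i}

lemma measurableSet_floorCube (k : Fin n → ℤ) : MeasurableSet (floorCube k) := by
  have : floorCube k = ⋂ i, {y : Space n | ⌊y i⌋ = k i} := by
    ext y
    simp [floorCube]
  rw [this]
  refine MeasurableSet.iInter fun i => ?_
  have h : Measurable fun y : Space n => ⌊y i⌋ := Int.measurable_floor.comp (by fun_prop)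
  exact h (measurableSet_singleton (k i))

lemma volume_floorCube (k : Fin n → ℤ) : volume (floorCube k : Set (Space n)) = 1 := by
  have h1 := (PiLp.volume_preserving_toLp (Fin n)).measure_preimage
    (measurableSet_floorCube k).nullMeasurableSet
  rw [← h1]
  have h2 : (WithLp.toLp 2 : (Fin n → ℝ) → Space n) ⁻¹' floorCube k =
      Set.pi univ fun i => Ico (k i : ℝ) (k i + 1) := by
    ext y
    simp [floorCube, Int.floor_eq_iff]
  rw [h2, Real.volume_pi_Ico]
  simp

open Classical in
/-- The weight `e^(-δ|m|^(1/s))` on the lattice points near `P_R(ε)`. -/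
noncomputable def pieceWeight (s δ : ℝ) (ε : Fin n → Fin 2) (R : ℝ) (m : Fin n → ℤ) : ℝ≥0∞ :=
  if m ∈ nearPiece ε R then
    ENNReal.ofReal (Real.exp (-(δ * ‖(latticePt m : Space n)‖ ^ (1 / s)))) else 0

/-- Translating the index by two units outwards in the orthant is injective, and the resulting unit
cubes are disjoint and lie in `‖y‖ > R`. On each of them the weight is comparable to the integrand,
up to `e^(3nδr)`. -/
lemma tsum_pieceWeight_le (hn : 1 ≤ n) (hs : 1 ≤ s) (hδ : 0 < δ) {r : ℝ} (hr : 0 < r) (hR : 0 ≤ R) :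
    ∑' m, pieceWeight s δ ε R m ^ r ≤ ENNReal.ofReal (Real.exp (δ * r * (3 * n)) *
      (s * omegaN n * (δ * r) ^ (-(s * n)) *
        ∫ y in Ioi (δ * r * R ^ (1 / s)), y ^ (s * n - 1) * Real.exp (-y))) := by
  have hn' : (1 : ℝ) ≤ n := by exact_mod_cast hn
  have hs0 : 0 < s := by linarith
  have hθ : 1 / s ≤ 1 := (div_le_one hs0).mpr hs
  set F : Space n → ℝ≥0∞ := fun y => {y : Space n | R < ‖y‖}.indicator
    (fun y => ENNReal.ofReal (Real.exp (-(δ * r * ‖y‖ ^ (1 / s))))) y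
  set A := ENNReal.ofReal (Real.exp (δ * r * (3 * n)))
  let e : (Fin n → ℤ) ≃ (Fin n → ℤ) := Equiv.addRight fun i => 2 * orthantSign ε i
  have hmeas : MeasurableSet {y : Space n | R < ‖y‖} :=
    measurableSet_lt measurable_const measurable_norm
  have h1 : ∀ m, pieceWeight s δ ε R m ^ r ≤ A * ∫⁻ y in floorCube (e m), F y := by
    intro m
    unfold pieceWeight
    split_ifs with hm
    · rw [← lintegral_const_mul _ (by
        refine Measurable.indicator ?_ hmeas
        fun_prop)]
      rw [ENNReal.ofReal_rpow_of_pos (Real.exp_pos _), ← Real.exp_mul]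
      calc ENNReal.ofReal (Real.exp (-(δ * ‖(latticePt m : Space n)‖ ^ (1 / s)) * r))
          = ∫⁻ y in floorCube (e m),
            ENNReal.ofReal (Real.exp (-(δ * ‖(latticePt m : Space n)‖ ^ (1 / s)) * r)) := by
            rw [setLIntegral_const, volume_floorCube, mul_one]
        _ ≤ _ := by
            refine setLIntegral_mono' (measurableSet_floorCube _) fun y hy => ?_
            obtain ⟨h2, h3⟩ := nearPiece_shift hm hy
            simp only [F, A]
            rw [indicator_of_mem (by exact h2), ← ENNReal.ofReal_mul (Real.exp_pos _).le]
            refine ENNReal.ofReal_le_ofReal ?_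
            have := exp_weight_le (b := δ * r) (t := 3 * n) (by positivity) hθ (norm_nonneg _)
              (norm_nonneg y) (by linarith) (by positivity) h3
            refine le_of_eq_of_le ?_ this
            ring_nf
    · rw [ENNReal.zero_rpow_of_pos hr]
      exact zero_le
  have hdisj : Pairwise (Function.onFun Disjoint (floorCube : (Fin n → ℤ) → Set (Space n))) := by
    intro k l hkl
    refine Set.disjoint_left.mpr fun y hk hl => hkl ?_
    ext i
    rw [← hk i, ← hl i]
  have huniv : (⋃ k : Fin n → ℤ, (floorCube k : Set (Space n))) = univ :=
    eq_univ_of_forall fun y => mem_iUnion.mpr ⟨fun i => ⌊y i⌋, fun i => rfl⟩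
  calc ∑' m, pieceWeight s δ ε R m ^ r ≤ ∑' m, A * ∫⁻ y in floorCube (e m), F y :=
        ENNReal.tsum_le_tsum h1
    _ = A * ∑' k, ∫⁻ y in floorCube k, F y := by
        rw [ENNReal.tsum_mul_left, e.tsum_eq fun k => ∫⁻ y in floorCube k, F y]
    _ = A * ∫⁻ y, F y := by
        rw [← lintegral_iUnion measurableSet_floorCube hdisj, huniv, setLIntegral_univ]
    _ = _ := by
        simp only [F]
        rw [lintegral_indicator hmeas, ← ofReal_integral_eq_lintegral_ofReal
          ((integrable_exp_neg_norm_rpow hn hs0 (by positivity)).integrableOn)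
          (Eventually.of_forall fun y => (Real.exp_pos _).le),
          setIntegral_exp_neg_norm_rpow hn hs0 (by positivity) hR,
          ← ENNReal.ofReal_mul (Real.exp_pos _).le]

/-- After the root is taken the loss is `e^(3nδ)`, and `δ ≤ 1` replaces it by a constant depending
only on `n`. -/
theorem seqNorm_pieceWeight_le (hn : 1 ≤ n) (hs : 1 ≤ s) (hδ : 0 < δ) (hδ1 : δ ≤ 1) (hR : 0 ≤ R)
    {q' : ℝ≥0∞} (hq' : q' ≠ 0) :
    seqNorm q' (pieceWeight s δ ε R) ≤
      ENNReal.ofReal (algebraConst n (Real.exp (3 * n)) s δ q' R) := by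
  have hn' : (1 : ℝ) ≤ n := by exact_mod_cast hn
  have hs0 : 0 < s := by linarith
  have hθ : 1 / s ≤ 1 := (div_le_one hs0).mpr hs
  unfold algebraConst
  split_ifs with h
  · subst h
    rw [seqNorm, eLpNorm_exponent_top, eLpNormEssSup_count]
    refine iSup_le fun m => ?_
    rw [enorm_eq_self]
    unfold pieceWeight
    split_ifs with hm
    -- For the supremum, one point of the shifted cube is enough; its corner is taken.
    · obtain ⟨h1, h2⟩ := nearPiece_shift (y := latticePt fun i => m i + 2 * orthantSign ε i) hm
        (fun i => by rw [latticePt_apply, Int.floor_intCast])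
      refine ENNReal.ofReal_le_ofReal ?_
      refine (exp_weight_le (by positivity) hθ (norm_nonneg _) hR (by linarith) hδ.le
        (h1.le.trans h2)).trans (mul_le_mul_of_nonneg_right ?_ (Real.exp_pos _).le)
      rw [Real.exp_le_exp]
      nlinarith
    · exact zero_le
  · have hr := ENNReal.toReal_pos hq' h
    rw [seqNorm, eLpNorm_ennreal_eq hq' h, lintegral_count]
    refine (ENNReal.rpow_le_rpow (tsum_pieceWeight_le hn hs hδ hr hR) (by positivity)).trans ?_
    have hI : 0 ≤ s * omegaN n * (δ * q'.toReal) ^ (-(s * n)) *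
        ∫ y in Ioi (δ * q'.toReal * R ^ (1 / s)), y ^ (s * n - 1) * Real.exp (-y) := by
      rw [← setIntegral_exp_neg_norm_rpow hn hs0 (by positivity) hR]
      exact integral_nonneg fun _ => (Real.exp_pos _).le
    rw [ENNReal.ofReal_rpow_of_nonneg (mul_nonneg (Real.exp_pos _).le hI) (by positivity)]
    refine ENNReal.ofReal_le_ofReal ?_
    rw [Real.mul_rpow (Real.exp_pos _).le hI, ← Real.exp_mul]
    refine mul_le_mul_of_nonneg_right ?_ (by positivity)
    rw [Real.exp_le_exp]
    have : δ * q'.toReal * (3 * n) * (1 / q'.toReal) = δ * (3 * n) := by field_simp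
    rw [this]
    nlinarith

lemma algebraConst_mul (C D δ s R : ℝ) (q' : ℝ≥0∞) :
    algebraConst n (C * D) s δ q' R = C * algebraConst n D s δ q' R := by
  unfold algebraConst
  split_ifs <;> ring

end LatticeSum

/-! ### Frequency blocks and Fourier supports -/

section Blocks

variable {n : ℕ} {s : ℝ} {ρ : Space n → ℝ} {p : ℝ≥0∞}

lemma box_eq_specWin (k : Fin n → ℤ) (T : GelfandShilovDual n s) :
    box ρ k T = specWin T (fun ξ => (sigma ρ k ξ : ℂ)) := by
  ext x
  unfold box specWin
  rw [fourierT_modulate]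
  rfl

lemma pair_add_left (T U : GelfandShilovDual n s) (g : Space n → ℂ) :
    pair (T + U) g = pair T g + pair U g := by
  unfold pair
  split_ifs
  · rfl
  · simp

lemma pair_smul_left (c : ℂ) (T : GelfandShilovDual n s) (g : Space n → ℂ) :
    pair (c • T) g = c * pair T g := by
  unfold pair
  split_ifs
  · rfl
  · simp

lemma pair_zero_left (g : Space n → ℂ) : pair (0 : GelfandShilovDual n s) g = 0 := by
  unfold pair
  split_ifs
  · rfl
  · rfl

lemma box_add (k : Fin n → ℤ) (T U : GelfandShilovDual n s) :
    box ρ k (T + U) = box ρ k T + box ρ k U := by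
  ext x
  simp only [box, pair_add_left, Pi.add_apply]
  ring

lemma box_smul (k : Fin n → ℤ) (c : ℂ) (T : GelfandShilovDual n s) :
    box ρ k (c • T) = c • box ρ k T := by
  ext x
  simp only [box, pair_smul_left, Pi.smul_apply, smul_eq_mul]
  ring

lemma box_zero (k : Fin n → ℤ) : box ρ k (0 : GelfandShilovDual n s) = 0 := by
  ext x
  simp [box, pair_zero_left]

lemma isClosed_fourierSupport (T : GelfandShilovDual n s) : IsClosed (fourierSupport T) := by
  rw [← isOpen_compl_iff, isOpen_iff_forall_mem_open]
  intro ξ hξ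
  simp only [fourierSupport, mem_compl_iff, mem_ofPred_eq, not_forall] at hξ
  obtain ⟨U, hU, hξU, h⟩ := hξ
  exact ⟨U, fun η hη hcon => h (hcon U hU hη), hU, hξU⟩

lemma fourierSupport_add (T U : GelfandShilovDual n s) :
    fourierSupport (T + U) ⊆ fourierSupport T ∪ fourierSupport U := by
  intro ξ hξ
  by_contra hcon
  rw [mem_union, not_or] at hcon
  have hopen := ((isClosed_fourierSupport T).isOpen_compl.inter (isClosed_fourierSupport U).isOpen_compl)
  obtain ⟨h1, h2⟩ := hcon
  simp only [fourierSupport, mem_ofPred_eq, not_forall] at h1 h2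
  obtain ⟨V, hV, hξV, h1⟩ := h1
  obtain ⟨W, hW, hξW, h2⟩ := h2
  obtain ⟨φ, hφ, hc, hs, hne⟩ := hξ (V ∩ W) (hV.inter hW) ⟨hξV, hξW⟩
  refine hne ?_
  push Not at h1 h2
  rw [pair_add_left, h1 φ hφ hc (hs.trans inter_subset_left), h2 φ hφ hc (hs.trans inter_subset_right),
    add_zero]

lemma fourierSupport_smul (c : ℂ) (T : GelfandShilovDual n s) :
    fourierSupport (c • T) ⊆ fourierSupport T := by
  intro ξ hξ U hU hξU
  obtain ⟨φ, hφ, hc, hs, hne⟩ := hξ U hU hξU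
  rw [pair_smul_left] at hne
  exact ⟨φ, hφ, hc, hs, right_ne_zero_of_mul hne⟩

lemma fourierSupport_zero : fourierSupport (0 : GelfandShilovDual n s) = ∅ := by
  rw [eq_empty_iff_forall_notMem]
  intro ξ hξ
  obtain ⟨φ, -, -, -, hne⟩ := hξ univ isOpen_univ (mem_univ _)
  exact hne (pair_zero_left _)

variable (hs : 1 ≤ s) (hρ : IsDecompositionWindow ρ) (hgs : (fun ξ => (ρ ξ : ℂ)) ∈ GelfandShilov n s)
include hs hρ hgs

lemma continuous_box (k : Fin n → ℤ) (T : GelfandShilovDual n s) : Continuous (box ρ k T) := by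
  rw [box_eq_specWin]
  exact continuous_specWin hs T (hρ.sigma_mem hs hgs k)

/-- `GM^{p,q}_s(ε,R)` is a linear subspace. -/
lemma exists_submodule_eq_GMPiece (hp : 1 ≤ p) {q : ℝ≥0∞} (hq : 1 ≤ q) (ε : Fin n → Fin 2) (R : ℝ) :
    ∃ V : Submodule ℂ (GelfandShilovDual n s),
      (V : Set (GelfandShilovDual n s)) = GMPiece ρ s p q ε R := by
  have hq0 : q ≠ 0 := (zero_lt_one.trans_le hq).ne'
  refine ⟨{ carrier := GMPiece ρ s p q ε R, zero_mem' := ?_, add_mem' := ?_, smul_mem' := ?_ }, rfl⟩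
  · rintro T U ⟨hT, hT'⟩ ⟨hU, hU'⟩
    refine ⟨?_, (fourierSupport_add T U).trans (union_subset hT' hU')⟩
    simp only [GMSpace, mem_ofPred_eq, gmNorm_eq_seqNorm hq0] at hT hU ⊢
    refine lt_of_le_of_lt ((seqNorm_mono fun k => ?_).trans (seqNorm_add_le hq _ _))
      (ENNReal.add_lt_top.mpr ⟨hT, hU⟩)
    unfold blockNorm
    rw [box_add, ← mul_add]
    exact mul_le_mul_right (eLpNorm_add_le (continuous_box hs hρ hgs k T).aestronglyMeasurable
      (continuous_box hs hρ hgs k U).aestronglyMeasurable hp) _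
  · refine ⟨?_, by rw [fourierSupport_zero]; exact empty_subset _⟩
    simp only [GMSpace, mem_ofPred_eq, gmNorm_eq_seqNorm hq0]
    have : blockNorm ρ p (0 : GelfandShilovDual n s) = fun _ => 0 := by
      ext k
      simp [blockNorm, box_zero]
    rw [this, seqNorm]
    simp
  · rintro c T ⟨hT, hT'⟩
    refine ⟨?_, (fourierSupport_smul c T).trans hT'⟩
    simp only [GMSpace, mem_ofPred_eq, gmNorm_eq_seqNorm hq0] at hT ⊢
    have : blockNorm ρ p (c • T) = fun k => ‖c‖ₑ * blockNorm ρ p T k := by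
      ext k
      rw [blockNorm, blockNorm, box_smul, eLpNorm_const_smul]
      ring
    rw [this, seqNorm_const_mul hq0]
    exact ENNReal.mul_lt_top enorm_lt_top hT

omit hs hgs in
lemma hasCompactSupport_sigma (k : Fin n → ℤ) :
    HasCompactSupport fun ξ => (sigma ρ k ξ : ℂ) := by
  refine HasCompactSupport.intro (isCompact_closedBall (latticePt k : Space n) n) fun ξ hξ => ?_
  by_contra hcon
  refine hξ ?_
  rw [Metric.mem_closedBall, dist_eq_norm]
  have := norm_le_of_abs_le (x := ξ - latticePt k) zero_le_one fun i =>
    hρ.sigma_ne_zero (k := k) (by simpa using hcon) i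
  simpa using this

/-- The window `σ_k` is supported in the cube about `k`, away from the Fourier support. Restricting
all sums to cubes near the piece is what makes the constant small for large `R`. -/
lemma box_eq_zero_of_notMem {T : GelfandShilovDual n s} {ε : Fin n → Fin 2} {R : ℝ}
    (hT : fourierSupport T ⊆ orthantP ε R) {k : Fin n → ℤ} (hk : k ∉ nearPiece ε R) :
    box ρ k T = 0 := by
  ext x
  unfold box
  rw [pair_fourierT_eq_zero_of_disjoint hs hρ hgs T
    (GelfandShilov.modulate hs (hρ.sigma_mem hs hgs k) x)
    ((hasCompactSupport_sigma hρ k).mul_right), mul_zero]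
  · rfl
  · rw [Set.disjoint_left]
    intro ξ h1 h2
    exact hk ⟨ξ, hT h2, hρ.tsupport_sigma_subset k (tsupport_mul_subset_left h1)⟩

end Blocks

/-! ### Bernstein's inequality, with constants independent of `k` and `s` -/

section Bernstein

variable {n : ℕ} {s : ℝ} {ρ : Space n → ℝ} {p : ℝ≥0∞}

/-- The sum of the windows next to the origin. -/
noncomputable def fatSigma (ρ : Space n → ℝ) (ξ : Space n) : ℂ := ∑ m ∈ intBox n 2, (sigma ρ m ξ : ℂ)

/-- The constant in the embedding of `Lᵖ` into `L^∞` for a frequency block. -/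
noncomputable def bernsteinConst (ρ : Space n → ℝ) (p : ℝ≥0∞) : ℝ≥0∞ :=
  ENNReal.ofReal (normConst n) * eLpNorm (fourierT (fatSigma ρ)) (1 - p⁻¹)⁻¹ volume

/-- The `L¹`-norm of the convolution kernel of `□₀`. -/
noncomputable def kernelConst (ρ : Space n → ℝ) : ℝ≥0∞ :=
  ENNReal.ofReal (normConst n) * ∫⁻ y, ‖fourierT (fun ξ => (sigma ρ 0 ξ : ℂ)) y‖ₑ

/-- Boundedness and integrability interpolate: `|f|^p ≤ C^(p-1) |f|`. -/
lemma GelfandShilov.eLpNorm_lt_top (hs : 0 ≤ s) {f : Space n → ℂ} (hf : f ∈ GelfandShilov n s)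
    (hp : 1 ≤ p) : eLpNorm f p volume < ∞ := by
  have hint := GelfandShilov.integrable hs hf
  obtain ⟨-, h, C, h0, hb⟩ := hf
  have hC : ∀ x, ‖f x‖ₑ ≤ ENNReal.ofReal C := fun x => by
    rw [← ofReal_norm]
    refine ENNReal.ofReal_le_ofReal ?_
    simpa using hb 0 0 x
  by_cases hpt : p = ∞
  · subst hpt
    rw [eLpNorm_exponent_top]
    exact (essSup_le_of_ae_le _ (Eventually.of_forall hC)).trans_lt ENNReal.ofReal_lt_top
  have hp0 : p ≠ 0 := (zero_lt_one.trans_le hp).ne'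
  have hr1 : 1 ≤ p.toReal := by
    rw [← ENNReal.toReal_one]
    exact ENNReal.toReal_mono hpt hp
  rw [eLpNorm_eq_lintegral_rpow_enorm_toReal hp0 hpt]
  refine ENNReal.rpow_lt_top_of_nonneg (by positivity) (ne_of_lt ?_)
  calc ∫⁻ x, ‖f x‖ₑ ^ p.toReal ≤ ∫⁻ x, ENNReal.ofReal C ^ (p.toReal - 1) * ‖f x‖ₑ := by
        refine lintegral_mono fun x => ?_
        have : ‖f x‖ₑ ^ p.toReal = ‖f x‖ₑ ^ (p.toReal - 1) * ‖f x‖ₑ := by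
          nth_rewrite 3 [← ENNReal.rpow_one ‖f x‖ₑ]
          rw [← ENNReal.rpow_add_of_nonneg _ _ (by linarith) zero_le_one, sub_add_cancel]
        rw [this]
        exact mul_le_mul_left (ENNReal.rpow_le_rpow (hC x) (by linarith)) _
    _ < ∞ := by
        rw [lintegral_const_mul' _ _ (by finiteness)]
        exact ENNReal.mul_lt_top (by finiteness) hint.2

variable (hs : 1 ≤ s) (hρ : IsDecompositionWindow ρ) (hgs : (fun ξ => (ρ ξ : ℂ)) ∈ GelfandShilov n s)
include hs hρ hgs

lemma fatSigma_mem : fatSigma ρ ∈ GelfandShilov n s :=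
  (pair_fourierT_sum hs 0 (intBox n 2) (fun m ξ => (sigma ρ m ξ : ℂ)) (hρ.sigma_mem hs hgs)).1

lemma bernsteinConst_lt_top : bernsteinConst ρ p < ∞ := by
  refine ENNReal.mul_lt_top ENNReal.ofReal_lt_top (GelfandShilov.eLpNorm_lt_top (by linarith)
    (GelfandShilov.fourierT hs (fatSigma_mem hs hρ hgs)) ?_)
  rw [ENNReal.one_le_inv]
  exact tsub_le_self

lemma kernelConst_lt_top : kernelConst ρ < ∞ :=
  ENNReal.mul_lt_top ENNReal.ofReal_lt_top (GelfandShilov.integrable (by linarith)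
    (GelfandShilov.fourierT hs (hρ.sigma_mem hs hgs 0))).2

omit hs hρ hgs in
lemma enorm_fourierT_translate (f : Space n → ℂ) (a ξ : Space n) :
    ‖fourierT (fun x => f (x - a)) ξ‖ₑ = ‖fourierT f ξ‖ₑ := by
  have := fourierT_translate f (-a) ξ
  simp only [← sub_eq_add_neg] at this
  rw [this, enorm_mul, mul_comm Complex.I, ← ofReal_norm, Complex.norm_exp_ofReal_mul_I]
  simp

/-- Bernstein's inequality for frequency blocks. -/
theorem enorm_box_le (hp : 1 ≤ p) (k : Fin n → ℤ) (T : GelfandShilovDual n s) (x : Space n) :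
    ‖box ρ k T x‖ₑ ≤ bernsteinConst ρ p * eLpNorm (box ρ k T) p volume := by
  have hmem : (fun ξ => fatSigma ρ (ξ - latticePt k)) ∈ GelfandShilov n s :=
    GelfandShilov.translate hs (fatSigma_mem hs hρ hgs) _
  have hmul : ∀ ξ, (sigma ρ k ξ : ℂ) * fatSigma ρ (ξ - latticePt k) = sigma ρ k ξ := by
    intro ξ
    refine Eq.trans ?_ (hρ.sigma_sum_neighbours (k := k) (ξ := ξ))
    unfold fatSigma
    congr 1
    refine Finset.sum_congr rfl fun m _ => ?_
    rw [IsDecompositionWindow.sigma_eq_translate (k + m), IsDecompositionWindow.sigma_eq_translate m, latticePt_add, sub_sub]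
  -- The block equals its own convolution with the transform of a translate of `fatSigma`.
  -- Translation only modulates the transform, so the modulus of the kernel is the same for all `k`,
  -- and Hölder with the conjugate exponent applies.
  have h1 := specWin_reproduce hs T (hρ.sigma_mem hs hgs k) hmem hmul x
  rw [← box_eq_specWin] at h1
  have hF : Continuous (fourierT (fatSigma ρ)) :=
    GelfandShilov.continuous (GelfandShilov.fourierT hs (fatSigma_mem hs hρ hgs))
  have hB := continuous_box hs hρ hgs k T
  have h2 : ‖(normConst n : ℂ)‖ₑ = ENNReal.ofReal (normConst n) := by
    rw [← ofReal_norm, Complex.norm_real, Real.norm_of_nonneg (normConst_pos n).le]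
  have hp' : (1 - p⁻¹)⁻¹⁻¹ + p⁻¹ = 1 := by
    rw [inv_inv]
    exact tsub_add_cancel_of_le (ENNReal.inv_le_one.mpr hp)
  rw [h1, enorm_mul, h2, bernsteinConst, mul_assoc]
  refine mul_le_mul_right ((enorm_integral_le_lintegral_enorm _).trans ?_) _
  simp only [enorm_mul, enorm_fourierT_translate]
  refine (lintegral_mul_le_eLpNorm_mul (f := fun y => ‖fourierT (fatSigma ρ) (y - x)‖ₑ)
    (g := fun y => ‖box ρ k T y‖ₑ) ?_ ?_ hp').trans (le_of_eq ?_)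
  · exact (hF.comp (continuous_sub_right x)).enorm.measurable.aemeasurable
  · exact hB.enorm.measurable.aemeasurable
  · rw [eLpNorm_enorm, eLpNorm_enorm]
    congr 1
    exact eLpNorm_comp_measurePreserving (g := fourierT (fatSigma ρ)) hF.aestronglyMeasurable
      (measurePreserving_sub_right volume x)

end Bernstein

/-! ### Elements of `GM^{p,q}_s(ε,R)` as sums of their blocks -/

section Representation

variable {n : ℕ} {s : ℝ} {ρ : Space n → ℝ} {p q q' : ℝ≥0∞}

/-- Bounded measurable functions define elements of `S_s'`. -/
lemma exists_isRepresentedBy (hs : 0 ≤ s) {u : Space n → ℂ} (hu : AEStronglyMeasurable u) {M : ℝ}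
    (hM : ∀ x, ‖u x‖ ≤ M) : ∃ T : GelfandShilovDual n s, IsRepresentedBy T u := by
  have hM0 : 0 ≤ M := (norm_nonneg _).trans (hM 0)
  have hint : ∀ φ : GelfandShilov n s, Integrable fun x => u x * (φ : Space n → ℂ) x := fun φ =>
    (GelfandShilov.integrable hs φ.2).bdd_mul hu (Eventually.of_forall hM)
  let L : GelfandShilov n s →ₗ[ℂ] ℂ :=
    { toFun := fun φ => ∫ x, u x * (φ : Space n → ℂ) x
      map_add' := fun φ ψ => by
        rw [← integral_add (hint φ) (hint ψ)]
        simp [mul_add]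
      map_smul' := fun c φ => by
        simp only [Submodule.coe_smul, Pi.smul_apply, smul_eq_mul, RingHom.id_apply]
        rw [← integral_const_mul]
        congr 1
        ext x
        ring }
  refine ⟨⟨L, fun h h0 => ?_⟩, memLp_top_of_bound hu M (Eventually.of_forall hM), fun φ => rfl⟩
  obtain ⟨K, hK, hd⟩ := GSBound.decay (n := n) hs h0.le (n + 1)
  refine ⟨M * K * ∫ x : Space n, ((1 + ‖x‖) ^ (n + 1))⁻¹, fun φ C hC => ?_⟩
  have h1 : ∀ x, ‖u x * (φ : Space n → ℂ) x‖ ≤ M * K * C * ((1 + ‖x‖) ^ (n + 1))⁻¹ := by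
    intro x
    have h2 := hd φ C hC 0 0 x
    simp only [pow_zero, norm_iteratedFDeriv_zero, one_mul, add_zero, mul_one, Nat.factorial_zero,
      Nat.cast_one, Real.one_rpow] at h2
    have h3 : ‖(φ : Space n → ℂ) x‖ ≤ K * C * ((1 + ‖x‖) ^ (n + 1))⁻¹ := by
      rw [← div_eq_mul_inv, le_div_iff₀ (by positivity)]
      linarith
    rw [norm_mul]
    calc ‖u x‖ * ‖(φ : Space n → ℂ) x‖ ≤ M * (K * C * ((1 + ‖x‖) ^ (n + 1))⁻¹) :=
          mul_le_mul (hM x) h3 (norm_nonneg _) hM0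
      _ = _ := by ring
  have h4 := norm_integral_le_of_norm_le ((integrable_one_add_norm_pow n).const_mul (M * K * C))
    (Eventually.of_forall h1)
  rw [integral_const_mul] at h4
  refine h4.trans (le_of_eq ?_)
  ring

/-- The blocks of `T` are bounded by a summable sequence. -/
def HasSummableBlocks (ρ : Space n → ℝ) (T : GelfandShilovDual n s) : Prop :=
  ∃ M : (Fin n → ℤ) → ℝ, Summable M ∧ ∀ l x, ‖box ρ l T x‖ ≤ M l

/-- The sum of the blocks. -/
noncomputable def blockSum (ρ : Space n → ℝ) (T : GelfandShilovDual n s) (x : Space n) : ℂ :=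
  ∑' l, box ρ l T x

lemma HasSummableBlocks.exists_bound {T : GelfandShilovDual n s} (hT : HasSummableBlocks ρ T) :
    ∃ M : ℝ, ∀ x, ‖blockSum ρ T x‖ ≤ M := by
  obtain ⟨M, hM, hb⟩ := hT
  exact ⟨∑' l, M l, fun x => tsum_of_norm_bounded hM.hasSum fun l => hb l x⟩

variable (hs : 1 ≤ s) (hρ : IsDecompositionWindow ρ) (hgs : (fun ξ => (ρ ξ : ℂ)) ∈ GelfandShilov n s)
include hs hρ hgs

/-- Since `δ ≤ 1`, the weight inside `blockNorm` outweighs `e^(-δ|k|^(1/s))`; away from the piece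
both sides vanish. This prepares Hölder against `pieceWeight`. -/
lemma eLpNorm_box_le {T : GelfandShilovDual n s} {ε : Fin n → Fin 2} {R δ : ℝ} (hδ : δ ≤ 1)
    (hT : fourierSupport T ⊆ orthantP ε R) (k : Fin n → ℤ) :
    eLpNorm (box ρ k T) p volume ≤ blockNorm ρ p T k * pieceWeight s δ ε R k := by
  unfold pieceWeight
  split_ifs with hk
  · rw [blockNorm, mul_right_comm, ← ENNReal.ofReal_mul (Real.exp_pos _).le, ← Real.exp_add]
    refine le_mul_of_one_le_left' ?_
    rw [ENNReal.one_le_ofReal, Real.one_le_exp_iff]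
    have : 0 ≤ ‖(latticePt k : Space n)‖ ^ (1 / s) := by positivity
    nlinarith
  · rw [box_eq_zero_of_notMem hs hρ hgs hT hk]
    simp

/-- Hölder between `ℓ^q` and `ℓ^(q')` sums the `Lᵖ` norms, and Bernstein turns them into sup norms.
-/
lemma hasSummableBlocks (hn : 1 ≤ n) (hp : 1 ≤ p) (hq : 1 ≤ q) (hqq : q⁻¹ + q'⁻¹ = 1)
    {T : GelfandShilovDual n s} {ε : Fin n → Fin 2} {R δ : ℝ} (hR : 0 ≤ R) (hδ0 : 0 < δ) (hδ : δ ≤ 1)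
    (hT : T ∈ GMPiece ρ s p q ε R) : HasSummableBlocks ρ T := by
  have hq' : q' ≠ 0 := by rintro rfl; simp at hqq
  have h1 : ∑' l, bernsteinConst ρ p * eLpNorm (box ρ l T) p volume < ∞ := by
    rw [ENNReal.tsum_mul_left]
    refine ENNReal.mul_lt_top (bernsteinConst_lt_top hs hρ hgs) ?_
    refine (ENNReal.tsum_le_tsum (eLpNorm_box_le hs hρ hgs hδ hT.2)).trans_lt
      ((tsum_mul_le_seqNorm hqq _ _).trans_lt (ENNReal.mul_lt_top ?_ ?_))
    · rw [← gmNorm_eq_seqNorm (zero_lt_one.trans_le hq).ne']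
      exact hT.1
    · exact (seqNorm_pieceWeight_le hn hs hδ0 hδ hR hq').trans_lt ENNReal.ofReal_lt_top
  refine ⟨fun l => (bernsteinConst ρ p * eLpNorm (box ρ l T) p volume).toReal,
    ENNReal.summable_toReal h1.ne, fun l x => ?_⟩
  have h2 : bernsteinConst ρ p * eLpNorm (box ρ l T) p volume ≠ ∞ := ENNReal.ne_top_of_tsum_ne_top h1.ne l
  have h3 := ENNReal.toReal_mono h2 (enorm_box_le hs hρ hgs hp l T x)
  rwa [toReal_enorm] at h3

lemma continuous_blockSum {T : GelfandShilovDual n s} (hT : HasSummableBlocks ρ T) :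
    Continuous (blockSum ρ T) := by
  obtain ⟨M, hM, hb⟩ := hT
  exact continuous_tsum (fun l => continuous_box hs hρ hgs l T) hM hb

/-- A distribution with summable blocks is the sum of its blocks. -/
theorem isRepresentedBy_blockSum {T : GelfandShilovDual n s} (hT : HasSummableBlocks ρ T) :
    IsRepresentedBy T (blockSum ρ T) := by
  obtain ⟨B, hB⟩ := hT.exists_bound
  obtain ⟨U, hU⟩ := exists_isRepresentedBy (s := s) (by linarith)
    (continuous_blockSum hs hρ hgs hT).aestronglyMeasurable hB
  obtain ⟨M, hM, hb⟩ := hT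
  suffices h : T = U by rwa [← h] at hU
  -- Against compactly supported `ψ` the partition of unity is a finite sum, so no convergence of `∑
  -- σ_l ψ` in `S_s` has to be discussed.
  refine eq_of_pair_eq hs hρ hgs T U fun ψ hψ hc => ?_
  have hFψ := GelfandShilov.fourierT hs hψ
  have hi := GelfandShilov.integrable (by linarith) hFψ
  have hterm : ∀ l, Integrable (fun y => fourierT ψ y * box ρ l T y) ∧
      pair T (fourierT fun ξ => (sigma ρ l ξ : ℂ) * ψ ξ) = ∫ y, fourierT ψ y * box ρ l T y := by
    intro l
    rw [box_eq_specWin]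
    exact pair_fourierT_mul' hs T (hρ.sigma_mem hs hgs l) hψ
  have hsum : Summable fun l => ∫ y, ‖fourierT ψ y * box ρ l T y‖ := by
    refine Summable.of_nonneg_of_le (fun l => integral_nonneg fun _ => norm_nonneg _) (fun l => ?_)
      (hM.mul_left (∫ y, ‖fourierT ψ y‖))
    rw [← integral_mul_const]
    refine integral_mono (hterm l).1.norm (hi.norm.mul_const _) fun y => ?_
    simp only [norm_mul]
    exact mul_le_mul_of_nonneg_left (hb l y) (norm_nonneg _)
  have e1 : pair U (fourierT ψ) = ∑' l, pair T (fourierT fun ξ => (sigma ρ l ξ : ℂ) * ψ ξ) := by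
    rw [pair_of_mem hFψ, hU.2]
    simp only [hterm]
    rw [integral_tsum_of_summable_integral_norm (fun l => (hterm l).1) hsum]
    refine integral_congr_ae (Eventually.of_forall fun y => ?_)
    simp only [blockSum]
    rw [tsum_mul_left, mul_comm]
  obtain ⟨r, hr⟩ := hc.isCompact.isBounded.subset_closedBall (0 : Space n)
  obtain ⟨N, hN⟩ := exists_nat_gt r
  have hψN : ∀ ξ, ψ ξ ≠ 0 → ‖ξ‖ < N := by
    intro ξ hξ
    have := hr (subset_tsupport ψ hξ)
    rw [Metric.mem_closedBall, dist_zero_right] at this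
    linarith
  rw [e1, tsum_eq_sum (s := intBox n (N + 1))]
  · rw [← (pair_fourierT_sum hs T (intBox n (N + 1)) (fun l ξ => (sigma ρ l ξ : ℂ) * ψ ξ)
      fun l => GelfandShilov.mul (by linarith) (hρ.sigma_mem hs hgs l) hψ).2]
    congr 2
    ext ξ
    rw [← Finset.sum_mul]
    by_cases h : ψ ξ = 0
    · simp [h]
    · have h2 : ‖ξ‖ < ((N + 1 : ℕ) : ℝ) := by
        push_cast
        linarith [hψN ξ h]
      have h1 := hρ.sum_sigma h2
      have h3 : ∑ l ∈ intBox n (N + 1), (sigma ρ l ξ : ℂ) = 1 := by exact_mod_cast h1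
      rw [h3, one_mul]
  · intro l hl
    have : (fun ξ => (sigma ρ l ξ : ℂ) * ψ ξ) = fun _ => 0 := by
      ext ξ
      by_cases h : ψ ξ = 0
      · simp [h]
      · have h4 : sigma ρ l ξ = 0 := by
          by_contra hcon
          refine hl (mem_intBox.mpr fun i => ?_)
          have h5 := hρ.sigma_ne_zero hcon i
          have h6 := (abs_apply_le_norm ξ i).trans (hψN ξ h).le
          have h7 : |(l i : ℝ)| ≤ N + 1 := by
            have := abs_sub_abs_le_abs_sub (l i : ℝ) (ξ i)
            rw [abs_sub_comm] at this
            linarith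
          exact_mod_cast h7
        simp [h4]
    rw [this]
    have : fourierT (fun _ : Space n => (0 : ℂ)) = 0 := by
      ext ξ
      simp [fourierT]
    rw [this, pair_zero]

/-- Expansion of a product of sums of blocks. -/
lemma integral_blockSum_mul {f g : GelfandShilovDual n s} (hf : HasSummableBlocks ρ f)
    (hg : HasSummableBlocks ρ g) {φ : Space n → ℂ} (hφ : Integrable φ) :
    ∫ x, blockSum ρ f x * blockSum ρ g x * φ x =
      ∑' z : (Fin n → ℤ) × (Fin n → ℤ), ∫ x, box ρ z.1 f x * box ρ z.2 g x * φ x := by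
  obtain ⟨M, hM, hfb⟩ := hf
  obtain ⟨N, hN, hgb⟩ := hg
  have hM0 : ∀ l, 0 ≤ M l := fun l => (norm_nonneg _).trans (hfb l 0)
  have hN0 : ∀ l, 0 ≤ N l := fun l => (norm_nonneg _).trans (hgb l 0)
  have hMN : Summable fun z : (Fin n → ℤ) × (Fin n → ℤ) => M z.1 * N z.2 :=
    hM.mul_of_nonneg hN hM0 hN0
  have hb : ∀ (z : (Fin n → ℤ) × (Fin n → ℤ)) x, ‖box ρ z.1 f x * box ρ z.2 g x‖ ≤ M z.1 * N z.2 := by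
    intro z x
    rw [norm_mul]
    exact mul_le_mul (hfb _ _) (hgb _ _) (norm_nonneg _) (hM0 _)
  have hint : ∀ z : (Fin n → ℤ) × (Fin n → ℤ),
      Integrable fun x => box ρ z.1 f x * box ρ z.2 g x * φ x := fun z =>
    hφ.bdd_mul ((continuous_box hs hρ hgs z.1 f).mul
      (continuous_box hs hρ hgs z.2 g)).aestronglyMeasurable (Eventually.of_forall (hb z))
  rw [integral_tsum_of_summable_integral_norm hint]
  · refine integral_congr_ae (Eventually.of_forall fun x => ?_)
    simp only [blockSum]
    rw [tsum_mul_right, tsum_mul_tsum_of_summable_norm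
      (hM.of_nonneg_of_le (fun _ => norm_nonneg _) fun l => hfb l x)
      (hN.of_nonneg_of_le (fun _ => norm_nonneg _) fun l => hgb l x)]
  · refine Summable.of_nonneg_of_le (fun z => integral_nonneg fun _ => norm_nonneg _) (fun z => ?_)
      (hMN.mul_right (∫ x, ‖φ x‖))
    rw [← integral_const_mul]
    refine integral_mono (hint z).norm (hφ.norm.const_mul _) fun x => ?_
    simp only
    rw [norm_mul]
    exact mul_le_mul_of_nonneg_right (hb z x) (norm_nonneg _)

/-- The Fourier transform of a product of two blocks, tested against `φ`, in terms of the factors. -/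
theorem integral_box_mul_box {f g : GelfandShilovDual n s} (hg : HasSummableBlocks ρ g)
    {φ : Space n → ℂ} (hφ : φ ∈ GelfandShilov n s) (l m : Fin n → ℤ) :
    (fun ξ => (sigma ρ l ξ : ℂ) * ((normConst n : ℂ) *
        pair g (fourierT fun η => (sigma ρ m η : ℂ) * φ (η + ξ)))) ∈ GelfandShilov n s ∧
    ∫ x, box ρ l f x * box ρ m g x * fourierT φ x =
      pair f (fourierT fun ξ => (sigma ρ l ξ : ℂ) * ((normConst n : ℂ) *
        pair g (fourierT fun η => (sigma ρ m η : ℂ) * φ (η + ξ)))) := by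
  obtain ⟨M, hM, hb⟩ := hg
  have hw : HasDecay s fun x => box ρ m g x * fourierT φ x :=
    (GelfandShilov.hasDecay (GelfandShilov.fourierT hs hφ)).mul_bounded
      (continuous_box hs hρ hgs m g).aestronglyMeasurable (hb m)
  -- The exchange formula for `g` identifies the inner pairing with the transform of `□_m g · F φ`
  -- at `-ξ`. That function has decay, so the exchange formula for `f` applies next.
  have e : (fun ξ => (sigma ρ l ξ : ℂ) * ((normConst n : ℂ) *
        pair g (fourierT fun η => (sigma ρ m η : ℂ) * φ (η + ξ)))) =
      fun ξ => (sigma ρ l ξ : ℂ) * fourierT (fun x => box ρ m g x * fourierT φ x) (-ξ) := by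
    ext ξ
    have hφξ : (fun η => φ (η + ξ)) ∈ GelfandShilov n s := by
      simpa using GelfandShilov.translate hs hφ (-ξ)
    rw [(pair_fourierT_mul' hs g (hρ.sigma_mem hs hgs m) hφξ).2]
    congr 2
    · refine integral_congr_ae (Eventually.of_forall fun y => ?_)
      simp only
      rw [fourierT_translate, ← box_eq_specWin, inner_neg_right, real_inner_comm]
      push_cast
      rw [mul_neg, neg_neg]
      ring
  rw [e]
  obtain ⟨h1, -, h2⟩ := pair_fourierT_mul hs f (hρ.sigma_mem hs hgs l) hw
  refine ⟨h1, ?_⟩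
  rw [h2, ← box_eq_specWin]
  refine integral_congr_ae (Eventually.of_forall fun y => ?_)
  simp only
  ring

end Representation

/-! ### Blocks and Fourier support of a product -/

section Products

variable {n : ℕ} {s : ℝ} {ρ : Space n → ℝ} {p q q' : ℝ≥0∞}

lemma pair_fourierT_zero (T : GelfandShilovDual n s) : pair T (fourierT fun _ => 0) = 0 := by
  have : fourierT (fun _ : Space n => (0 : ℂ)) = 0 := by
    ext ξ
    simp [fourierT]
  rw [this, pair_zero]

/-- Coordinates with a common sign cannot cancel, so absolute values add. The control of the
summands by the sum supplies compactness in `IsProduct.fourierSupport_subset`. -/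
lemma add_mem_orthantP {ε : Fin n → Fin 2} {R : ℝ} {a b : Space n} (ha : a ∈ orthantP ε R)
    (hb : b ∈ orthantP ε R) :
    a + b ∈ orthantP ε R ∧ (∀ i, |a i| ≤ ‖a + b‖) ∧ ∀ i, |b i| ≤ ‖a + b‖ := by
  rw [mem_orthantP_iff] at ha hb ⊢
  obtain ⟨ha1, j, hj⟩ := ha
  have h1 : ∀ i, |(a + b) i| = |a i| + |b i| := by
    intro i
    have h2 := ha1 i
    have h3 := hb.1 i
    rw [PiLp.add_apply]
    rcases orthantSign_eq ε i with h | h <;> rw [h] at h2 h3 <;> norm_num at h2 h3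
    · rw [abs_of_pos h2, abs_of_pos h3, abs_of_pos (by linarith)]
    · rw [abs_of_neg h2, abs_of_neg h3, abs_of_neg (by linarith)]
      ring
  refine ⟨⟨fun i => ?_, j, ?_⟩, fun i => ?_, fun i => ?_⟩
  · rw [PiLp.add_apply, mul_add]
    exact add_pos (ha1 i) (hb.1 i)
  · rw [h1]
    linarith [abs_nonneg (b j)]
  · refine le_trans ?_ (abs_apply_le_norm (a + b) i)
    rw [h1]
    linarith [abs_nonneg (b i)]
  · refine le_trans ?_ (abs_apply_le_norm (a + b) i)
    rw [h1]
    linarith [abs_nonneg (a i)]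

variable (hs : 1 ≤ s) (hρ : IsDecompositionWindow ρ) (hgs : (fun ξ => (ρ ξ : ℂ)) ∈ GelfandShilov n s)
include hs hρ hgs

lemma IsRepresentedBy.ae_eq {T : GelfandShilovDual n s} {u v : Space n → ℂ} (hu : IsRepresentedBy T u)
    (hv : IsRepresentedBy T v) : u =ᵐ[volume] v := by
  obtain ⟨M, hM0, hM⟩ := hu.exists_bound
  obtain ⟨N, hN0, hN⟩ := hv.exists_bound
  have h := ae_eq_zero_of_integral_eq_zero hs hρ hgs (u := fun x => u x - v x)
    (hu.1.1.sub hv.1.1) (add_nonneg hM0 hN0)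
    (by filter_upwards [hM, hN] with x h1 h2 using (norm_sub_le _ _).trans (add_le_add h1 h2))
    (fun φ hφ => by
      have hi := GelfandShilov.integrable (by linarith) hφ
      have e : ∀ x, (u x - v x) * φ x = u x * φ x - v x * φ x := fun x => sub_mul _ _ _
      simp only [e]
      rw [integral_sub (hi.bdd_mul hu.1.1 hM) (hi.bdd_mul hv.1.1 hN), ← hu.2 ⟨φ, hφ⟩, ← hv.2 ⟨φ, hφ⟩,
        sub_self])
  filter_upwards [h] with x hx using sub_eq_zero.mp hx

lemma exists_isProduct {f g : GelfandShilovDual n s} (hf : HasSummableBlocks ρ f)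
    (hg : HasSummableBlocks ρ g) : ∃ h : GelfandShilovDual n s, IsProduct f g h := by
  obtain ⟨M, hM⟩ := hf.exists_bound
  obtain ⟨N, hN⟩ := hg.exists_bound
  obtain ⟨h, hh⟩ := exists_isRepresentedBy (s := s) (by linarith)
    ((continuous_blockSum hs hρ hgs hf).mul (continuous_blockSum hs hρ hgs hg)).aestronglyMeasurable
    (M := M * N) (fun x => by
      change ‖blockSum ρ f x * blockSum ρ g x‖ ≤ _
      rw [norm_mul]
      exact mul_le_mul (hM x) (hN x) (norm_nonneg _) ((norm_nonneg _).trans (hM x)))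
  exact ⟨h, _, _, isRepresentedBy_blockSum hs hρ hgs hf, isRepresentedBy_blockSum hs hρ hgs hg, hh⟩

/-- Representatives agree almost everywhere with the block sums, so the expansion holds for
whichever representatives define the product. -/
lemma IsProduct.pair_eq {f g h : GelfandShilovDual n s} (hf : HasSummableBlocks ρ f)
    (hg : HasSummableBlocks ρ g) (hh : IsProduct f g h) {φ : Space n → ℂ} (hφ : φ ∈ GelfandShilov n s) :
    pair h φ = ∑' z : (Fin n → ℤ) × (Fin n → ℤ), ∫ x, box ρ z.1 f x * box ρ z.2 g x * φ x := by
  obtain ⟨u, v, hu, hv, huv⟩ := hh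
  rw [← integral_blockSum_mul hs hρ hgs hf hg (GelfandShilov.integrable (by linarith) hφ),
    pair_of_mem hφ, huv.2]
  refine integral_congr_ae ?_
  filter_upwards [IsRepresentedBy.ae_eq hs hρ hgs hu (isRepresentedBy_blockSum hs hρ hgs hf),
    IsRepresentedBy.ae_eq hs hρ hgs hv (isRepresentedBy_blockSum hs hρ hgs hg)] with x h1 h2
  simp only [h1, h2]

/-- Almost orthogonality of products of blocks. -/
lemma integral_box_mul_box_eq_zero {f g : GelfandShilovDual n s} (hg : HasSummableBlocks ρ g)
    {k l m : Fin n → ℤ} (h : l + m - k ∉ intBox n 3) (x : Space n) :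
    ∫ y, box ρ l f y * box ρ m g y * fourierT (fun η =>
      (sigma ρ k η : ℂ) * Complex.exp (Complex.I * ((inner ℝ x η : ℝ) : ℂ))) y = 0 := by
  rw [(integral_box_mul_box hs hρ hgs hg
    (GelfandShilov.modulate hs (hρ.sigma_mem hs hgs k) x) l m).2]
  refine Eq.trans ?_ (pair_fourierT_zero f)
  congr 2
  ext ξ
  by_cases hξ : sigma ρ l ξ = 0
  · simp [hξ]
  have h0 : (fun η => (sigma ρ m η : ℂ) * ((sigma ρ k (η + ξ) : ℂ) *
      Complex.exp (Complex.I * ((inner ℝ x (η + ξ) : ℝ) : ℂ)))) = fun _ => 0 := by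
    ext η
    by_contra hcon
    have h1 : sigma ρ m η ≠ 0 := by
      rintro h2
      exact hcon (by simp [h2])
    have h2 : sigma ρ k (η + ξ) ≠ 0 := by
      rintro h2
      exact hcon (by simp [h2])
    refine h (mem_intBox.mpr fun i => ?_)
    have h3 := abs_le.mp (hρ.sigma_ne_zero hξ i)
    have h4 := abs_le.mp (hρ.sigma_ne_zero h1 i)
    have h5 := abs_le.mp (hρ.sigma_ne_zero h2 i)
    rw [PiLp.add_apply] at h5
    have h6 : |(l i : ℝ) + m i - k i| ≤ 3 := by
      rw [abs_le]
      constructor <;> linarith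
    exact_mod_cast h6
  rw [h0, pair_fourierT_zero]
  simp

/-- Seen from `f`, the test function is supported in the differences of points of `tsupport φ` and
of the Fourier support of `g`, which miss the Fourier support of `f`. Localising by `σ_m` makes this
set of differences compact, hence closed. -/
lemma integral_box_mul_box_eq_zero_of_disjoint {f g : GelfandShilovDual n s}
    (hg : HasSummableBlocks ρ g) {φ : Space n → ℂ} (hφ : φ ∈ GelfandShilov n s)
    (hc : HasCompactSupport φ)
    (hd : ∀ a ∈ fourierSupport f, ∀ b ∈ fourierSupport g, a + b ∉ tsupport φ) (l m : Fin n → ℤ) :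
    ∫ y, box ρ l f y * box ρ m g y * fourierT φ y = 0 := by
  obtain ⟨h1, h2⟩ := integral_box_mul_box (f := f) hs hρ hgs hg hφ l m
  rw [h2]
  set B : Set (Space n) := fourierSupport g ∩ tsupport fun ξ => (sigma ρ m ξ : ℂ)
  have hB : IsCompact B :=
    (hasCompactSupport_sigma hρ m).isCompact.inter_left (isClosed_fourierSupport g)
  set K : Set (Space n) := (fun z : Space n × Space n => z.1 - z.2) '' (tsupport φ ×ˢ B)
  have hK : IsCompact K := (hc.isCompact.prod hB).image (by fun_prop)
  refine pair_fourierT_eq_zero_of_disjoint hs hρ hgs f h1 ?_ ?_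
  · exact (hasCompactSupport_sigma hρ l).mul_right
  · have hsub : tsupport (fun ξ => (sigma ρ l ξ : ℂ) * ((normConst n : ℂ) *
        pair g (fourierT fun η => (sigma ρ m η : ℂ) * φ (η + ξ)))) ⊆ K := by
      refine closure_minimal (fun ξ hξ => ?_) hK.isClosed
      by_contra hcon
      refine hξ ?_
      have hφξ : (fun η => φ (η + ξ)) ∈ GelfandShilov n s := by
        simpa using GelfandShilov.translate hs hφ (-ξ)
      have h3 : pair g (fourierT fun η => (sigma ρ m η : ℂ) * φ (η + ξ)) = 0 := by
        refine pair_fourierT_eq_zero_of_disjoint hs hρ hgs g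
          (GelfandShilov.mul (by linarith) (hρ.sigma_mem hs hgs m) hφξ)
          (hasCompactSupport_sigma hρ m).mul_right ?_
        rw [Set.disjoint_left]
        intro η h4 h5
        refine hcon ⟨(η + ξ, η), ⟨?_, h5, tsupport_mul_subset_left h4⟩, by simp⟩
        have h6 := tsupport_mul_subset_right h4
        exact tsupport_comp_subset_preimage φ (f := fun η => η + ξ) (by fun_prop) h6
      simp [h3]
    rw [Set.disjoint_left]
    intro ξ h3 h4
    obtain ⟨⟨t, b⟩, ⟨ht, hb, -⟩, htb⟩ := hsub h3
    refine hd ξ h4 b hb ?_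
    simp only at htb ht
    rwa [← htb, sub_add_cancel]

/-- The Fourier support of a product lies in the same piece of the orthant. -/
theorem IsProduct.fourierSupport_subset {f g h : GelfandShilovDual n s} (hf : HasSummableBlocks ρ f)
    (hg : HasSummableBlocks ρ g) (hh : IsProduct f g h) {ε : Fin n → Fin 2} {R : ℝ}
    (hfR : fourierSupport f ⊆ orthantP ε R) (hgR : fourierSupport g ⊆ orthantP ε R) :
    fourierSupport h ⊆ orthantP ε R := by
  intro ξ hξ
  by_contra hcon
  set r := n * (‖ξ‖ + 1)
  -- A sum of closed sets need not be closed, and `P_R(ε)` is not closed either. Near `ξ` only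
  -- summands of norm at most `r` matter, and cutting both supports to that ball makes the sum
  -- compact.
  set S : Set (Space n) := (fun z : Space n × Space n => z.1 + z.2) ''
    ((fourierSupport f ∩ Metric.closedBall 0 r) ×ˢ (fourierSupport g ∩ Metric.closedBall 0 r))
  have hS : IsCompact S := (((isCompact_closedBall 0 r).inter_left (isClosed_fourierSupport f)).prod
    ((isCompact_closedBall 0 r).inter_left (isClosed_fourierSupport g))).image (by fun_prop)
  have hξS : ξ ∉ S := by
    rintro ⟨⟨a, b⟩, ⟨ha, hb⟩, hab⟩
    exact hcon (hab ▸ (add_mem_orthantP (hfR ha.1) (hgR hb.1)).1)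
  obtain ⟨φ, hφ, hc, hsupp, hne⟩ := hξ (Metric.ball ξ 1 ∩ Sᶜ)
    (Metric.isOpen_ball.inter hS.isClosed.isOpen_compl) ⟨Metric.mem_ball_self one_pos, hξS⟩
  refine hne ?_
  rw [IsProduct.pair_eq hs hρ hgs hf hg hh (GelfandShilov.fourierT hs hφ)]
  have hz : ∀ z : (Fin n → ℤ) × (Fin n → ℤ),
      ∫ x, box ρ z.1 f x * box ρ z.2 g x * fourierT φ x = 0 := fun z => by
    refine integral_box_mul_box_eq_zero_of_disjoint hs hρ hgs hg hφ hc (fun a ha b hb hab => ?_) _ _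
    obtain ⟨h1, h2⟩ := hsupp hab
    refine h2 ⟨(a, b), ⟨⟨ha, ?_⟩, hb, ?_⟩, rfl⟩
    all_goals
      have h3 : ‖a + b‖ ≤ ‖ξ‖ + 1 := by
        rw [Metric.mem_ball, dist_eq_norm] at h1
        have := norm_add_le (a + b - ξ) ξ
        rw [sub_add_cancel] at this
        linarith
      obtain ⟨-, h4, h5⟩ := add_mem_orthantP (hfR ha) (hgR hb)
      rw [Metric.mem_closedBall, dist_zero_right]
    · exact norm_le_of_abs_le (by positivity) fun i => (h4 i).trans h3
    · exact norm_le_of_abs_le (by positivity) fun i => (h5 i).trans h3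
  simp [hz]

open Classical in
/-- The blocks of a product. -/
lemma IsProduct.eLpNorm_box_le (hp : 1 ≤ p) {f g h : GelfandShilovDual n s} (hf : HasSummableBlocks ρ f)
    (hg : HasSummableBlocks ρ g) (hh : IsProduct f g h) (k : Fin n → ℤ) :
    eLpNorm (box ρ k h) p volume ≤ ∑' z : (Fin n → ℤ) × (Fin n → ℤ),
      if z.1 + z.2 - k ∈ intBox n 3 then kernelConst ρ * bernsteinConst ρ p *
        (eLpNorm (box ρ z.1 f) p volume * eLpNorm (box ρ z.2 g) p volume) else 0 := by
  have hp0 : p ≠ 0 := (zero_lt_one.trans_le hp).ne'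
  set κ : Space n → ℝ≥0∞ := fun y => ‖fourierT (fun ξ => (sigma ρ 0 ξ : ℂ)) y‖ₑ with hκdef
  have hκ : Measurable κ := (GelfandShilov.continuous
    (GelfandShilov.fourierT hs (hρ.sigma_mem hs hgs 0))).enorm.measurable
  have hm : ∀ (T : GelfandShilovDual n s) l, Measurable fun y => ‖box ρ l T y‖ₑ := fun T l =>
    (continuous_box hs hρ hgs l T).enorm.measurable
  let F : (Fin n → ℤ) × (Fin n → ℤ) → Space n → ℝ≥0∞ := fun z x =>
    if z.1 + z.2 - k ∈ intBox n 3 then ENNReal.ofReal (normConst n) *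
      ∫⁻ y, (‖box ρ z.1 f y‖ₑ * ‖box ρ z.2 g y‖ₑ) * κ (y - x) else 0
  have hFint : ∀ z : (Fin n → ℤ) × (Fin n → ℤ), Measurable fun x : Space n =>
      ∫⁻ y, (‖box ρ z.1 f y‖ₑ * ‖box ρ z.2 g y‖ₑ) * κ (y - x) := by
    intro z
    have h1 := hm f z.1
    have h2 := hm g z.2
    exact Measurable.lintegral_prod_right' (f := fun w : Space n × Space n =>
      (‖box ρ z.1 f w.2‖ₑ * ‖box ρ z.2 g w.2‖ₑ) * κ (w.2 - w.1))
      (((h1.comp measurable_snd).mul (h2.comp measurable_snd)).mul (hκ.comp (by fun_prop)))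
  have hpt : ∀ x, ‖box ρ k h x‖ₑ ≤ ∑' z, F z x := by
    intro x
    have hmod := GelfandShilov.modulate hs (hρ.sigma_mem hs hgs k) x
    -- Up to a unimodular factor, the kernel is a translate of the one for `σ_0`.
    have hker : ∀ y, ‖fourierT (fun η => (sigma ρ k η : ℂ) *
        Complex.exp (Complex.I * ((inner ℝ x η : ℝ) : ℂ))) y‖ₑ = κ (y - x) := by
      intro y
      rw [fourierT_modulate, hκdef]
      simp only [IsDecompositionWindow.sigma_eq_translate k]
      exact enorm_fourierT_translate (fun ξ => (sigma ρ 0 ξ : ℂ)) (latticePt k) (y - x)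
    have h2 : ‖(((2 * Real.pi) ^ (-(n : ℝ) / 2) : ℝ) : ℂ)‖ₑ = ENNReal.ofReal (normConst n) := by
      rw [← ofReal_norm, Complex.norm_real, Real.norm_of_nonneg (by positivity)]
      rfl
    unfold box
    rw [IsProduct.pair_eq hs hρ hgs hf hg hh (GelfandShilov.fourierT hs hmod), enorm_mul, h2]
    refine (mul_le_mul_right enorm_tsum_le_tsum_enorm _).trans ?_
    rw [← ENNReal.tsum_mul_left]
    refine ENNReal.tsum_le_tsum fun z => ?_
    simp only [F]
    split_ifs with hz
    · refine mul_le_mul_right ((enorm_integral_le_lintegral_enorm _).trans (le_of_eq ?_)) _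
      simp only [enorm_mul, hker]
    · rw [integral_box_mul_box_eq_zero hs hρ hgs hg hz]
      simp
  calc eLpNorm (box ρ k h) p volume ≤ eLpNorm (fun x => ∑' z, F z x) p volume :=
        eLpNorm_mono_enorm hpt
    _ ≤ ∑' z, eLpNorm (F z) p volume := by
        refine eLpNorm_tsum_le (fun z => ?_) hp
        simp only [F]
        split_ifs
        · exact (hFint z).const_mul _
        · exact measurable_const
    _ ≤ _ := by
        refine ENNReal.tsum_le_tsum fun z => ?_
        simp only [F]
        split_ifs
        · rw [eLpNorm_ennreal_const_mul _ (hFint z) hp0, kernelConst, mul_assoc, mul_assoc]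
          refine mul_le_mul_right ((eLpNorm_lintegral_kernel_le ((hm f z.1).mul (hm g z.2)) hκ
            hp).trans (mul_le_mul_right ?_ _)) _
          -- Bernstein is spent on the block of `g`; the block of `f` keeps its `Lᵖ` norm.
          calc eLpNorm (fun y => ‖box ρ z.1 f y‖ₑ * ‖box ρ z.2 g y‖ₑ) p volume
              ≤ eLpNorm (fun y => (bernsteinConst ρ p * eLpNorm (box ρ z.2 g) p volume) *
                ‖box ρ z.1 f y‖ₑ) p volume := by
                refine eLpNorm_mono_enorm fun y => ?_
                rw [enorm_eq_self, enorm_eq_self, mul_comm]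
                exact mul_le_mul_left (enorm_box_le hs hρ hgs hp z.2 g y) _
            _ = _ := by
                rw [eLpNorm_ennreal_const_mul _ (hm f z.1) hp0, eLpNorm_enorm]
                ring
        · simp

end Products

/-! ### The strict subadditivity of the weight -/

section WeightInequality

/-- The points `x` and `2y` are complementary convex combinations of `y` and `x + y`, with weights
`y/x` and `1 - y/x`. Adding the two concavity inequalities gives `y^θ + (x+y)^θ ≤ x^θ + (2y)^θ`,
which is where `2 - 2^(1/s)` comes from. -/
lemma rpow_add_le_of_le {θ x y : ℝ} (hθ0 : 0 < θ) (hθ : θ ≤ 1) (hy : 0 ≤ y) (hxy : y ≤ x) :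
    (x + y) ^ θ + (2 - 2 ^ θ) * y ^ θ ≤ x ^ θ + y ^ θ := by
  rcases hy.eq_or_lt with rfl | hy0
  · rw [Real.zero_rpow hθ0.ne']
    simp
  have hx0 : 0 < x := hy0.trans_le hxy
  have hc := Real.concaveOn_rpow hθ0.le hθ
  have ht0 : 0 ≤ y / x := by positivity
  have ht1 : 0 ≤ 1 - y / x := sub_nonneg.mpr ((div_le_one hx0).mpr hxy)
  have h1 := hc.2 (mem_Ici.mpr hy) (mem_Ici.mpr (by linarith : 0 ≤ x + y)) ht0 ht1 (by ring)
  have h2 := hc.2 (mem_Ici.mpr hy) (mem_Ici.mpr (by linarith : 0 ≤ x + y)) ht1 ht0 (by ring)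
  simp only [smul_eq_mul] at h1 h2
  have e1 : y / x * y + (1 - y / x) * (x + y) = x := by
    field_simp
    ring
  have e2 : (1 - y / x) * y + y / x * (x + y) = 2 * y := by
    field_simp
    ring
  rw [e1] at h1
  rw [e2, Real.mul_rpow (by norm_num) hy] at h2
  linarith

/-- The gain belongs to the smaller of `x` and `y`; the sum of both exponentials makes the bound
symmetric, so that it need not be known which one is smaller. -/
lemma exp_rpow_add_le {θ δ x y z t : ℝ} (hθ0 : 0 < θ) (hθ : θ ≤ 1) (hδ : δ ≤ 2 - 2 ^ θ) (hx : 0 ≤ x)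
    (hy : 0 ≤ y) (hz : 0 ≤ z) (ht : 1 ≤ t) (h : z ≤ x + y + t) :
    Real.exp (z ^ θ) ≤ Real.exp t * (Real.exp (x ^ θ) * Real.exp (y ^ θ) *
      (Real.exp (-(δ * x ^ θ)) + Real.exp (-(δ * y ^ θ)))) := by
  wlog hxy : y ≤ x generalizing x y
  · have := this hy hx (by linarith) (by linarith)
    rw [mul_comm (Real.exp (x ^ θ)), add_comm (Real.exp (-(δ * x ^ θ)))]
    exact this
  have h1 : z ^ θ ≤ (x + y) ^ θ + t :=
    calc z ^ θ ≤ (x + y + t) ^ θ := Real.rpow_le_rpow hz h hθ0.le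
      _ ≤ (x + y) ^ θ + t ^ θ := Real.rpow_add_le_add_rpow (by linarith) (by linarith) hθ0.le hθ
      _ ≤ (x + y) ^ θ + t := by
        gcongr
        exact (Real.rpow_le_rpow_of_exponent_le ht hθ).trans_eq (Real.rpow_one t)
  have h2 := rpow_add_le_of_le hθ0 hθ hy hxy
  have h3 : δ * y ^ θ ≤ (2 - 2 ^ θ) * y ^ θ := by gcongr
  calc Real.exp (z ^ θ) ≤ Real.exp (t + (x ^ θ + y ^ θ + -(δ * y ^ θ))) := by
        rw [Real.exp_le_exp]
        linarith
    _ = Real.exp t * (Real.exp (x ^ θ) * Real.exp (y ^ θ) * Real.exp (-(δ * y ^ θ))) := by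
        rw [Real.exp_add, Real.exp_add, Real.exp_add]
    _ ≤ _ := by
        gcongr
        linarith [Real.exp_pos (-(δ * x ^ θ))]

end WeightInequality

/-! ### The norm estimate for products -/

section Algebra

variable {n : ℕ} {s δ : ℝ} {ρ : Space n → ℝ} {p q q' : ℝ≥0∞}

/-- The constant in the estimate of the product. -/
noncomputable def productConst (ρ : Space n → ℝ) (p : ℝ≥0∞) : ℝ≥0∞ :=
  ENNReal.ofReal (Real.exp (3 * n)) * (kernelConst ρ * bernsteinConst ρ p) *
    (2 * ((intBox n 3).card : ℝ≥0∞))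

variable (hs : 1 ≤ s) (hρ : IsDecompositionWindow ρ) (hgs : (fun ξ => (ρ ξ : ℂ)) ∈ GelfandShilov n s)
include hs hρ hgs

lemma productConst_lt_top : productConst ρ p < ∞ := by
  have h1 := bernsteinConst_lt_top (p := p) hs hρ hgs
  have h2 := kernelConst_lt_top hs hρ hgs
  unfold productConst
  finiteness

/-- Unless both indices are near the piece, a block vanishes. Otherwise the weight inequality
applies with `t = 3n`, the norm bound for vectors of the box. -/
lemma weighted_eLpNorm_mul_le (hn : 1 ≤ n) (hδ : δ ≤ 2 - 2 ^ (1 / s)) {f g : GelfandShilovDual n s}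
    {ε : Fin n → Fin 2} {R : ℝ}
    (hfR : fourierSupport f ⊆ orthantP ε R) (hgR : fourierSupport g ⊆ orthantP ε R)
    {k l m : Fin n → ℤ} (h : l + m - k ∈ intBox n 3) :
    ENNReal.ofReal (Real.exp (‖(latticePt k : Space n)‖ ^ (1 / s))) *
      (eLpNorm (box ρ l f) p volume * eLpNorm (box ρ m g) p volume) ≤
    ENNReal.ofReal (Real.exp (3 * n)) * (blockNorm ρ p f l * blockNorm ρ p g m *
      (pieceWeight s δ ε R l + pieceWeight s δ ε R m)) := by
  have hn' : (1 : ℝ) ≤ n := by exact_mod_cast hn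
  have hs0 : 0 < s := by linarith
  by_cases hl : l ∈ nearPiece ε R
  swap
  · rw [box_eq_zero_of_notMem hs hρ hgs hfR hl]
    simp
  by_cases hm : m ∈ nearPiece ε R
  swap
  · rw [box_eq_zero_of_notMem hs hρ hgs hgR hm]
    simp
  have hk : ‖(latticePt k : Space n)‖ ≤ ‖(latticePt l : Space n)‖ + ‖(latticePt m : Space n)‖ + 3 * n := by
    have h1 : ‖(latticePt (l + m - k) : Space n)‖ ≤ n * 3 :=
      norm_le_of_abs_le (by norm_num) fun i => by
        have h0 : (((|(l + m - k) i| : ℤ)) : ℝ) ≤ (((3 : ℕ) : ℤ) : ℝ) :=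
          Int.cast_le.mpr (mem_intBox.mp h i)
        rw [latticePt_apply, ← Int.cast_abs]
        exact h0.trans (by norm_num)
    have h2 : (latticePt k : Space n) = latticePt l + latticePt m - latticePt (l + m - k) := by
      rw [latticePt_sub, latticePt_add]
      abel
    rw [h2]
    have h3 := norm_sub_le ((latticePt l : Space n) + latticePt m) (latticePt (l + m - k))
    have h4 := norm_add_le (latticePt l : Space n) (latticePt m)
    linarith
  have key := exp_rpow_add_le (θ := 1 / s) (by positivity) ((div_le_one hs0).mpr hs) hδ
    (norm_nonneg _) (norm_nonneg _) (norm_nonneg _) (by linarith) hk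
  have key' := ENNReal.ofReal_le_ofReal key
  rw [ENNReal.ofReal_mul (by positivity), ENNReal.ofReal_mul (by positivity),
    ENNReal.ofReal_mul (by positivity), ENNReal.ofReal_add (by positivity) (by positivity)] at key'
  simp only [pieceWeight, hl, hm, if_true, blockNorm]
  refine (mul_le_mul_left key' _).trans (le_of_eq ?_)
  ring

theorem IsProduct.blockNorm_le (hn : 1 ≤ n) (hp : 1 ≤ p) (hδ : δ ≤ 2 - 2 ^ (1 / s))
    {f g h : GelfandShilovDual n s} (hf : HasSummableBlocks ρ f) (hg : HasSummableBlocks ρ g)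
    (hh : IsProduct f g h) {ε : Fin n → Fin 2} {R : ℝ} (hfR : fourierSupport f ⊆ orthantP ε R)
    (hgR : fourierSupport g ⊆ orthantP ε R) (k : Fin n → ℤ) :
    blockNorm ρ p h k ≤ ENNReal.ofReal (Real.exp (3 * n)) * (kernelConst ρ * bernsteinConst ρ p) *
      ∑ j ∈ intBox n 3, ∑' l, blockNorm ρ p f l * blockNorm ρ p g (k - l + j) *
        (pieceWeight s δ ε R l + pieceWeight s δ ε R (k - l + j)) := by
  classical
  set A := ENNReal.ofReal (Real.exp (3 * n)) * (kernelConst ρ * bernsteinConst ρ p)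
  let G : (Fin n → ℤ) → (Fin n → ℤ) → ℝ≥0∞ := fun l m =>
    blockNorm ρ p f l * blockNorm ρ p g m * (pieceWeight s δ ε R l + pieceWeight s δ ε R m)
  calc blockNorm ρ p h k ≤ ∑' z : (Fin n → ℤ) × (Fin n → ℤ),
        if z.1 + z.2 - k ∈ intBox n 3 then A * G z.1 z.2 else 0 := by
        unfold blockNorm
        refine (mul_le_mul_right (IsProduct.eLpNorm_box_le hs hρ hgs hp hf hg hh k) _).trans ?_
        rw [← ENNReal.tsum_mul_left]
        refine ENNReal.tsum_le_tsum fun z => ?_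
        split_ifs with hz
        · have h1 := mul_le_mul_right (weighted_eLpNorm_mul_le (p := p) hs hρ hgs hn hδ hfR hgR hz)
            (kernelConst ρ * bernsteinConst ρ p)
          refine le_of_eq_of_le ?_ (h1.trans (le_of_eq ?_))
          · ring
          · simp only [A, G]
            ring
        · simp
    _ = ∑' l, ∑' m, if l + m - k ∈ intBox n 3 then A * G l m else 0 :=
        ENNReal.tsum_prod (f := fun l m => if l + m - k ∈ intBox n 3 then A * G l m else 0)
    -- The second index is `m = k - l + j` with `j` in the box, which gives finitely many discrete
    -- convolutions.
    _ = ∑' l, ∑ j ∈ intBox n 3, A * G l (k - l + j) := by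
        refine tsum_congr fun l => ?_
        rw [← (Equiv.addLeft (k - l)).tsum_eq, tsum_eq_sum (s := intBox n 3)]
        · refine Finset.sum_congr rfl fun j hj => ?_
          have e : l + (Equiv.addLeft (k - l)) j - k = j := by
            simp only [Equiv.coe_addLeft]
            abel
          rw [e, if_pos hj]
          rfl
        · intro j hj
          have e : l + (Equiv.addLeft (k - l)) j - k = j := by
            simp only [Equiv.coe_addLeft]
            abel
          rw [e, if_neg hj]
    _ = _ := by
        rw [Summable.tsum_finsetSum fun _ _ => ENNReal.summable, Finset.mul_sum]
        refine Finset.sum_congr rfl fun j _ => ?_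
        rw [ENNReal.tsum_mul_left]

theorem IsProduct.gmNorm_le (hn : 1 ≤ n) (hp : 1 ≤ p) (hq : 1 ≤ q) (hqq : q⁻¹ + q'⁻¹ = 1)
    (hδ : δ ≤ 2 - 2 ^ (1 / s)) {f g h : GelfandShilovDual n s} (hf : HasSummableBlocks ρ f)
    (hg : HasSummableBlocks ρ g) (hh : IsProduct f g h) {ε : Fin n → Fin 2} {R : ℝ}
    (hfR : fourierSupport f ⊆ orthantP ε R) (hgR : fourierSupport g ⊆ orthantP ε R) :
    gmNorm ρ p q h ≤ productConst ρ p * seqNorm q' (pieceWeight s δ ε R) *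
      (gmNorm ρ p q f * gmNorm ρ p q g) := by
  have hq0 : q ≠ 0 := (zero_lt_one.trans_le hq).ne'
  simp only [gmNorm_eq_seqNorm hq0]
  refine (seqNorm_mono (IsProduct.blockNorm_le hs hρ hgs hn hp hδ hf hg hh hfR hgR)).trans ?_
  rw [seqNorm_const_mul hq0]
  refine (mul_le_mul_right (seqNorm_bilinear_le hq hqq _ _ _ _) _).trans (le_of_eq ?_)
  unfold productConst
  ring

end Algebra

end GevreyModulation

theorem proposition3p12 (n : ℕ) (hn : 1 ≤ n) (p : ℝ≥0∞) (hp : 1 ≤ p)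
    (ρ : EuclideanSpace ℝ (Fin n) → ℝ) (hρ : IsDecompositionWindow ρ) :
    ∃ C₀ : ℝ, 0 < C₀ ∧
      ∀ s : ℝ, 1 < s → (fun ξ => (ρ ξ : ℂ)) ∈ GelfandShilov n s →
      ∀ q q' : ℝ≥0∞, 1 ≤ q → q⁻¹ + q'⁻¹ = 1 →
      ∀ δ : ℝ, 0 < δ → δ ≤ 2 - (2 : ℝ) ^ (1 / s) →
        Tendsto (fun R : ℝ => algebraConst n C₀ s δ q' R) atTop (𝓝 0) ∧
        ∀ (ε : Fin n → Fin 2) (R : ℝ), 0 < R →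
          (∃ V : Submodule ℂ (GelfandShilovDual n s),
            (V : Set (GelfandShilovDual n s)) = GMPiece ρ s p q ε R) ∧
          ∀ f ∈ GMPiece ρ s p q ε R, ∀ g ∈ GMPiece ρ s p q ε R,
            (∃ h : GelfandShilovDual n s, IsProduct f g h) ∧
            ∀ h : GelfandShilovDual n s, IsProduct f g h →
              h ∈ GMPiece ρ s p q ε R ∧
              gmNorm ρ p q h ≤ ENNReal.ofReal (algebraConst n C₀ s δ q' R) *
                gmNorm ρ p q f * gmNorm ρ p q g := by
  -- `productConst` involves only `n`, `p` and `ρ`, and the exponential is the loss of the lattice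
  -- comparison. The `1` ensures positivity; finiteness of `productConst` is invoked only once `ρ ∈
  -- S_s` is available.
  refine ⟨((productConst ρ p).toReal + 1) * Real.exp (3 * n), by positivity,
    fun s hs hgs q q' hq hqq δ hδ0 hδ => ?_⟩
  have hs1 : 1 ≤ s := hs.le
  have hs0 : 0 < s := by linarith
  have hq' : q' ≠ 0 := by rintro rfl; simp at hqq
  -- `2^(1/s) ≥ 1`, so the admissible gain never exceeds the full weight.
  have hδ1 : δ ≤ 1 := by
    have := Real.one_le_rpow (x := 2) (z := 1 / s) (by norm_num) (by positivity)
    linarith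
  refine ⟨tendsto_algebraConst hn hs0 _ hδ0 hq', fun ε R hR =>
    ⟨exists_submodule_eq_GMPiece hs1 hρ hgs hp hq ε R, fun f hf g hg => ?_⟩⟩
  have hfb := hasSummableBlocks hs1 hρ hgs hn hp hq hqq hR.le hδ0 hδ1 hf
  have hgb := hasSummableBlocks hs1 hρ hgs hn hp hq hqq hR.le hδ0 hδ1 hg
  refine ⟨exists_isProduct hs1 hρ hgs hfb hgb, fun h hh => ?_⟩
  have hC : productConst ρ p ≤ ENNReal.ofReal ((productConst ρ p).toReal + 1) := by
    rw [← ENNReal.ofReal_toReal (productConst_lt_top hs1 hρ hgs).ne]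
    refine ENNReal.ofReal_le_ofReal ?_
    rw [ENNReal.toReal_ofReal ENNReal.toReal_nonneg]
    linarith
  have hbound : gmNorm ρ p q h ≤
      ENNReal.ofReal (algebraConst n (((productConst ρ p).toReal + 1) * Real.exp (3 * n)) s δ q' R) *
        gmNorm ρ p q f * gmNorm ρ p q g := by
    refine (IsProduct.gmNorm_le hs1 hρ hgs hn hp hq hqq hδ hfb hgb hh hf.2 hg.2).trans ?_
    rw [algebraConst_mul, ENNReal.ofReal_mul (by positivity), mul_assoc _ (gmNorm ρ p q f)]
    exact mul_le_mul_left (mul_le_mul' hC (seqNorm_pieceWeight_le hn hs1 hδ0 hδ1 hR.le hq')) _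
  exact ⟨⟨hbound.trans_lt (ENNReal.mul_lt_top (ENNReal.mul_lt_top ENNReal.ofReal_lt_top hf.1) hg.1),
    IsProduct.fourierSupport_subset hs1 hρ hgs hfb hgb hh hf.2 hg.2⟩, hbound⟩
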